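/- Let $d\ge 1$, let $\Omega\subset\mathbb{R}^d$ be a nonempty bounded open set with Lipschitz boundary, and let $A:\mathbb{R}^d\to\mathbb{R}^{d\times d}$ be measurable, with $A(x)$ symmetric and $a_*|z|^2\le A(x)z\cdot z\le a^*|z|^2$ for almost every $x\in\mathbb{R}^d$ and all $z\in\mathbb{R}^d$, where $a_*>0$. For $0<s<1$ and $\Phi\in C_c^\infty(\mathbb{R}^d)^d$ put \[D^s\cdot\Phi(x)=c_{d,s}\int_{\mathbb{R}^d}\frac{\Phi(x)-\Phi(y)}{|x-y|^{d+s}}\cdot\frac{x-y}{|x-y|}\,dy,\qquad c_{d,s}=2^s\pi^{-d/2}\,\frac{\Gamma\left(\frac{d+s+1}{2}\right)}{\Gamma\left(\frac{1-s}{2}\right)},\] and let $D^1\cdot\Phi$ be the classical divergence. For $0<s\le1$ and $u\in L^2(\mathbb{R}^d)$, the distributional Riesz fractional gradient $D^su$ is the field in $L^2(\mathbb{R}^d)^d$, if there is one, with $\int_{\mathbb{R}^d} D^su\cdot\Phi=-\int_{\mathbb{R}^d} u\,(D^s\cdot\Phi)$ for all $\Phi\in C_c^\infty(\mathbb{R}^d)^d$.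 Let $H^s_0(\Omega)$ be the closure of $C_c^\infty(\Omega)$ with respect to the norm $\left(\|u\|_{L^2(\mathbb{R}^d)}^2+\|D^su\|_{L^2(\mathbb{R}^d)^d}^2\right)^{1/2}$, functions on $\Omega$ being extended by $0$. Let $0<\sigma\le1$. For $s\in[\sigma,1]$ let $T^s:L^2(\Omega)\to L^2(\Omega)$ be the bounded linear operator that maps $h$ to the unique $u^s\in H^s_0(\Omega)$ with \[\int_{\mathbb{R}^d}A\,D^su^s\cdot D^sv\,dx=\int_\Omega hv\,dx\qquad\text{for all }v\in H^s_0(\Omega),\] and let $\lambda_1^s\ge\lambda_2^s\ge\cdots$ be the eigenvalues of $T^s$, each repeated according to its multiplicity. (These operators and sequences are well defined.) Then, for all $k\ge1$ and all $s,r\in[\sigma,1]$, \[|\lambda_k^s-\lambda_k^r|\le\|T^s-T^r\|:=\sup_{\|f\|_{L^2(\Omega)}\le1}\|(T^s-T^r)f\|_{L^2(\Omega)}.\] In particular, for every $k\ge1$ the map $s\mapsto\lambda_k^s\in(0,\infty)$ is continuous on $[\sigma,1]$. -/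

import Mathlib

open MeasureTheory Set
open scoped ContDiff

namespace FracEigen

noncomputable section

/-- The Euclidean space `ℝᵈ`. -/
abbrev E (d : ℕ) : Type := EuclideanSpace ℝ (Fin d)

/-- `L²(ℝᵈ)`. -/
abbrev L2 (d : ℕ) : Type := Lp ℝ 2 (volume : Measure (E d))

/-- `L²(ℝᵈ)ᵈ`, the square integrable vector fields. -/
abbrev L2Vec (d : ℕ) : Type := Lp (E d) 2 (volume : Measure (E d))

/-- `L²(Ω)`. -/
abbrev L2On {d : ℕ} (Ω : Set (E d)) : Type := Lp ℝ 2 (volume.restrict Ω)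

/-- The open set `Ω` has a Lipschitz boundary: near each boundary point `Ω` is, in suitable
orthonormal coordinates with last axis `e`, the set of points strictly above the graph of a
Lipschitz function `g` of the remaining coordinates; `x - ⟪e, x⟫ e` is the projection of `x` to
the hyperplane orthogonal to `e`, and only the values of `g` on that hyperplane matter. -/
def HasLipschitzBoundary {d : ℕ} (Ω : Set (E d)) : Prop :=
  ∀ x₀ ∈ frontier Ω, ∃ e : E d, ‖e‖ = 1 ∧ ∃ (K : NNReal) (g : E d → ℝ), LipschitzWith K g ∧
    ∃ ρ > 0, ∀ x ∈ Metric.ball x₀ ρ, x ∈ Ω ↔ g (x - inner ℝ e x • e) < inner ℝ e x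

/-- `C_c^∞(Ω)`. -/
def IsTestFunction {d : ℕ} (Ω : Set (E d)) (φ : E d → ℝ) : Prop :=
  ContDiff ℝ ∞ φ ∧ HasCompactSupport φ ∧ tsupport φ ⊆ Ω

/-- The normalising constant `c_{d,s} = 2^s π^{-d/2} Γ((d+s+1)/2) / Γ((1-s)/2)`, `0 < s < 1`. -/
def rieszConst (d : ℕ) (s : ℝ) : ℝ :=
  2 ^ s * Real.pi ^ (-(d : ℝ) / 2) * Real.Gamma (((d : ℝ) + s + 1) / 2)
    / Real.Gamma ((1 - s) / 2)

/-- The `s`-divergence `D^s · Φ` of a smooth compactly supported vector field, for `0 < s ≤ 1`: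
the classical divergence if `s = 1`, and otherwise
`c_{d,s} ∫ (Φ(x) - Φ(y)) / |x-y|^{d+s} · (x-y) / |x-y| dy`. -/
def rieszDiv {d : ℕ} (s : ℝ) (Φ : E d → E d) (x : E d) : ℝ :=
  if s = 1 then ∑ i : Fin d, (fderiv ℝ Φ x (EuclideanSpace.single i 1)) i
  else rieszConst d s *
    ∫ y : E d, inner ℝ (Φ x - Φ y) (x - y) / ‖x - y‖ ^ ((d : ℝ) + s + 1)

/-- `G ∈ L²(ℝᵈ)ᵈ` is the distributional Riesz fractional `s`-gradient `D^s u` of `u ∈ L²(ℝᵈ)`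
(the weak gradient if `s = 1`). -/
def IsRieszGradient {d : ℕ} (s : ℝ) (u : L2 d) (G : L2Vec d) : Prop :=
  ∀ Φ : E d → E d, ContDiff ℝ ∞ Φ → HasCompactSupport Φ →
    ∫ x, inner ℝ (G x) (Φ x) = -∫ x, u x * rieszDiv s Φ x

/-- `H^s(ℝᵈ)`, each element `u` being recorded as the pair `(u, D^s u)`; the topology of
`L²(ℝᵈ) × L²(ℝᵈ)ᵈ` on these pairs is that of the norm `(‖u‖² + ‖D^s u‖²)^{1/2}`. -/
def Hs (d : ℕ) (s : ℝ) : Set (L2 d × L2Vec d) :=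
  {p | IsRieszGradient s p.1 p.2}

/-- `H^s_0(Ω)`, the closure of `C_c^∞(Ω)` in `H^s(ℝᵈ)`, again as a set of pairs `(u, D^s u)`. -/
def Hs0 {d : ℕ} (Ω : Set (E d)) (s : ℝ) : Set (L2 d × L2Vec d) :=
  Hs d s ∩ closure {p | p ∈ Hs d s ∧ ∃ φ : E d → ℝ, IsTestFunction Ω φ ∧ p.1 =ᵐ[volume] φ}

/-- `u ∈ L²(Ω)`, extended by zero, belongs to `H^s_0(Ω)` and
`∫_{ℝᵈ} A D^s u · D^s v = ∫_Ω h v` for all `v ∈ H^s_0(Ω)`. -/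
def IsWeakSolution {d : ℕ} (Ω : Set (E d)) (A : E d → Matrix (Fin d) (Fin d) ℝ) (s : ℝ)
    (h u : L2On Ω) : Prop :=
  ∃ p ∈ Hs0 Ω s, p.1 =ᵐ[volume] Ω.indicator u ∧
    ∀ q ∈ Hs0 Ω s,
      ∫ x, inner ℝ (Matrix.toEuclideanLin (A x) (p.2 x)) (q.2 x) = ∫ x in Ω, h x * q.1 x

/-- `T` is the operator `T^s : L²(Ω) → L²(Ω)` mapping `h` to the solution `u^s`. -/
def IsSolutionOperator {d : ℕ} (Ω : Set (E d)) (A : E d → Matrix (Fin d) (Fin d) ℝ) (s : ℝ)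
    (T : L2On Ω →L[ℝ] L2On Ω) : Prop :=
  ∀ h : L2On Ω, IsWeakSolution Ω A s h (T h)

/-- `lam 0 ≥ lam 1 ≥ lam 2 ≥ …` is the list of all eigenvalues of `T`, each repeated according
to its multiplicity (the dimension of its eigenspace); `lam k` is thus the `(k+1)`-st one. -/
def IsEigenvalueSequence {H : Type*} [NormedAddCommGroup H] [NormedSpace ℝ H]
    (T : H →L[ℝ] H) (lam : ℕ → ℝ) : Prop :=
  Antitone lam ∧ ∀ μ : ℝ,
    {k | lam k = μ}.encard
      = Cardinal.toENat (Module.rank ℝ (Module.End.eigenspace (T : H →ₗ[ℝ] H) μ))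

end

end FracEigen

/-! For two compact, symmetric, positive definite operators, eigenvalues of equal index differ by at
most the norm of the difference. The span of the first k+1 eigenvectors of one contains a nonzero v
orthogonal to the first k eigenvectors of the other, and comparing the two quadratic forms at v
gives the bound (`eigenvalue_le_add_norm_sub`). The analytic task is to show that the T^s are such
operators and that s ↦ T^s is continuous in operator norm; continuity of the eigenvalues then
follows.

The fractional gradient is handled on the Fourier side. Its symbol is i(2π)^s|ξ|^(s-1)ξ, the case s
= 1 included (`ft_rieszDiv`), so for u in L¹ ∩ L² of finite energy the squared norm of D^s u is
∫(2π|ξ|)^(2s)|û|². On a bounded Lipschitz domain H^s_0(Ω) consists exactly of the H^s functions that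
vanish off Ω (`mem_Hs0_iff`): cut u into pieces, push each piece into Ω, and mollify. Unlike the
closure that defines the space, this description passes to weak limits while s varies.

For u supported in Ω, û(ξ) is a functional on L² bounded uniformly in ξ. Low frequencies are thus
controlled by the L² norm and high ones by the energy, which gives a Poincaré inequality uniform in
s ∈ (0,1] (`exists_poincare`). Weak convergence makes û converge pointwise, Fatou bounds the energy
of the limit, and the same splitting gives Rellich compactness uniform for orders at least σ
(`tendsto_of_weak_of_energy_le`).

Since D^(s_n)φ → D^sφ in L² for test functions φ, the equation itself passes to the limit: if s_n →
s and h_n converges weakly to h, then a subsequence of T^(s_n)h_n converges strongly to T^s h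
(`exists_subseq_solves`). With constant order this is compactness of T^s; applied to near-maximisers
of ‖(T^(s_n) - T^s)h‖ it is norm convergence (`IsAdmissible.tendsto_operator`). -/

namespace FracEigen

noncomputable section

open Filter Topology Module

/-! ### Eigenvalue sequences of compact positive operators and Weyl's inequality. -/

section Spectral

/-- A family of reals whose superlevel sets are finite can be enumerated in decreasing order. -/
theorem exists_antitone_enumeration {ι : Type*} [Infinite ι] (m : ι → ℝ)
    (hm : ∀ i, {j | m i ≤ m j}.Finite) : ∃ e : ℕ ≃ ι, Antitone (m ∘ e) := by
  classical
  have step : ∀ F : Finset ι, ∃ i, i ∉ F ∧ ∀ j, j ∉ F → m j ≤ m i := by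
    intro F
    obtain ⟨i₀, hi₀⟩ := Infinite.exists_notMem_finset F
    have hfin : ({j | m i₀ ≤ m j} \ (F : Set ι)).Finite := (hm i₀).subset sdiff_subset
    obtain ⟨i, hi, hmax⟩ := Set.exists_max_image _ m hfin ⟨i₀, by simpa using hi₀⟩
    refine ⟨i, by simpa using hi.2, fun j hj => ?_⟩
    by_cases h : m i₀ ≤ m j
    · exact hmax j ⟨h, by simpa using hj⟩
    · exact (le_of_not_ge h).trans hi.1
  choose g hg hgmax using step
  -- Greedy choice: `F n` holds the first n indices selected, and `g` picks a maximiser of `m`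
  -- outside them.
  let F : ℕ → Finset ι := fun n => Nat.rec ∅ (fun _ F => insert (g F) F) n
  have hF : ∀ n, F (n + 1) = insert (g (F n)) (F n) := fun n => rfl
  have hFmono : Monotone F := monotone_nat_of_le_succ fun n => by
    rw [hF]; exact Finset.subset_insert _ _
  have hmem : ∀ n k, n < k → g (F n) ∈ F k := fun n k h =>
    hFmono (Nat.succ_le_of_lt h) (by rw [Nat.succ_eq_add_one, hF]; exact Finset.mem_insert_self _ _)
  have hinj : Function.Injective fun n => g (F n) := by
    intro a b hab
    by_contra hne
    rcases lt_or_gt_of_ne hne with h | h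
    · exact hg (F b) (by rw [← show g (F a) = g (F b) from hab]; exact hmem a b h)
    · exact hg (F a) (by rw [show g (F a) = g (F b) from hab]; exact hmem b a h)
  have hrange : ∀ n i, i ∈ F n → ∃ k, g (F k) = i := by
    intro n
    induction n with
    | zero => intro i hi; exact absurd hi (Finset.notMem_empty i)
    | succ n ih =>
      intro i hi
      rw [hF, Finset.mem_insert] at hi
      exact hi.elim (fun h => ⟨n, h.symm⟩) (ih i)
  -- An index never selected has value at most that of every selected one, so infinitely many
  -- selected indices would lie in a finite superlevel set.
  have hsurj : Function.Surjective fun n => g (F n) := by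
    intro i
    by_contra hi
    have hnot : ∀ n, i ∉ F n := fun n h => hi (hrange n i h)
    exact Set.infinite_range_of_injective hinj
      ((hm i).subset (by rintro _ ⟨n, rfl⟩; exact hgmax _ i (hnot n)))
  refine ⟨Equiv.ofBijective _ ⟨hinj, hsurj⟩, antitone_nat_of_succ_le fun n => ?_⟩
  refine hgmax (F n) _ fun h => hg (F (n + 1)) (hFmono n.le_succ h)

/-- Consider the first disagreement, say l k < l' k. By monotonicity l takes the value l' k only at
indices below k, where the two sequences agree, whereas l' takes it at those indices and also at k;
the finite multiplicities differ. -/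
theorem antitone_eq_of_encard_fiber_eq {l l' : ℕ → ℝ} (hl : Antitone l) (hl' : Antitone l')
    (h : ∀ μ, {k | l k = μ}.encard = {k | l' k = μ}.encard) : l = l' := by
  have key : ∀ (l l' : ℕ → ℝ), Antitone l → (∀ μ, {k | l k = μ}.encard = {k | l' k = μ}.encard) →
      ∀ k, (∀ j < k, l j = l' j) → ¬ l k < l' k := by
    intro l l' hl h k hj hlt
    have hsub : {j | l j = l' k} ⊆ {j | l' j = l' k} \ {k} := by
      intro j hjk
      have hjk' : l j = l' k := hjk
      have : j < k := by
        by_contra hcon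
        exact absurd (hl (not_lt.mp hcon)) (by rw [hjk']; exact not_le.mpr hlt)
      exact ⟨by rw [mem_ofPred_eq, ← hj j this]; exact hjk', this.ne⟩
    have hfin : {j | l j = l' k}.Finite := by
      refine (Set.finite_lt_nat k).subset fun j hjk => ?_
      by_contra hcon
      have hjk' : l j = l' k := hjk
      exact absurd (hl (not_lt.mp hcon)) (by rw [hjk']; exact not_le.mpr hlt)
    have hss : {j | l j = l' k} ⊂ {j | l' j = l' k} :=
      ⟨hsub.trans sdiff_subset, fun hcon => (hsub (hcon (show k ∈ {j | l' j = l' k} from rfl))).2 rfl⟩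
    exact (hfin.encard_lt_encard hss).ne (h _)
  funext k
  induction k using Nat.strong_induction_on with
  | _ k ih =>
    exact le_antisymm (not_lt.mp (key l' l hl' (fun μ => (h μ).symm) k fun j hj => (ih j hj).symm))
      (not_lt.mp (key l l' hl h k ih))

variable {H : Type*} [NormedAddCommGroup H] [InnerProductSpace ℝ H]

theorem eigenvalue_pos {T : H →L[ℝ] H} (hpos : ∀ x, x ≠ 0 → 0 < inner ℝ (T x) x) {μ : ℝ} {v : H}
    (hv : v ≠ 0) (h : T v = μ • v) : 0 < μ := by
  have h1 := hpos v hv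
  rw [h, real_inner_smul_left, real_inner_self_eq_norm_sq] at h1
  exact pos_of_mul_pos_left h1 (sq_nonneg _)

theorem eigenspace_eq_bot {T : H →L[ℝ] H} (hpos : ∀ x, x ≠ 0 → 0 < inner ℝ (T x) x) {μ : ℝ}
    (hμ : μ ≤ 0) : End.eigenspace (T : H →ₗ[ℝ] H) μ = ⊥ := by
  rw [Submodule.eq_bot_iff]
  intro x hx
  by_contra hne
  exact absurd (eigenvalue_pos hpos hne (End.mem_eigenspace_iff.mp hx)) (not_lt.mpr hμ)

/-- On the span of the first k+1 eigenvectors the Rayleigh quotient is a weighted mean of `lam 0`,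
…, `lam k`, the smallest of which is `lam k`. -/
theorem le_inner_of_mem_span {T : H →L[ℝ] H} {lam : ℕ → ℝ} (hlam : Antitone lam) {e : ℕ → H}
    (he : Orthonormal ℝ e) (hT : ∀ k, T (e k) = lam k • e k) (k : ℕ) (c : Fin (k + 1) → ℝ) :
    lam k * ‖∑ i, c i • e i‖ ^ 2 ≤ inner ℝ (T (∑ i, c i • e i)) (∑ i, c i • e i) := by
  have he' : Orthonormal ℝ fun i : Fin (k + 1) => e i := he.comp _ Fin.val_injective
  have h1 : T (∑ i, c i • e i) = ∑ i : Fin (k + 1), (c i * lam i) • e i := by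
    simp [map_sum, hT, smul_smul]
  rw [h1, ← real_inner_self_eq_norm_sq, he'.inner_sum, he'.inner_sum, Finset.mul_sum]
  refine Finset.sum_le_sum fun i _ => ?_
  have := hlam (Nat.le_of_lt_succ i.2)
  simp only [conj_trivial]
  nlinarith [mul_self_nonneg (c i)]

variable [CompleteSpace H]

/-- Compactness covers only nonzero μ. Definiteness removes μ = 0, which matters because
`IsEigenvalueSequence` counts the eigenspace of every real μ. -/
theorem finiteDimensional_eigenspace {T : H →L[ℝ] H} (hc : IsCompactOperator T)
    (hpos : ∀ x, x ≠ 0 → 0 < inner ℝ (T x) x) (μ : ℝ) :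
    FiniteDimensional ℝ (End.eigenspace (T : H →ₗ[ℝ] H) μ) := by
  by_cases hμ : μ ≤ 0
  · rw [eigenspace_eq_bot hpos hμ]; infer_instance
  · exact ContinuousLinearMap.finite_dimensional_eigenspace hc μ (not_le.mp hμ).ne'

theorem toENat_rank_eigenspace {T : H →L[ℝ] H} (hc : IsCompactOperator T)
    (hpos : ∀ x, x ≠ 0 → 0 < inner ℝ (T x) x) (μ : ℝ) :
    Cardinal.toENat (Module.rank ℝ (End.eigenspace (T : H →ₗ[ℝ] H) μ))
      = finrank ℝ (End.eigenspace (T : H →ₗ[ℝ] H) μ) := by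
  have := finiteDimensional_eigenspace hc hpos μ
  rw [← finrank_eq_rank, Cardinal.toENat_nat]

/-- The spectral theorem for compact symmetric operators, in the form of completeness of the
eigenvectors. -/
theorem eq_zero_of_forall_eigenvector_orthogonal {T : H →L[ℝ] H} (hc : IsCompactOperator T)
    (hs : (T : H →ₗ[ℝ] H).IsSymmetric) {x : H}
    (hx : ∀ μ, ∀ v ∈ End.eigenspace (T : H →ₗ[ℝ] H) μ, inner ℝ v x = 0) : x = 0 := by
  have h := ContinuousLinearMap.orthogonalComplement_iSup_eigenspaces_eq_bot hc hs
  have hx' : x ∈ (⨆ μ, End.eigenspace (T : H →ₗ[ℝ] H) μ)ᗮ := by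
    rw [← Submodule.iInf_orthogonal, Submodule.mem_iInf]
    exact fun μ => (Submodule.mem_orthogonal _ _).mpr (hx μ)
  rw [h] at hx'
  exact (Submodule.mem_bot ℝ).mp hx'

/-- The eigenvalue sequence of a positive compact operator is that of an orthonormal basis of
eigenvectors. -/
theorem IsEigenvalueSequence.exists_orthonormal {T : H →L[ℝ] H} (hc : IsCompactOperator T)
    (hs : (T : H →ₗ[ℝ] H).IsSymmetric) (hpos : ∀ x, x ≠ 0 → 0 < inner ℝ (T x) x) {lam : ℕ → ℝ}
    (hlam : IsEigenvalueSequence T lam) :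
    ∃ e : ℕ → H, Orthonormal ℝ e ∧ (∀ k, T (e k) = lam k • e k) ∧
      ∀ x, (∀ k, inner ℝ (e k) x = 0) → x = 0 := by
  classical
  have hfd := finiteDimensional_eigenspace hc hpos
  have hfin : ∀ μ, {k | lam k = μ}.Finite := fun μ => by
    rw [← Set.encard_ne_top_iff, hlam.2, toENat_rank_eigenspace hc hpos]
    exact ENat.natCast_ne_top _
  have hft : ∀ μ, Fintype {k | lam k = μ} := fun μ => (hfin μ).fintype
  -- The fibre of `lam` over μ has as many elements as the eigenspace has dimensions, so it can
  -- index an orthonormal basis of that eigenspace; `e k` is then the basis vector with label k.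
  have hb : ∀ μ, Nonempty (OrthonormalBasis {k | lam k = μ} ℝ (End.eigenspace (T : H →ₗ[ℝ] H) μ)) := by
    intro μ
    have hcard : Fintype.card {k | lam k = μ} = finrank ℝ (End.eigenspace (T : H →ₗ[ℝ] H) μ) := by
      have h1 := (hlam.2 μ).trans (toENat_rank_eigenspace hc hpos μ)
      rw [Set.encard_eq_coe_toFinset_card, Nat.cast_inj] at h1
      rw [← h1, Set.toFinset_card]
    exact ⟨(stdOrthonormalBasis ℝ (End.eigenspace (T : H →ₗ[ℝ] H) μ)).reindex
      (Fintype.equivOfCardEq (by rw [Fintype.card_fin, hcard]))⟩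
  let b := fun μ => (hb μ).some
  let e : ℕ → H := fun k => (b (lam k) ⟨k, rfl⟩ : H)
  -- Transport along `lam k = μ`, so that two indices of one fibre refer to the same basis.
  have he : ∀ μ k (h : lam k = μ), e k = (b μ ⟨k, h⟩ : H) := by
    rintro μ k rfl; rfl
  have hT : ∀ k, T (e k) = lam k • e k := fun k =>
    End.mem_eigenspace_iff.mp (b (lam k) ⟨k, rfl⟩).2
  refine ⟨e, ⟨fun k => ?_, fun k l hkl => ?_⟩, hT, fun x hx => ?_⟩
  · exact (b (lam k)).orthonormal.1 _
  · by_cases h : lam k = lam l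
    · change inner ℝ (e k) (e l) = 0
      rw [he (lam l) k h, he (lam l) l rfl, ← Submodule.coe_inner]
      exact (b (lam l)).orthonormal.2 (fun h' => hkl (congrArg Subtype.val h'))
    · exact hs.orthogonalFamily_eigenspaces h (b (lam k) ⟨k, rfl⟩) (b (lam l) ⟨l, rfl⟩)
  · refine eq_zero_of_forall_eigenvector_orthogonal hc hs fun μ v hv => ?_
    have hsum := (b μ).sum_repr' ⟨v, hv⟩
    have hv' : v = ∑ i, inner ℝ (b μ i) (⟨v, hv⟩ : End.eigenspace (T : H →ₗ[ℝ] H) μ) • (b μ i : H) := by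
      have := congrArg Subtype.val hsum
      simpa using this.symm
    rw [hv', sum_inner]
    refine Finset.sum_eq_zero fun i _ => ?_
    rw [inner_smul_left, ← he μ i i.2, hx, mul_zero]

/-- Parseval in the eigenbasis: ⟨Tv, v⟩ = Σ lam i ⟨e i, v⟩², where the terms with i < k vanish and
the others have lam i ≤ lam k. -/
theorem inner_le_of_forall_orthogonal {T : H →L[ℝ] H} (hs : (T : H →ₗ[ℝ] H).IsSymmetric)
    {lam : ℕ → ℝ} (hlam : Antitone lam) {e : ℕ → H}
    (he : Orthonormal ℝ e) (hT : ∀ k, T (e k) = lam k • e k)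
    (hcomp : ∀ x, (∀ k, inner ℝ (e k) x = 0) → x = 0) (k : ℕ) {v : H}
    (hv : ∀ j < k, inner ℝ (e j) v = 0) : inner ℝ (T v) v ≤ lam k * ‖v‖ ^ 2 := by
  have hbot : (Submodule.span ℝ (Set.range e))ᗮ = ⊥ := by
    rw [Submodule.eq_bot_iff]
    intro x hx
    exact hcomp x fun k => (Submodule.mem_orthogonal _ _).mp hx _ (Submodule.subset_span ⟨k, rfl⟩)
  let b := HilbertBasis.mkOfOrthogonalEqBot he hbot
  have hb : ∀ i, b i = e i := fun i => by simp [b]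
  have h1 := b.hasSum_inner_mul_inner (T v) v
  have h2 := (b.hasSum_inner_mul_inner v v).mul_left (lam k)
  rw [← real_inner_self_eq_norm_sq]
  refine hasSum_le (fun i => ?_) h1 h2
  have h3 : inner ℝ (T v) (b i) = lam i * inner ℝ v (b i) := by
    have := hs v (b i)
    simp only [ContinuousLinearMap.coe_coe] at this
    rw [this, hb, hT, inner_smul_right]
  rw [h3, real_inner_comm (b i) v]
  by_cases hi : i < k
  · rw [hb, hv i hi]; simp
  · have := hlam (not_lt.mp hi)
    nlinarith [mul_self_nonneg (inner ℝ (b i) v)]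

/-- One half of Weyl's inequality. At a vector v in the span of the first k+1 eigenvectors of `T`
and orthogonal to the first k of `S`, lam k ‖v‖² ≤ ⟨Tv, v⟩ = ⟨Sv, v⟩ + ⟨(T - S)v, v⟩ ≤ (mu k + ‖T -
S‖)‖v‖². -/
theorem eigenvalue_le_add_norm_sub {T S : H →L[ℝ] H} (hcT : IsCompactOperator T)
    (hsT : (T : H →ₗ[ℝ] H).IsSymmetric) (hposT : ∀ x, x ≠ 0 → 0 < inner ℝ (T x) x)
    (hcS : IsCompactOperator S)
    (hsS : (S : H →ₗ[ℝ] H).IsSymmetric) (hposS : ∀ x, x ≠ 0 → 0 < inner ℝ (S x) x)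
    {lam mu : ℕ → ℝ} (hlam : IsEigenvalueSequence T lam) (hmu : IsEigenvalueSequence S mu) (k : ℕ) :
    lam k ≤ mu k + ‖T - S‖ := by
  obtain ⟨e, he, hTe, -⟩ := hlam.exists_orthonormal hcT hsT hposT
  obtain ⟨f, hf, hSf, hcomp⟩ := hmu.exists_orthonormal hcS hsS hposS
  let L : (Fin (k + 1) → ℝ) →ₗ[ℝ] (Fin k → ℝ) :=
    { toFun := fun c j => inner ℝ (f j) (∑ i, c i • e i)
      map_add' := fun c c' => by
        funext j; simp [add_smul, Finset.sum_add_distrib, inner_add_right]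
      map_smul' := fun a c => by
        funext j; simp [mul_smul, ← Finset.smul_sum, inner_smul_right] }
  -- There are k + 1 coefficients and k orthogonality conditions.
  have hker : LinearMap.ker L ≠ ⊥ := LinearMap.ker_ne_bot_of_finrank_lt (by simp)
  obtain ⟨c, hc, hc0⟩ := Submodule.exists_mem_ne_zero_of_ne_bot hker
  set v := ∑ i, c i • e i with hv
  have hv0 : v ≠ 0 := by
    intro h0
    have he' : Orthonormal ℝ fun i : Fin (k + 1) => e i := he.comp _ Fin.val_injective
    exact hc0 (funext (Fintype.linearIndependent_iff.mp he'.linearIndependent c h0))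
  have hperp : ∀ j < k, inner ℝ (f j) v = 0 := fun j hj =>
    congrFun (LinearMap.mem_ker.mp hc) ⟨j, hj⟩
  have h1 := le_inner_of_mem_span hlam.1 he hTe k c
  have h2 := inner_le_of_forall_orthogonal hsS hmu.1 hf hSf hcomp k hperp
  have h3 : inner ℝ ((T - S) v) v ≤ ‖T - S‖ * ‖v‖ ^ 2 :=
    (real_inner_le_norm _ _).trans (by
      rw [pow_two, ← mul_assoc]; gcongr; exact (T - S).le_opNorm v)
  rw [sub_apply, inner_sub_left] at h3
  have h4 : 0 < ‖v‖ ^ 2 := by positivity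
  rw [← hv] at h1
  by_contra hcon
  nlinarith [mul_lt_mul_of_pos_right (not_le.mp hcon) h4]

theorem abs_eigenvalue_sub_le {T S : H →L[ℝ] H} (hcT : IsCompactOperator T)
    (hsT : (T : H →ₗ[ℝ] H).IsSymmetric) (hposT : ∀ x, x ≠ 0 → 0 < inner ℝ (T x) x)
    (hcS : IsCompactOperator S)
    (hsS : (S : H →ₗ[ℝ] H).IsSymmetric) (hposS : ∀ x, x ≠ 0 → 0 < inner ℝ (S x) x)
    {lam mu : ℕ → ℝ} (hlam : IsEigenvalueSequence T lam) (hmu : IsEigenvalueSequence S mu) (k : ℕ) :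
    |lam k - mu k| ≤ ‖T - S‖ := by
  have h1 := eigenvalue_le_add_norm_sub hcT hsT hposT hcS hsS hposS hlam hmu k
  have h2 := eigenvalue_le_add_norm_sub hcS hsS hposS hcT hsT hposT hmu hlam k
  rw [norm_sub_rev] at h2
  exact abs_sub_le_iff.mpr ⟨by linarith, by linarith⟩

theorem IsEigenvalueSequence.pos {T : H →L[ℝ] H} (hc : IsCompactOperator T)
    (hs : (T : H →ₗ[ℝ] H).IsSymmetric) (hpos : ∀ x, x ≠ 0 → 0 < inner ℝ (T x) x) {lam : ℕ → ℝ}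
    (hlam : IsEigenvalueSequence T lam) (k : ℕ) : 0 < lam k := by
  obtain ⟨e, he, hT, -⟩ := hlam.exists_orthonormal hc hs hpos
  exact eigenvalue_pos hpos (he.ne_zero k) (hT k)

/-- The pairs of an eigenvalue and a basis index of its eigenspace are sorted decreasingly. Infinite
dimension makes the list infinite, and compactness makes its superlevel sets finite. -/
theorem existsUnique_isEigenvalueSequence {T : H →L[ℝ] H} (hinf : ¬ FiniteDimensional ℝ H)
    (hc : IsCompactOperator T) (hs : (T : H →ₗ[ℝ] H).IsSymmetric)
    (hpos : ∀ x, x ≠ 0 → 0 < inner ℝ (T x) x) : ∃! lam, IsEigenvalueSequence T lam := by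
  classical
  have hfd := finiteDimensional_eigenspace hc hpos
  let ι := Σ μ : ℝ, Fin (finrank ℝ (End.eigenspace (T : H →ₗ[ℝ] H) μ))
  let b : ι → H := fun i => (stdOrthonormalBasis ℝ (End.eigenspace (T : H →ₗ[ℝ] H) i.1) i.2 : H)
  have hb : Orthonormal ℝ b :=
    hs.orthogonalFamily_eigenspaces.orthonormal_sigma_orthonormal
      fun μ => (stdOrthonormalBasis ℝ (End.eigenspace (T : H →ₗ[ℝ] H) μ)).orthonormal
  have hTb : ∀ i, T (b i) = i.1 • b i := fun i => End.mem_eigenspace_iff.mp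
    (stdOrthonormalBasis ℝ (End.eigenspace (T : H →ₗ[ℝ] H) i.1) i.2).2
  have hipos : ∀ i : ι, 0 < i.1 := fun i => eigenvalue_pos hpos (hb.ne_zero i) (hTb i)
  -- Finitely many eigenvectors would span a closed subspace with trivial orthogonal complement,
  -- that is, all of `H`.
  have hinfι : Infinite ι := by
    by_contra hcon
    rw [not_infinite_iff_finite] at hcon
    apply hinf
    have hfdspan : FiniteDimensional ℝ (Submodule.span ℝ (Set.range b)) :=
      FiniteDimensional.span_of_finite ℝ (Set.finite_range b)
    have hbot : (Submodule.span ℝ (Set.range b))ᗮ = ⊥ := by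
      rw [Submodule.eq_bot_iff]
      intro x hx
      refine eq_zero_of_forall_eigenvector_orthogonal hc hs fun μ v hv => ?_
      have hsum := (stdOrthonormalBasis ℝ (End.eigenspace (T : H →ₗ[ℝ] H) μ)).sum_repr' ⟨v, hv⟩
      refine (Submodule.mem_orthogonal _ _).mp hx v ?_
      have hv' := congrArg Subtype.val hsum
      simp only [Submodule.coe_sum, Submodule.coe_smul] at hv'
      rw [← hv']
      exact Submodule.sum_mem _ fun j _ =>
        Submodule.smul_mem _ _ (Submodule.subset_span ⟨⟨μ, j⟩, rfl⟩)
    have htop : Submodule.span ℝ (Set.range b) = ⊤ := (Submodule.orthogonal_eq_bot_iff).mp hbot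
    rw [htop] at hfdspan
    exact Module.Finite.equiv Submodule.topEquiv
  -- Infinitely many orthonormal eigenvectors with eigenvalue at least `i.1` would have pairwise
  -- orthogonal images of norm at least `i.1`. Their mutual distances are at least `i.1`, so no
  -- subsequence of the images is Cauchy.
  have hfin : ∀ i : ι, {j : ι | i.1 ≤ j.1}.Finite := by
    intro i
    by_contra hcon
    have : Infinite {j : ι | i.1 ≤ j.1} := Set.infinite_coe_iff.mpr hcon
    let g := Infinite.natEmbedding {j : ι | i.1 ≤ j.1}
    obtain ⟨K, hK, hKsub⟩ := hc.image_closedBall_subset_compact 1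
    obtain ⟨x, -, φ, hφ, hlim⟩ := hK.tendsto_subseq (x := fun n => T (b (g n))) fun n =>
      hKsub ⟨b (g n), by simp [hb.1 (g n)], rfl⟩
    have hcau := hlim.cauchySeq
    obtain ⟨N, hN⟩ := Metric.cauchySeq_iff.mp hcau i.1 (hipos i)
    have h1 := hN (N + 1) N.le_succ N le_rfl
    have hne : (g (φ (N + 1)) : ι) ≠ g (φ N) := fun h =>
      absurd (hφ.injective (g.injective (Subtype.ext h))) (by simp)
    have horth : inner ℝ (T (b (g (φ (N + 1))))) (T (b (g (φ N)))) = 0 := by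
      rw [hTb, hTb, inner_smul_left, inner_smul_right, hb.2 hne]; simp
    have h2 : i.1 ^ 2 ≤ ‖T (b (g (φ (N + 1)))) - T (b (g (φ N)))‖ ^ 2 := by
      rw [@norm_sub_sq_real, horth]
      have h3 : i.1 ≤ ‖T (b (g (φ (N + 1))))‖ := by
        rw [hTb, norm_smul, hb.1, mul_one]
        exact (g (φ (N + 1))).2.trans (le_abs_self _)
      nlinarith [hipos i, sq_nonneg ‖T (b (g (φ N)))‖]
    simp only [Function.comp_apply, dist_eq_norm] at h1
    have h4 := norm_nonneg (T (b (g (φ (N + 1)))) - T (b (g (φ N))))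
    nlinarith
  obtain ⟨e, he⟩ := exists_antitone_enumeration (fun i : ι => i.1) hfin
  have hcount : ∀ μ, {k | (e k).1 = μ}.encard
      = Cardinal.toENat (Module.rank ℝ (End.eigenspace (T : H →ₗ[ℝ] H) μ)) := by
    intro μ
    rw [toENat_rank_eigenspace hc hpos]
    let f : Fin (finrank ℝ (End.eigenspace (T : H →ₗ[ℝ] H) μ)) → ℕ := fun j => e.symm ⟨μ, j⟩
    have hf : Function.Injective f := fun j j' h =>
      eq_of_heq (Sigma.mk.inj (e.symm.injective h)).2
    have hr : {k | (e k).1 = μ} = Set.range f := by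
      ext k
      simp only [mem_ofPred_eq, mem_range, f]
      constructor
      · intro h
        subst h
        exact ⟨(e k).2, by simp⟩
      · rintro ⟨j, rfl⟩; simp
    rw [hr, ← Set.image_univ, hf.encard_image, Set.encard_univ]
    simp
  exact ⟨fun k => (e k).1, ⟨he, hcount⟩, fun l hl =>
    antitone_eq_of_encard_fiber_eq hl.1 he fun μ => (hl.2 μ).trans (hcount μ).symm⟩

end Spectral

end

end FracEigen

namespace FracEigen

noncomputable section

open Filter Topology Complex
open scoped FourierTransform ENNReal Real

/-! ### Characters, integrability of the Riesz kernel, and Gaussian integrals. -/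

section Kernel

variable {d : ℕ}

/-- The character `z ↦ exp (-2πi z·ξ)`. -/
def chi (ξ z : E d) : ℂ := cexp (↑(-2 * π * inner ℝ z ξ) * I)

theorem norm_chi (ξ z : E d) : ‖chi ξ z‖ = 1 := Complex.norm_exp_ofReal_mul_I _

theorem continuous_chi (ξ : E d) : Continuous (chi ξ) := by
  unfold chi; fun_prop

theorem chi_add (ξ z w : E d) : chi ξ (z + w) = chi ξ z * chi ξ w := by
  simp only [chi, ← Complex.exp_add, inner_add_left]
  congr 1; push_cast; ring

theorem norm_one_sub_chi_le (ξ z : E d) : ‖1 - chi ξ z‖ ≤ 2 * π * ‖ξ‖ * ‖z‖ := by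
  rw [norm_sub_rev, chi, mul_comm]
  refine Real.norm_exp_I_mul_ofReal_sub_one_le.trans ?_
  rw [norm_mul, norm_mul, Real.norm_eq_abs, Real.norm_eq_abs, Real.norm_eq_abs, abs_neg,
    abs_of_pos Real.pi_pos, abs_two]
  have := abs_real_inner_le_norm z ξ
  have hpi := Real.pi_pos
  nlinarith

/-- The factor min(|z|, 1) tames the kernel |z|^(-d-s) at both ends: first-order vanishing at 0
suffices because s < 1, boundedness at infinity because s > 0. -/
theorem norm_one_sub_chi_le_min (ξ z : E d) :
    ‖1 - chi ξ z‖ ≤ (2 + 2 * π * ‖ξ‖) * min ‖z‖ 1 := by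
  have h1 := norm_one_sub_chi_le ξ z
  have h2 : ‖1 - chi ξ z‖ ≤ 2 := (norm_sub_le _ _).trans (by rw [norm_chi]; norm_num)
  have hpi := Real.pi_pos
  have hz := norm_nonneg z
  have hξ := norm_nonneg ξ
  rcases min_cases ‖z‖ 1 with ⟨h, -⟩ | ⟨h, -⟩ <;> rw [h]
  · nlinarith [mul_nonneg hpi.le hξ]
  · nlinarith [mul_nonneg hpi.le hξ]

theorem fourier_eq_integral_chi (f : E d → ℂ) (ξ : E d) : 𝓕 f ξ = ∫ x, chi ξ x * f x := by
  rw [Real.fourier_eq']; rfl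

/-- `min(|z|, 1) |z|^{-d-s}` is integrable. -/
theorem integrable_min_mul_rpow (hd : 0 < d) {s : ℝ} (hs0 : 0 < s) (hs1 : s < 1) :
    Integrable fun z : E d => min ‖z‖ 1 * ‖z‖ ^ (-((d : ℝ) + s)) := by
  have hmeas : AEStronglyMeasurable (fun z : E d => min ‖z‖ 1 * ‖z‖ ^ (-((d : ℝ) + s))) volume := by
    refine Measurable.aestronglyMeasurable ?_
    fun_prop
  have h1 : IntegrableOn (fun z : E d => min ‖z‖ 1 * ‖z‖ ^ (-((d : ℝ) + s)))
      (Metric.ball 0 1) volume := by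
    refine integrableOn_ball_of_norm_le_rpow (C := 1) (α := (d : ℝ) + s - 1)
      (by simpa using Nat.succ_le_of_lt hd) (by simp; linarith) (Eventually.of_forall fun z => ?_) hmeas
    rw [one_mul, Real.norm_of_nonneg (by positivity)]
    rcases eq_or_ne z 0 with rfl | hz
    · simp only [norm_zero]
      rw [min_eq_left zero_le_one, zero_mul]; exact Real.rpow_nonneg le_rfl _
    · have hz' : 0 < ‖z‖ := norm_pos_iff.mpr hz
      calc min ‖z‖ 1 * ‖z‖ ^ (-((d : ℝ) + s)) ≤ ‖z‖ ^ (1 : ℝ) * ‖z‖ ^ (-((d : ℝ) + s)) := by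
            gcongr; rw [Real.rpow_one]; exact min_le_left _ _
        _ = ‖z‖ ^ (-((d : ℝ) + s - 1)) := by rw [← Real.rpow_add hz']; congr 1; ring
  -- Outside the unit ball 1 + |z| ≤ 2|z|, whence the constant 2^(d+s); the decay is integrable as s
  -- > 0.
  have h2 : IntegrableOn (fun z : E d => min ‖z‖ 1 * ‖z‖ ^ (-((d : ℝ) + s)))
      (Metric.ball 0 1)ᶜ volume := by
    have hj : Integrable (fun z : E d => 2 ^ ((d : ℝ) + s) * (1 + ‖z‖) ^ (-((d : ℝ) + s))) :=
      (integrable_one_add_norm (by simp; linarith)).const_mul _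
    refine Integrable.mono' hj.integrableOn hmeas.restrict ?_
    refine (ae_restrict_iff' measurableSet_ball.compl).mpr (Eventually.of_forall fun z hz => ?_)
    have hz1 : 1 ≤ ‖z‖ := by simpa using hz
    rw [Real.norm_of_nonneg (by positivity), min_eq_right hz1, one_mul,
      Real.rpow_neg (by positivity), Real.rpow_neg (by positivity),
      ← Real.inv_rpow (by positivity), ← Real.inv_rpow (by positivity), ← Real.mul_rpow (by positivity) (by positivity)]
    refine Real.rpow_le_rpow (by positivity) ?_ (by positivity)
    rw [← div_eq_mul_inv, inv_eq_one_div, div_le_div_iff₀ (by positivity) (by positivity)]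
    linarith
  rw [← integrableOn_univ, ← union_compl_self (Metric.ball (0 : E d) 1)]
  exact h1.union h2

theorem integrable_norm_mul_gaussian {t : ℝ} (ht : 0 < t) :
    Integrable fun v : E d => ‖v‖ * ‖cexp (-(t : ℂ) * ‖v‖ ^ 2)‖ := by
  have hg : Integrable fun v : E d => cexp (-((t / 2 : ℝ) : ℂ) * ‖v‖ ^ 2) := by
    simpa using GaussianFourier.integrable_cexp_neg_mul_sq_norm_add (V := E d) (b := ((t / 2 : ℝ) : ℂ))
      (by simpa using ht) 0 0
  refine Integrable.mono' (hg.norm.const_mul (1 + 1 / (2 * t))) (by fun_prop)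
    (Eventually.of_forall fun v => ?_)
  have e1 : ∀ a : ℝ, ‖cexp (-(a : ℂ) * (‖v‖ : ℂ) ^ 2)‖ = Real.exp (-a * ‖v‖ ^ 2) := fun a => by
    rw [Complex.norm_exp]; congr 1
    rw [← Complex.ofReal_neg, ← Complex.ofReal_pow, ← Complex.ofReal_mul, Complex.ofReal_re]
  rw [Real.norm_of_nonneg (by positivity), e1, e1]
  have e2 : Real.exp (-t * ‖v‖ ^ 2) = Real.exp (-(t / 2) * ‖v‖ ^ 2) * Real.exp (-(t / 2) * ‖v‖ ^ 2) := by
    rw [← Real.exp_add]; congr 1; ring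
  have e3 : 1 + t / 2 * ‖v‖ ^ 2 ≤ Real.exp (t / 2 * ‖v‖ ^ 2) := by
    rw [add_comm]; exact Real.add_one_le_exp _
  have e4 : Real.exp (t / 2 * ‖v‖ ^ 2) * Real.exp (-(t / 2) * ‖v‖ ^ 2) = 1 := by
    rw [← Real.exp_add, neg_mul, add_neg_cancel, Real.exp_zero]
  -- From (t/2)(|v| - 1/t)² ≥ 0. One half of the Gaussian absorbs the factor |v| and the other half
  -- remains integrable.
  have e5 : ‖v‖ ≤ (1 + 1 / (2 * t)) * (1 + t / 2 * ‖v‖ ^ 2) := by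
    have : 0 ≤ t / 2 * (‖v‖ - 1 / t) ^ 2 := by positivity
    have h6 : t / 2 * (‖v‖ - 1 / t) ^ 2 = t / 2 * ‖v‖ ^ 2 - ‖v‖ + 1 / (2 * t) := by
      field_simp; ring
    have h7 : 0 ≤ 1 / (2 * t) * (t / 2 * ‖v‖ ^ 2) := by positivity
    nlinarith
  have e6 := Real.exp_pos (-(t / 2) * ‖v‖ ^ 2)
  rw [e2, ← mul_assoc]
  refine mul_le_mul_of_nonneg_right ?_ e6.le
  calc ‖v‖ * Real.exp (-(t / 2) * ‖v‖ ^ 2)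
      ≤ ((1 + 1 / (2 * t)) * Real.exp (t / 2 * ‖v‖ ^ 2)) * Real.exp (-(t / 2) * ‖v‖ ^ 2) := by
        gcongr
        exact e5.trans (by gcongr)
    _ = 1 + 1 / (2 * t) := by rw [mul_assoc, e4, mul_one]

/-- Multiplication by v_i is differentiation in ξ_i on the Fourier side. The derivative of the
Gaussian's transform, taken under the integral and from its closed form, must agree. -/
theorem fourier_coord_mul_gaussian {t : ℝ} (ht : 0 < t) (ξ : E d) (i : Fin d) :
    ∫ v : E d, chi ξ v * ((v i : ℂ) * cexp (-(t : ℂ) * ‖v‖ ^ 2))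
      = -(I * π * ξ i / t * ((π / t : ℝ) ^ ((d : ℝ) / 2) : ℝ) * (Real.exp (-(π ^ 2 * ‖ξ‖ ^ 2 / t)) : ℝ)) := by
  set g : E d → ℂ := fun v => cexp (-(t : ℂ) * ‖v‖ ^ 2) with hg
  have hgi : Integrable g := by
    simpa [hg] using GaussianFourier.integrable_cexp_neg_mul_sq_norm_add (V := E d) (b := (t : ℂ))
      (by simpa using ht) 0 0
  have hgn := integrable_norm_mul_gaussian (d := d) ht
  have hF : 𝓕 g = fun w : E d => (((π / t : ℝ) ^ ((d : ℝ) / 2) : ℝ) : ℂ)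
      * ((Real.exp (-(π ^ 2 / t) * ‖w‖ ^ 2) : ℝ) : ℂ) := by
    funext w
    rw [hg, fourier_gaussian_innerProductSpace (by simpa using ht) w]
    congr 1
    · rw [Complex.ofReal_cpow (by positivity)]; simp
    · push_cast; congr 1; ring
  have h1 := Real.hasFDerivAt_fourier hgi hgn ξ
  have h2 : HasFDerivAt (𝓕 g) ((((π / t : ℝ) ^ ((d : ℝ) / 2) : ℝ) : ℂ) •
      (Complex.ofRealCLM.comp (Real.exp (-(π ^ 2 / t) * ‖ξ‖ ^ 2) •
        ((-(π ^ 2 / t)) • (2 • (innerSL ℝ ξ)))))) ξ := by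
    rw [hF]
    have h3 : HasFDerivAt (fun w : E d => Real.exp (-(π ^ 2 / t) * ‖w‖ ^ 2))
        (Real.exp (-(π ^ 2 / t) * ‖ξ‖ ^ 2) • ((-(π ^ 2 / t)) • (2 • (innerSL ℝ ξ)))) ξ :=
      ((hasStrictFDerivAt_norm_sq ξ).hasFDerivAt.const_mul (-(π ^ 2 / t))).exp
    exact (Complex.ofRealCLM.hasFDerivAt.comp ξ h3).const_mul _
  have h4 := DFunLike.congr_fun (h1.unique h2) (EuclideanSpace.single i 1)
  have hint : Integrable (VectorFourier.fourierSMulRight (innerSL ℝ) g) := by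
    refine Integrable.mono' (hgn.const_mul (2 * π * ‖innerSL ℝ (E := E d)‖)) ?_
      (Eventually.of_forall fun v => ?_)
    · exact hgi.aestronglyMeasurable.fourierSMulRight
    · rw [← mul_assoc]; exact VectorFourier.norm_fourierSMulRight_le _ _ _
  rw [Real.fourier_continuousLinearMap_apply hint, fourier_eq_integral_chi] at h4
  have h5 : ∀ v : E d, chi ξ v * ((VectorFourier.fourierSMulRight (innerSL ℝ) g v) (EuclideanSpace.single i 1))
      = -(2 * π * I) * (chi ξ v * ((v i : ℂ) * g v)) := by
    intro v
    rw [VectorFourier.fourierSMulRight_apply]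
    have h8 : ((innerSL ℝ : E d →L[ℝ] E d →L[ℝ] ℝ) v) (EuclideanSpace.single i 1) = v i :=
      (EuclideanSpace.inner_single_right i (1 : ℝ) v).trans (by simp)
    rw [h8]
    simp only [smul_eq_mul, real_smul]
    ring
  simp_rw [h5] at h4
  rw [integral_const_mul] at h4
  have h6 : (2 * π * I : ℂ) ≠ 0 := by simp [Real.pi_ne_zero]
  refine mul_left_cancel₀ (neg_ne_zero.mpr h6) (h4.trans ?_)
  have ht' : (t : ℂ) ≠ 0 := by exact_mod_cast ht.ne'
  simp only [smul_apply, ContinuousLinearMap.comp_apply, innerSL_apply_apply,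
    EuclideanSpace.inner_single_right, ofRealCLM_apply, smul_eq_mul, one_mul, conj_trivial, nsmul_eq_mul]
  have h7 : -(π ^ 2 / t) * ‖ξ‖ ^ 2 = -(π ^ 2 * ‖ξ‖ ^ 2 / t) := by ring
  rw [h7]
  push_cast
  field_simp
  ring_nf
  simp [I_sq]

end Kernel

end

end FracEigen

namespace FracEigen

noncomputable section

open Filter Topology Complex
open scoped FourierTransform ENNReal Real

/-! ### The Fourier symbol of the Riesz kernel. -/

section Symbol

variable {d : ℕ}

/-- The `i`-th component `i (2π)^s |ξ|^{s-1} ξ_i` of the Fourier symbol of `D^s`. -/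
def symb (s : ℝ) (i : Fin d) (ξ : E d) : ℂ := I * (((2 * π) ^ s * ‖ξ‖ ^ (s - 1) * ξ i : ℝ) : ℂ)

/-- The Fourier transform of a real function. -/
def ft (u : E d → ℝ) : E d → ℂ := 𝓕 fun x => (u x : ℂ)

theorem ft_apply (u : E d → ℝ) (ξ : E d) : ft u ξ = ∫ x, chi ξ x * (u x : ℂ) :=
  fourier_eq_integral_chi _ _

theorem chi_zero_left (z : E d) : chi 0 z = 1 := by simp [chi]

theorem rpow_two_mul_div_eq (z : E d) (hz : z ≠ 0) (b : ℝ) :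
    (1 / ‖z‖ ^ 2) ^ (b / 2) = 1 / ‖z‖ ^ b := by
  have hz' : 0 < ‖z‖ := norm_pos_iff.mpr hz
  rw [Real.div_rpow zero_le_one (by positivity), Real.one_rpow, ← Real.rpow_natCast ‖z‖ 2,
    ← Real.rpow_mul hz'.le]
  congr 2; push_cast; ring

theorem integrable_kernel (hd : 0 < d) {s : ℝ} (hs0 : 0 < s) (hs1 : s < 1) (ξ : E d) (i : Fin d) :
    Integrable fun z : E d => ((z i / ‖z‖ ^ ((d : ℝ) + s + 1) : ℝ) : ℂ) * (1 - chi ξ z) := by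
  refine Integrable.mono' ((integrable_min_mul_rpow hd hs0 hs1).const_mul (2 + 2 * π * ‖ξ‖)) ?_
    (Eventually.of_forall fun z => ?_)
  · refine Measurable.aestronglyMeasurable (Measurable.mul ?_ ?_)
    · fun_prop
    · exact measurable_const.sub (continuous_chi ξ).measurable
  rcases eq_or_ne z 0 with rfl | hz
  · simp
  have hz' : 0 < ‖z‖ := norm_pos_iff.mpr hz
  rw [norm_mul, norm_real, Real.norm_eq_abs, abs_div, abs_of_pos (Real.rpow_pos_of_pos hz' _)]
  have h1 : |z i| / ‖z‖ ^ ((d : ℝ) + s + 1) ≤ ‖z‖ ^ (-((d : ℝ) + s)) := by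
    rw [div_le_iff₀ (by positivity), ← Real.rpow_add hz']
    have : -((d : ℝ) + s) + (d + s + 1) = 1 := by ring
    rw [this, Real.rpow_one]
    exact PiLp.norm_apply_le z i
  calc _ ≤ ‖z‖ ^ (-((d : ℝ) + s)) * ((2 + 2 * π * ‖ξ‖) * min ‖z‖ 1) := by
        gcongr; exact norm_one_sub_chi_le_min ξ z
    _ = _ := by ring

/-- The substitution t ↦ 1/t turns this into a Gamma integral. -/
theorem integral_rpow_mul_exp_neg_div {a c : ℝ} (ha : 0 < a) (hc : 0 < c) :
    ∫ t in Ioi (0 : ℝ), t ^ (-a - 1) * Real.exp (-(c / t)) = (1 / c) ^ a * Real.Gamma a := by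
  rw [← Real.integral_rpow_mul_exp_neg_mul_Ioi ha hc,
    ← integral_comp_rpow_Ioi (fun t : ℝ => t ^ (a - 1) * Real.exp (-(c * t)))
      (show (-1 : ℝ) ≠ 0 by norm_num)]
  refine setIntegral_congr_fun measurableSet_Ioi fun t ht => ?_
  have ht' : (0 : ℝ) < t := ht
  simp only [smul_eq_mul, abs_neg, abs_one, one_mul]
  rw [← mul_assoc, ← Real.rpow_mul ht'.le, ← Real.rpow_add ht', Real.rpow_neg_one, div_eq_mul_inv]
  congr 2; ring

/-- The summand 1 contributes nothing, the integral of z_i times a Gaussian being zero (the case ξ =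
0 of the transform); what is left is minus the transform at ξ. -/
theorem integral_gaussian_kernel {t : ℝ} (ht : 0 < t) (ξ : E d) (i : Fin d) :
    ∫ z : E d, (Real.exp (-(‖z‖ ^ 2 * t)) : ℂ) * ((z i : ℂ) * (1 - chi ξ z))
      = I * π * ξ i / t * ((π / t : ℝ) ^ ((d : ℝ) / 2) : ℝ)
        * (Real.exp (-(π ^ 2 * ‖ξ‖ ^ 2 / t)) : ℝ) := by
  have h0 := fourier_coord_mul_gaussian ht (0 : E d) i
  have h1 := fourier_coord_mul_gaussian ht ξ i
  simp only [chi_zero_left, one_mul, PiLp.zero_apply, ofReal_zero, mul_zero, zero_div, zero_mul,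
    neg_zero] at h0
  have hint : Integrable fun v : E d => (v i : ℂ) * cexp (-(t : ℂ) * ‖v‖ ^ 2) := by
    refine Integrable.mono' (integrable_norm_mul_gaussian ht) (by fun_prop)
      (Eventually.of_forall fun v => ?_)
    rw [norm_mul, norm_real]
    gcongr
    exact PiLp.norm_apply_le v i
  have hint2 : Integrable fun v : E d => chi ξ v * ((v i : ℂ) * cexp (-(t : ℂ) * ‖v‖ ^ 2)) :=
    hint.bdd_mul (continuous_chi ξ).aestronglyMeasurable
      (Eventually.of_forall fun v => (norm_chi ξ v).le)
  have h2 : ∀ z : E d, (Real.exp (-(‖z‖ ^ 2 * t)) : ℂ) * ((z i : ℂ) * (1 - chi ξ z))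
      = (z i : ℂ) * cexp (-(t : ℂ) * ‖z‖ ^ 2) - chi ξ z * ((z i : ℂ) * cexp (-(t : ℂ) * ‖z‖ ^ 2)) := by
    intro z
    have : ((Real.exp (-(‖z‖ ^ 2 * t)) : ℝ) : ℂ) = cexp (-(t : ℂ) * ‖z‖ ^ 2) := by
      push_cast; congr 1; ring
    rw [this]; ring
  simp_rw [h2]
  rw [integral_sub hint hint2, h0, h1, zero_sub, neg_neg]

/-- The Fourier symbol of the Riesz kernel. -/
theorem rieszConst_mul_integral_kernel (hd : 0 < d) {s : ℝ} (hs0 : 0 < s) (hs1 : s < 1) (ξ : E d)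
    (i : Fin d) :
    (rieszConst d s : ℂ) * ∫ z : E d, ((z i / ‖z‖ ^ ((d : ℝ) + s + 1) : ℝ) : ℂ) * (1 - chi ξ z)
      = symb s i ξ := by
  rcases eq_or_ne ξ 0 with rfl | hξ
  · simp [chi_zero_left, symb]
  have hξ' : 0 < ‖ξ‖ := norm_pos_iff.mpr hξ
  set b : ℝ := ((d : ℝ) + s + 1) / 2 with hb
  have hbpos : 0 < b := by positivity
  have hΓ : 0 < Real.Gamma b := Real.Gamma_pos_of_pos hbpos
  have hΓ' : 0 < Real.Gamma ((1 - s) / 2) := Real.Gamma_pos_of_pos (by linarith)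
  -- Subordination: with 2b = d + s + 1, Γ(b)|z|^(-2b) = ∫ t^(b-1) exp(-|z|²t) dt over t > 0. The
  -- kernel is thus a superposition of Gaussians, and Fubini reduces its transform to
  -- `integral_gaussian_kernel`.
  let F : E d → ℝ → ℂ := fun z t =>
    ((t ^ (b - 1) * Real.exp (-(‖z‖ ^ 2 * t)) : ℝ) : ℂ) * ((z i : ℂ) * (1 - chi ξ z))
  have hreal : ∀ z : E d, z ≠ 0 → ∫ t in Ioi (0 : ℝ), t ^ (b - 1) * Real.exp (-(‖z‖ ^ 2 * t))
      = Real.Gamma b / ‖z‖ ^ ((d : ℝ) + s + 1) := by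
    intro z hz
    have hz' : 0 < ‖z‖ := norm_pos_iff.mpr hz
    rw [Real.integral_rpow_mul_exp_neg_mul_Ioi hbpos (by positivity), hb, rpow_two_mul_div_eq z hz]
    ring
  have hinner : ∀ z : E d, ∫ t in Ioi (0 : ℝ), F z t
      = (Real.Gamma b : ℂ) * (((z i / ‖z‖ ^ ((d : ℝ) + s + 1) : ℝ) : ℂ) * (1 - chi ξ z)) := by
    intro z
    rcases eq_or_ne z 0 with rfl | hz
    · simp [F]
    simp only [F]
    rw [integral_mul_const, integral_complex_ofReal, hreal z hz]
    push_cast; ring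
  have hnorm : ∀ z : E d, ∫ t in Ioi (0 : ℝ), ‖F z t‖
      = Real.Gamma b * ‖((z i / ‖z‖ ^ ((d : ℝ) + s + 1) : ℝ) : ℂ) * (1 - chi ξ z)‖ := by
    intro z
    rcases eq_or_ne z 0 with rfl | hz
    · simp [F]
    have : ∀ t ∈ Ioi (0 : ℝ), ‖F z t‖ = t ^ (b - 1) * Real.exp (-(‖z‖ ^ 2 * t))
        * ‖(z i : ℂ) * (1 - chi ξ z)‖ := by
      intro t ht
      have ht' : (0 : ℝ) < t := ht
      simp only [F]
      rw [norm_mul, norm_real, Real.norm_of_nonneg (by positivity)]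
    rw [setIntegral_congr_fun measurableSet_Ioi this, integral_mul_const, hreal z hz, norm_mul,
      norm_mul, norm_real, norm_real, norm_div, Real.norm_of_nonneg (Real.rpow_nonneg (norm_nonneg z) _)]
    ring
  have hFi : Integrable (Function.uncurry F) (volume.prod (volume.restrict (Ioi (0 : ℝ)))) := by
    have hmeas : AEStronglyMeasurable (Function.uncurry F)
        (volume.prod (volume.restrict (Ioi (0 : ℝ)))) := by
      refine Measurable.aestronglyMeasurable ?_
      have hchi : Measurable fun p : E d × ℝ => chi ξ p.1 :=
        (continuous_chi ξ).measurable.comp measurable_fst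
      have h1 : Measurable fun p : E d × ℝ => (p.2 ^ (b - 1) * Real.exp (-(‖p.1‖ ^ 2 * p.2)) : ℝ) := by
        fun_prop
      have h2 : Measurable fun p : E d × ℝ => ((p.1 i : ℝ) : ℂ) := by fun_prop
      exact (Complex.measurable_ofReal.comp h1).mul (h2.mul (measurable_const.sub hchi))
    rw [integrable_prod_iff hmeas]
    refine ⟨Eventually.of_forall fun z => ?_, ?_⟩
    · rcases eq_or_ne z 0 with rfl | hz
      · simp [F]
      have hz' : 0 < ‖z‖ := norm_pos_iff.mpr hz
      have h1 := integrableOn_rpow_mul_exp_neg_mul_rpow (p := 1) (s := b - 1) (b := ‖z‖ ^ 2)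
        (by linarith) one_pos (by positivity)
      have h2 : Integrable (fun t : ℝ => t ^ (b - 1) * Real.exp (-(‖z‖ ^ 2 * t)))
          (volume.restrict (Ioi 0)) := by
        simpa [IntegrableOn] using h1
      exact (h2.ofReal (𝕜 := ℂ)).mul_const ((z i : ℂ) * (1 - chi ξ z))
    · simp only [Function.uncurry]
      simp_rw [hnorm]
      exact (integrable_kernel hd hs0 hs1 ξ i).norm.const_mul _
  have hswap := integral_integral_swap hFi
  simp_rw [hinner] at hswap
  rw [integral_const_mul] at hswap
  -- After the z-integration the power of t is -(1-s)/2 - 1. The remaining t-integral therefore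
  -- produces Γ((1-s)/2), which the normalising constant cancels.
  have hzint : ∀ t ∈ Ioi (0 : ℝ), ∫ z, F z t
      = (I * π * ξ i * ((π ^ ((d : ℝ) / 2) : ℝ) : ℂ)) *
        ((t ^ (-((1 - s) / 2) - 1) * Real.exp (-(π ^ 2 * ‖ξ‖ ^ 2 / t)) : ℝ) : ℂ) := by
    intro t ht
    have ht' : (0 : ℝ) < t := ht
    have h1 : ∀ z, F z t = ((t ^ (b - 1) : ℝ) : ℂ) *
        ((Real.exp (-(‖z‖ ^ 2 * t)) : ℂ) * ((z i : ℂ) * (1 - chi ξ z))) := by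
      intro z; simp only [F]; push_cast; ring
    simp_rw [h1]
    rw [integral_const_mul, integral_gaussian_kernel ht']
    have h2 : t ^ (-((1 - s) / 2) - 1) = t ^ (b - 1) * t⁻¹ * (t ^ ((d : ℝ) / 2))⁻¹ := by
      rw [← Real.rpow_neg ht'.le, ← Real.rpow_neg_one, ← Real.rpow_add ht', ← Real.rpow_add ht', hb]
      congr 1; ring
    rw [h2, Real.div_rpow Real.pi_pos.le ht'.le]
    push_cast
    ring
  rw [setIntegral_congr_fun measurableSet_Ioi hzint, integral_const_mul, integral_complex_ofReal,
    integral_rpow_mul_exp_neg_div (by linarith) (by positivity)] at hswap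
  have hΓc : (Real.Gamma b : ℂ) ≠ 0 := by exact_mod_cast hΓ.ne'
  refine mul_left_cancel₀ hΓc ?_
  rw [mul_left_comm, hswap, rieszConst, symb]
  have h3 : (1 / (π ^ 2 * ‖ξ‖ ^ 2)) ^ ((1 - s) / 2) = π ^ (s - 1) * ‖ξ‖ ^ (s - 1) := by
    rw [← mul_pow, one_div, Real.inv_rpow (by positivity), ← Real.rpow_natCast, ← Real.rpow_mul (by positivity),
      ← Real.rpow_neg (by positivity), ← Real.mul_rpow Real.pi_pos.le hξ'.le]
    congr 1; push_cast; ring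
  have h4 : (2 * π) ^ s = 2 ^ s * (π ^ (s - 1) * π) := by
    rw [Real.mul_rpow (by norm_num) Real.pi_pos.le, Real.rpow_sub_one Real.pi_ne_zero,
      div_mul_cancel₀ _ Real.pi_ne_zero]
  have h5 : π ^ (-(d : ℝ) / 2) * π ^ ((d : ℝ) / 2) = 1 := by
    rw [← Real.rpow_add Real.pi_pos, neg_div, neg_add_cancel, Real.rpow_zero]
  rw [h3, h4, ← hb]
  have h6 : (2 ^ s * π ^ (-(d : ℝ) / 2) * Real.Gamma b / Real.Gamma ((1 - s) / 2)) *
      (π * ξ i * π ^ ((d : ℝ) / 2) * (π ^ (s - 1) * ‖ξ‖ ^ (s - 1) * Real.Gamma ((1 - s) / 2)))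
      = Real.Gamma b * (2 ^ s * (π ^ (s - 1) * π) * ‖ξ‖ ^ (s - 1) * ξ i) := by
    rw [div_mul_eq_mul_div, div_eq_iff hΓ'.ne']
    linear_combination (2 ^ s * Real.Gamma b * π * ξ i * (π ^ (s - 1) * ‖ξ‖ ^ (s - 1)
      * Real.Gamma ((1 - s) / 2))) * h5
  have h7 := congrArg (fun r : ℝ => I * (r : ℂ)) h6
  simp only [ofReal_mul] at h7 ⊢
  linear_combination h7

end Symbol

end

end FracEigen

namespace FracEigen

noncomputable section

open Filter Topology Complex
open scoped FourierTransform ENNReal Real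

/-! ### The fractional divergence of test fields and its Fourier transform. -/

section Divergence

variable {d : ℕ}

theorem integral_chi_mul_sub (f : E d → ℂ) (ξ z : E d) :
    ∫ x, chi ξ x * f (x - z) = chi ξ z * ∫ x, chi ξ x * f x := by
  rw [← integral_add_right_eq_self (fun x => chi ξ x * f (x - z)) z, ← integral_const_mul]
  refine integral_congr_ae (Eventually.of_forall fun x => ?_)
  simp only [add_sub_cancel_right, chi_add]
  ring

theorem integrable_chi_mul {f : E d → ℂ} (hf : Integrable f) (ξ : E d) :
    Integrable fun x => chi ξ x * f x :=
  hf.bdd_mul (continuous_chi ξ).aestronglyMeasurable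
      (Eventually.of_forall fun v => (norm_chi ξ v).le)

/-- A bound for the increments of a test field. -/
theorem exists_increment_bound {Φ : E d → E d} (hΦ : ContDiff ℝ ∞ Φ) (hc : HasCompactSupport Φ) :
    ∃ C : ℝ, 0 ≤ C ∧ ∀ x z, ‖Φ x - Φ (x - z)‖ ≤ C * min ‖z‖ 1 *
      ((tsupport Φ).indicator 1 x + (tsupport Φ).indicator 1 (x - z)) := by
  obtain ⟨L, hL⟩ := hΦ.lipschitzWith_of_hasCompactSupport hc (by simp)
  obtain ⟨M, hM⟩ := hΦ.continuous.bounded_above_of_compact_support hc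
  have hM0 : 0 ≤ M := (norm_nonneg _).trans (hM 0)
  refine ⟨L + 2 * M, by positivity, fun x z => ?_⟩
  have h1 : ‖Φ x - Φ (x - z)‖ ≤ L * ‖z‖ := by
    have := hL.dist_le_mul x (x - z)
    rwa [dist_eq_norm, dist_eq_norm, sub_sub_cancel] at this
  have h2 : ‖Φ x - Φ (x - z)‖ ≤ 2 * M :=
    (norm_sub_le _ _).trans (by linarith [hM x, hM (x - z)])
  have h3 : ‖Φ x - Φ (x - z)‖ ≤ (L + 2 * M) * min ‖z‖ 1 := by
    have hz := norm_nonneg z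
    have hL0 := L.coe_nonneg
    rcases min_cases ‖z‖ 1 with ⟨h, -⟩ | ⟨h, -⟩ <;> rw [h] <;> nlinarith
  have h0 : ∀ y, y ∉ tsupport Φ → Φ y = 0 := fun y hy => image_eq_zero_of_notMem_tsupport hy
  by_cases hx : x ∈ tsupport Φ
  · refine h3.trans (le_mul_of_one_le_right ((norm_nonneg _).trans h3) ?_)
    rw [indicator_of_mem hx, Pi.one_apply]
    exact le_add_of_nonneg_right (indicator_nonneg (fun _ _ => zero_le_one) _)
  · by_cases hz : x - z ∈ tsupport Φ
    · refine h3.trans (le_mul_of_one_le_right ((norm_nonneg _).trans h3) ?_)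
      rw [indicator_of_mem hz, Pi.one_apply]
      exact le_add_of_nonneg_left (indicator_nonneg (fun _ _ => zero_le_one) _)
    · rw [h0 x hx, h0 _ hz, indicator_of_notMem hx, indicator_of_notMem hz]; simp

/-- The integrand of the fractional divergence, in the variables `x` and `z = x - y`. -/
def divIntegrand (s : ℝ) (Φ : E d → E d) (x z : E d) : ℝ :=
  inner ℝ (Φ x - Φ (x - z)) z / ‖z‖ ^ ((d : ℝ) + s + 1)

theorem rieszDiv_eq {s : ℝ} (hs : s ≠ 1) (Φ : E d → E d) (x : E d) :
    rieszDiv s Φ x = rieszConst d s * ∫ z, divIntegrand s Φ x z := by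
  rw [rieszDiv, if_neg hs, ← integral_sub_left_eq_self (fun z => divIntegrand s Φ x z) volume x]
  simp [divIntegrand]

theorem norm_divIntegrand_le {Φ : E d → E d} {C : ℝ}
    (h : ∀ x z, ‖Φ x - Φ (x - z)‖ ≤ C * min ‖z‖ 1 *
      ((tsupport Φ).indicator 1 x + (tsupport Φ).indicator 1 (x - z))) (s : ℝ) (x z : E d) :
    ‖divIntegrand s Φ x z‖ ≤ C * (min ‖z‖ 1 * ‖z‖ ^ (-((d : ℝ) + s))) *
      ((tsupport Φ).indicator 1 x + (tsupport Φ).indicator 1 (x - z)) := by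
  have hind : ∀ y, (0 : ℝ) ≤ (tsupport Φ).indicator 1 y := fun y =>
    indicator_nonneg (fun _ _ => zero_le_one) _
  have hrhs := add_nonneg (hind x) (hind (x - z))
  rcases eq_or_ne z 0 with rfl | hz
  · simp [divIntegrand]
  have hz' : 0 < ‖z‖ := norm_pos_iff.mpr hz
  rw [divIntegrand, norm_div, Real.norm_of_nonneg (Real.rpow_nonneg (norm_nonneg z) _),
    div_le_iff₀ (by positivity)]
  have h1 : ‖z‖ ^ (-((d : ℝ) + s)) * ‖z‖ ^ ((d : ℝ) + s + 1) = ‖z‖ := by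
    rw [← Real.rpow_add hz']
    have : -((d : ℝ) + s) + (d + s + 1) = 1 := by ring
    rw [this, Real.rpow_one]
  calc ‖inner ℝ (Φ x - Φ (x - z)) z‖ ≤ ‖Φ x - Φ (x - z)‖ * ‖z‖ := norm_inner_le_norm _ _
    _ ≤ (C * min ‖z‖ 1 * ((tsupport Φ).indicator 1 x + (tsupport Φ).indicator 1 (x - z))) * ‖z‖ := by
        gcongr; exact h x z
    _ = C * min ‖z‖ 1 * ((tsupport Φ).indicator 1 x + (tsupport Φ).indicator 1 (x - z)) *
        (‖z‖ ^ (-((d : ℝ) + s)) * ‖z‖ ^ ((d : ℝ) + s + 1)) := by rw [h1]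
    _ = _ := by ring

/-- The joint integrability needed for Fubini. With k(z) = min(|z|, 1)|z|^(-d-s) and K the support
of Φ, the majorant is a constant times k(z)1_K(x) + k(z)1_K(x - z): a product plus a convolution
integrand. -/
theorem integrable_divIntegrand (hd : 0 < d) {s : ℝ} (hs0 : 0 < s) (hs1 : s < 1) {Φ : E d → E d}
    (hΦ : ContDiff ℝ ∞ Φ) (hc : HasCompactSupport Φ) :
    Integrable (Function.uncurry (divIntegrand s Φ)) (volume.prod volume) := by
  obtain ⟨C, hC, h⟩ := exists_increment_bound hΦ hc
  have hk := integrable_min_mul_rpow hd hs0 hs1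
  have hK : Integrable ((tsupport Φ).indicator (1 : E d → ℝ)) :=
    (integrable_indicator_iff (isClosed_tsupport Φ).measurableSet).mpr
      (integrableOn_const hc.measure_lt_top.ne)
  have h1 := hK.mul_prod hk
  have h2 := hk.convolution_integrand (ContinuousLinearMap.mul ℝ ℝ) hK
  refine Integrable.mono' ((h1.add h2).const_mul C) ?_ (Eventually.of_forall fun p => ?_)
  · refine Measurable.aestronglyMeasurable ?_
    have hΦm := hΦ.continuous.measurable
    have e1 : Measurable fun p : E d × E d => Φ p.1 - Φ (p.1 - p.2) := by fun_prop
    have e2 : Measurable fun p : E d × E d => ‖p.2‖ ^ ((d : ℝ) + s + 1) := by fun_prop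
    exact (e1.inner measurable_snd).div e2
  · refine (norm_divIntegrand_le h s p.1 p.2).trans (le_of_eq ?_)
    simp only [Pi.add_apply, ContinuousLinearMap.mul_apply']
    ring

theorem integrable_component {Φ : E d → E d}
    (hΦ : ContDiff ℝ ∞ Φ) (hc : HasCompactSupport Φ) (i : Fin d) :
    Integrable fun x => ((Φ x i : ℝ) : ℂ) := by
  have h1 : Integrable Φ := hΦ.continuous.integrable_of_hasCompactSupport hc
  refine h1.mono ?_ (Eventually.of_forall fun x => ?_)
  · have := hΦ.continuous
    exact Continuous.aestronglyMeasurable (by fun_prop)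
  · rw [norm_real]; exact PiLp.norm_apply_le _ _

/-- Translation by z multiplies a transform by `chi ξ z`, so the increment Φ(x) - Φ(x - z) yields
the factor `1 - chi ξ z`. -/
theorem integral_chi_mul_divIntegrand {s : ℝ} {Φ : E d → E d} (hΦ : ContDiff ℝ ∞ Φ)
    (hc : HasCompactSupport Φ) (ξ z : E d) :
    ∫ x, chi ξ x * (divIntegrand s Φ x z : ℂ)
      = ∑ i, ft (fun x => Φ x i) ξ * (((z i / ‖z‖ ^ ((d : ℝ) + s + 1) : ℝ) : ℂ) * (1 - chi ξ z)) := by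
  have hi := integrable_component hΦ hc
  have h1 : ∀ x, chi ξ x * (divIntegrand s Φ x z : ℂ)
      = ∑ i, ((z i / ‖z‖ ^ ((d : ℝ) + s + 1) : ℝ) : ℂ) *
        (chi ξ x * ((Φ x i : ℝ) : ℂ) - chi ξ x * ((Φ (x - z) i : ℝ) : ℂ)) := by
    intro x
    rw [divIntegrand, PiLp.inner_apply, Finset.sum_div, ofReal_sum, Finset.mul_sum]
    refine Finset.sum_congr rfl fun i _ => ?_
    simp only [RCLike.inner_apply, conj_trivial, PiLp.sub_apply]
    push_cast
    ring
  have hi' : ∀ i, Integrable fun x => chi ξ x * ((Φ (x - z) i : ℝ) : ℂ) := fun i =>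
    integrable_chi_mul ((hi i).comp_sub_right z) ξ
  simp_rw [h1]
  rw [integral_finsetSum]
  · refine Finset.sum_congr rfl fun i _ => ?_
    rw [integral_const_mul, integral_sub (integrable_chi_mul (hi i) ξ) (hi' i), ft_apply,
      integral_chi_mul_sub (fun x => ((Φ x i : ℝ) : ℂ)) ξ z]
    ring
  · exact fun i _ => ((integrable_chi_mul (hi i) ξ).sub (hi' i)).const_mul _

theorem rieszDiv_one (Φ : E d → E d) (x : E d) :
    rieszDiv 1 Φ x = ∑ i : Fin d, (fderiv ℝ Φ x (EuclideanSpace.single i 1)) i := by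
  rw [rieszDiv, if_pos rfl]

theorem continuous_rieszDiv_one {Φ : E d → E d} (hΦ : ContDiff ℝ ∞ Φ) :
    Continuous (rieszDiv 1 Φ) := by
  have h1 : Continuous (fderiv ℝ Φ) := hΦ.continuous_fderiv (by simp)
  have : rieszDiv 1 Φ = fun x => ∑ i : Fin d, (fderiv ℝ Φ x (EuclideanSpace.single i 1)) i :=
    funext fun x => rieszDiv_one Φ x
  rw [this]
  fun_prop

theorem hasCompactSupport_rieszDiv_one {Φ : E d → E d} (hc : HasCompactSupport Φ) :
    HasCompactSupport (rieszDiv 1 Φ) := by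
  refine (hc.fderiv ℝ).mono' fun x hx => subset_tsupport _ ?_
  intro h0
  refine hx ?_
  rw [rieszDiv_one, h0]
  simp

theorem ft_rieszDiv_one {Φ : E d → E d} (hΦ : ContDiff ℝ ∞ Φ) (hc : HasCompactSupport Φ) (ξ : E d) :
    ft (rieszDiv 1 Φ) ξ = ∑ i, symb 1 i ξ * ft (fun x => Φ x i) ξ := by
  have hi := integrable_component hΦ hc
  have hΦd : Differentiable ℝ Φ := hΦ.differentiable (by simp)
  let f : Fin d → E d → ℂ := fun i x => ((Φ x i : ℝ) : ℂ)
  let L : Fin d → E d →L[ℝ] ℂ := fun i => Complex.ofRealCLM.comp (EuclideanSpace.proj i)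
  have hfL : ∀ i, f i = L i ∘ Φ := fun i => rfl
  have hfd : ∀ i, Differentiable ℝ (f i) := fun i => by
    rw [hfL]; exact (L i).differentiable.comp hΦd
  have hfderiv : ∀ i x, fderiv ℝ (f i) x = (L i).comp (fderiv ℝ Φ x) := fun i x => by
    rw [hfL]; exact ((L i).hasFDerivAt.comp x (hΦd x).hasFDerivAt).fderiv
  have hint : Integrable (fderiv ℝ Φ) :=
    (hΦ.continuous_fderiv (by simp)).integrable_of_hasCompactSupport (hc.fderiv ℝ)
  have hfint : ∀ i, Integrable (fderiv ℝ (f i)) := fun i => by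
    have : fderiv ℝ (f i) = fun x => ContinuousLinearMap.compL ℝ (E d) (E d) ℂ (L i) (fderiv ℝ Φ x) := by
      funext x; rw [hfderiv]; rfl
    rw [this]
    exact (ContinuousLinearMap.compL ℝ (E d) (E d) ℂ (L i)).integrable_comp hint
  have hsum : ∀ x, chi ξ x * (rieszDiv 1 Φ x : ℂ)
      = ∑ i, chi ξ x * (fderiv ℝ (f i) x (EuclideanSpace.single i 1)) := by
    intro x
    rw [rieszDiv_one, ofReal_sum, Finset.mul_sum]
    refine Finset.sum_congr rfl fun i _ => ?_
    rw [hfderiv]; rfl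
  rw [ft_apply]
  simp_rw [hsum]
  have hfint' : ∀ i, Integrable fun x => chi ξ x * (fderiv ℝ (f i) x (EuclideanSpace.single i 1)) :=
    fun i => integrable_chi_mul
      ((ContinuousLinearMap.apply ℝ ℂ (EuclideanSpace.single i (1 : ℝ))).integrable_comp (hfint i)) ξ
  rw [integral_finsetSum _ fun i _ => hfint' i]
  refine Finset.sum_congr rfl fun i _ => ?_
  have h1 := DFunLike.congr_fun (congrFun (Real.fourier_fderiv (hi i) (hfd i) (hfint i)) ξ)
    (EuclideanSpace.single i (1 : ℝ))
  rw [Real.fourier_continuousLinearMap_apply (hfint i), fourier_eq_integral_chi,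
    VectorFourier.fourierSMulRight_apply] at h1
  rw [h1]
  have h8 : ((-innerSL ℝ : E d →L[ℝ] E d →L[ℝ] ℝ) ξ) (EuclideanSpace.single i 1) = -ξ i :=
    congrArg Neg.neg ((EuclideanSpace.inner_single_right i (1 : ℝ) ξ).trans (by simp))
  rw [h8, symb, sub_self, Real.rpow_zero, Real.rpow_one, ft]
  simp only [smul_eq_mul, real_smul]
  push_cast
  ring

theorem integrable_rieszDiv (hd : 0 < d) {s : ℝ} (hs0 : 0 < s) (hs1 : s ≤ 1) {Φ : E d → E d}
    (hΦ : ContDiff ℝ ∞ Φ) (hc : HasCompactSupport Φ) : Integrable (rieszDiv s Φ) := by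
  rcases hs1.eq_or_lt with rfl | hs
  · exact (continuous_rieszDiv_one hΦ).integrable_of_hasCompactSupport
      (hasCompactSupport_rieszDiv_one hc)
  · have := (integrable_divIntegrand hd hs0 hs hΦ hc).integral_prod_left.const_mul (rieszConst d s)
    exact this.congr (Eventually.of_forall fun x => (rieszDiv_eq hs.ne Φ x).symm)

theorem exists_bound_rieszDiv (hd : 0 < d) {s : ℝ} (hs0 : 0 < s) (hs1 : s ≤ 1) {Φ : E d → E d}
    (hΦ : ContDiff ℝ ∞ Φ) (hc : HasCompactSupport Φ) : ∃ M, ∀ x, ‖rieszDiv s Φ x‖ ≤ M := by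
  rcases hs1.eq_or_lt with rfl | hs
  · exact (continuous_rieszDiv_one hΦ).bounded_above_of_compact_support
      (hasCompactSupport_rieszDiv_one hc)
  · obtain ⟨C, hC, h⟩ := exists_increment_bound hΦ hc
    have hk := integrable_min_mul_rpow hd hs0 hs
    refine ⟨‖rieszConst d s‖ * ∫ z : E d, C * (min ‖z‖ 1 * ‖z‖ ^ (-((d : ℝ) + s))) * 2, fun x => ?_⟩
    rw [rieszDiv_eq hs.ne, norm_mul]
    gcongr
    refine norm_integral_le_of_norm_le ((hk.const_mul C).mul_const 2) (Eventually.of_forall fun z => ?_)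
    refine (norm_divIntegrand_le h s x z).trans ?_
    gcongr
    have hind : ∀ y, (tsupport Φ).indicator (1 : E d → ℝ) y ≤ 1 := fun y =>
      indicator_le_self' (fun _ _ => zero_le_one) y
    linarith [hind x, hind (x - z)]

/-- Integrable and bounded implies square integrable. As an element of L² the divergence can be
paired with weakly convergent sequences. -/
theorem memLp_rieszDiv (hd : 0 < d) {s : ℝ} (hs0 : 0 < s) (hs1 : s ≤ 1) {Φ : E d → E d}
    (hΦ : ContDiff ℝ ∞ Φ) (hc : HasCompactSupport Φ) : MemLp (rieszDiv s Φ) 2 := by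
  have hi := integrable_rieszDiv hd hs0 hs1 hΦ hc
  obtain ⟨M, hM⟩ := exists_bound_rieszDiv hd hs0 hs1 hΦ hc
  rw [memLp_two_iff_integrable_sq hi.aestronglyMeasurable]
  refine (hi.norm.const_mul M).mono' (hi.aestronglyMeasurable.pow 2) (Eventually.of_forall fun x => ?_)
  rw [norm_pow, pow_two]
  gcongr
  exact hM x

/-- On the Fourier side the fractional divergence is multiplication by the symbol. -/
theorem ft_rieszDiv (hd : 0 < d) {s : ℝ} (hs0 : 0 < s) (hs1 : s ≤ 1) {Φ : E d → E d}
    (hΦ : ContDiff ℝ ∞ Φ) (hc : HasCompactSupport Φ) (ξ : E d) :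
    ft (rieszDiv s Φ) ξ = ∑ i, symb s i ξ * ft (fun x => Φ x i) ξ := by
  rcases hs1.eq_or_lt with rfl | hs
  · exact ft_rieszDiv_one hΦ hc ξ
  have hprod : Integrable (Function.uncurry fun x z => chi ξ x * (divIntegrand s Φ x z : ℂ))
      (volume.prod volume) :=
    ((integrable_divIntegrand hd hs0 hs hΦ hc).ofReal (𝕜 := ℂ)).bdd_mul
      ((continuous_chi ξ).comp continuous_fst).aestronglyMeasurable
      (Eventually.of_forall fun v => (norm_chi ξ v.1).le)
  have h1 : ∀ x, chi ξ x * (rieszDiv s Φ x : ℂ)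
      = (rieszConst d s : ℂ) * ∫ z, chi ξ x * (divIntegrand s Φ x z : ℂ) := by
    intro x
    rw [rieszDiv_eq hs.ne, integral_const_mul, integral_complex_ofReal]
    push_cast; ring
  rw [ft_apply]
  simp_rw [h1]
  rw [integral_const_mul, integral_integral_swap hprod]
  simp_rw [integral_chi_mul_divIntegrand hΦ hc]
  rw [integral_finsetSum _ fun i _ => (integrable_kernel hd hs0 hs ξ i).const_mul _, Finset.mul_sum]
  refine Finset.sum_congr rfl fun i _ => ?_
  rw [integral_const_mul, mul_left_comm, rieszConst_mul_integral_kernel hd hs0 hs, mul_comm]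

end Divergence

end

end FracEigen

namespace FracEigen

noncomputable section

open Filter Topology Complex
open scoped FourierTransform ENNReal Real

/-! ### Plancherel and Parseval for real functions and fields. -/

section Plancherel

variable {d : ℕ}

/-- `L²(ℝᵈ; ℂ)`. -/
abbrev L2C (d : ℕ) : Type := Lp ℂ 2 (volume : Measure (E d))

theorem continuous_fourier {f : E d → ℂ} (hf : Integrable f) : Continuous (𝓕 f) :=
  VectorFourier.fourierIntegral_continuous Real.continuous_fourierChar
    (L := innerₗ (E d)) continuous_inner hf

/-- On `L¹ ∩ L²` the Fourier transform of `L²` is given by the Fourier integral. -/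
theorem fourier_toLp_ae_eq {f : E d → ℂ} (h1 : Integrable f) (h2 : MemLp f 2) :
    (𝓕 (h2.toLp f) : L2C d) =ᵐ[volume] 𝓕 f := by
  refine ae_eq_of_integral_contDiff_smul_eq
    ((Lp.memLp _).locallyIntegrable one_le_two) (continuous_fourier h1).locallyIntegrable ?_
  intro g hg hgc
  have hgC : ContDiff ℝ ∞ fun x => (g x : ℂ) := Complex.ofRealCLM.contDiff.comp hg
  have hgcC : HasCompactSupport fun x => (g x : ℂ) := hgc.comp_left Complex.ofReal_zero
  let ψ : SchwartzMap (E d) ℂ := hgcC.toSchwartzMap hgC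
  have hψ : ∀ x, ψ x = (g x : ℂ) := fun x => rfl
  -- The L² transform is also the distributional one, so testing it with g moves the transform onto
  -- g; Fubini does the same for the Fourier integral.
  have e1 := DFunLike.congr_fun (Lp.fourier_toTemperedDistribution_eq (h2.toLp f)) ψ
  rw [TemperedDistribution.fourier_apply, Lp.toTemperedDistribution_apply,
    Lp.toTemperedDistribution_apply] at e1
  have e2 : ∫ x, g x • (𝓕 (h2.toLp f) : L2C d) x = ∫ x, ψ x • (𝓕 (h2.toLp f) : L2C d) x := by
    simp only [hψ, real_smul, smul_eq_mul]
  rw [e2, ← e1]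
  have e3 : ∫ x, (𝓕 ψ) x • (h2.toLp f) x = ∫ x, (𝓕 (ψ : E d → ℂ)) x • f x := by
    refine integral_congr_ae ?_
    filter_upwards [h2.coeFn_toLp] with x hx
    rw [hx, SchwartzMap.fourier_coe]
  rw [e3]
  have e4 := VectorFourier.integral_fourierIntegral_smul_eq_flip (μ := volume) (ν := volume)
    (L := innerₗ (E d)) Real.continuous_fourierChar continuous_inner (ψ.integrable (μ := volume)) h1
  rw [flip_innerₗ] at e4
  exact e4

theorem lintegral_enorm_sq {F : Type*} [NormedAddCommGroup F] (f : E d → F) :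
    ∫⁻ x, ‖f x‖ₑ ^ 2 = eLpNorm f 2 volume ^ 2 := by
  have := eLpNorm_nnreal_pow_eq_lintegral (f := f) (μ := (volume : Measure (E d)))
    (p := 2) two_ne_zero
  simpa using this.symm

theorem memLp_two_of_lintegral {F : Type*} [NormedAddCommGroup F] {f : E d → F}
    (hf : AEStronglyMeasurable f volume) (h : ∫⁻ x, ‖f x‖ₑ ^ 2 < ⊤) : MemLp f 2 := by
  refine ⟨hf, ?_⟩
  rw [lintegral_enorm_sq] at h
  by_contra hcon
  rw [not_lt, top_le_iff] at hcon
  simp [hcon] at h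

theorem enorm_sq_eq_lintegral {F : Type*} [NormedAddCommGroup F] (f : Lp F 2 (volume : Measure (E d))) :
    ‖f‖ₑ ^ 2 = ∫⁻ x, ‖f x‖ₑ ^ 2 := by
  rw [Lp.enorm_def, lintegral_enorm_sq]

theorem enorm_toLp_sq {F : Type*} [NormedAddCommGroup F] {f : E d → F} (hf : MemLp f 2) :
    ‖hf.toLp f‖ₑ ^ 2 = ∫⁻ x, ‖f x‖ₑ ^ 2 := by
  rw [Lp.enorm_toLp, lintegral_enorm_sq]

/-- Complexification `L²(ℝᵈ) → L²(ℝᵈ; ℂ)`. -/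
def cpx : L2 d →L[ℝ] L2C d := Complex.ofRealCLM.compLpL 2 volume

theorem coeFn_cpx (u : L2 d) : cpx u =ᵐ[volume] fun x => (u x : ℂ) :=
  Complex.ofRealCLM.coeFn_compLpL u

/-- The `i`-th component of a field, complexified. -/
def compC (i : Fin d) : L2Vec d →L[ℝ] L2C d :=
  (Complex.ofRealCLM.comp (EuclideanSpace.proj i)).compLpL 2 volume

theorem coeFn_compC (i : Fin d) (G : L2Vec d) : compC i G =ᵐ[volume] fun x => ((G x i : ℝ) : ℂ) :=
  (Complex.ofRealCLM.comp (EuclideanSpace.proj i)).coeFn_compLpL G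

theorem enorm_cpx (u : L2 d) : ‖cpx u‖ₑ = ‖u‖ₑ := by
  rw [Lp.enorm_def, Lp.enorm_def]
  refine eLpNorm_congr_norm_ae ?_
  filter_upwards [coeFn_cpx u] with x hx
  rw [hx, norm_real]

/-- The fields are real but Plancherel lives in complex L², so norms are computed through
complexified components. -/
theorem inner_L2Vec_eq_sum (G F : L2Vec d) :
    inner ℝ G F = ∑ i, (inner ℂ (compC i G) (compC i F)).re := by
  have h1 : ∀ i, inner ℂ (compC i G) (compC i F) = ((∫ x, G x i * F x i : ℝ) : ℂ) := by
    intro i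
    rw [L2.inner_def, ← integral_complex_ofReal]
    refine integral_congr_ae ?_
    filter_upwards [coeFn_compC i G, coeFn_compC i F] with x h1 h2
    rw [h1, h2, RCLike.inner_apply, conj_ofReal, ofReal_mul, mul_comm]
  simp_rw [h1, ofReal_re]
  rw [← integral_finsetSum, L2.inner_def]
  · refine integral_congr_ae (Eventually.of_forall fun x => ?_)
    simp only [PiLp.inner_apply, RCLike.inner_apply, conj_trivial]
    exact Finset.sum_congr rfl fun i _ => mul_comm _ _
  · intro i _
    have hG : MemLp (fun x => G x i) 2 := (Lp.memLp G).eval_piLp i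
    have hF : MemLp (fun x => F x i) 2 := (Lp.memLp F).eval_piLp i
    exact hG.integrable_mul hF

theorem norm_sq_L2Vec_eq_sum (G : L2Vec d) : ‖G‖ ^ 2 = ∑ i, ‖compC i G‖ ^ 2 := by
  rw [← real_inner_self_eq_norm_sq, inner_L2Vec_eq_sum]
  refine Finset.sum_congr rfl fun i _ => ?_
  rw [← inner_self_eq_norm_sq (𝕜 := ℂ)]; rfl

theorem enorm_sq_L2Vec_eq_sum (G : L2Vec d) : ‖G‖ₑ ^ 2 = ∑ i, ‖compC i G‖ₑ ^ 2 := by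
  have h1 : ∀ {F : Type} [NormedAddCommGroup F] (a : F), ‖a‖ₑ ^ 2 = ENNReal.ofReal (‖a‖ ^ 2) := by
    intro F _ a
    rw [ENNReal.ofReal_pow (norm_nonneg a), ofReal_norm]
  rw [h1, norm_sq_L2Vec_eq_sum, ENNReal.ofReal_sum_of_nonneg fun i _ => sq_nonneg _]
  exact Finset.sum_congr rfl fun i _ => (h1 _).symm

theorem integrable_ofReal {u : E d → ℝ} (h : Integrable u) : Integrable fun x => (u x : ℂ) :=
  h.ofReal

theorem memLp_ofReal {u : E d → ℝ} (h2 : MemLp u 2) : MemLp (fun x => (u x : ℂ)) 2 := h2.ofReal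

theorem continuous_ft {u : E d → ℝ} (h1 : Integrable u) : Continuous (ft u) :=
  continuous_fourier (integrable_ofReal h1)

theorem memLp_ft {u : E d → ℝ} (h1 : Integrable u) (h2 : MemLp u 2) : MemLp (ft u) 2 :=
  (memLp_congr_ae (fourier_toLp_ae_eq (integrable_ofReal h1) (memLp_ofReal h2))).mp (Lp.memLp _)

theorem lintegral_ft_sq {u : E d → ℝ} (h1 : Integrable u) (h2 : MemLp u 2) :
    ∫⁻ ξ, ‖ft u ξ‖ₑ ^ 2 = ∫⁻ x, ‖u x‖ₑ ^ 2 := by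
  have e1 : ∫⁻ ξ, ‖ft u ξ‖ₑ ^ 2 = ‖(𝓕 ((memLp_ofReal h2).toLp _) : L2C d)‖ₑ ^ 2 := by
    rw [enorm_sq_eq_lintegral]
    refine lintegral_congr_ae ?_
    filter_upwards [fourier_toLp_ae_eq (integrable_ofReal h1) (memLp_ofReal h2)] with x hx
    rw [hx]; rfl
  rw [e1, ← ofReal_norm, Lp.norm_fourier_eq, ofReal_norm, enorm_toLp_sq]
  simp [enorm_eq_nnnorm]

theorem ft_congr_ae {u v : E d → ℝ} (h : u =ᵐ[volume] v) : ft u = ft v := by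
  funext ξ
  rw [ft_apply, ft_apply]
  refine integral_congr_ae ?_
  filter_upwards [h] with x hx
  rw [hx]

theorem ft_add {u v : E d → ℝ} (hu : Integrable u) (hv : Integrable v) (ξ : E d) :
    ft (fun x => u x + v x) ξ = ft u ξ + ft v ξ := by
  rw [ft_apply, ft_apply, ft_apply, ← integral_add (integrable_chi_mul (integrable_ofReal hu) ξ)
    (integrable_chi_mul (integrable_ofReal hv) ξ)]
  refine integral_congr_ae (Eventually.of_forall fun x => ?_)
  simp [mul_add]

theorem ft_sub {u v : E d → ℝ} (hu : Integrable u) (hv : Integrable v) (ξ : E d) :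
    ft (fun x => u x - v x) ξ = ft u ξ - ft v ξ := by
  rw [ft_apply, ft_apply, ft_apply, ← integral_sub (integrable_chi_mul (integrable_ofReal hu) ξ)
    (integrable_chi_mul (integrable_ofReal hv) ξ)]
  refine integral_congr_ae (Eventually.of_forall fun x => ?_)
  simp [mul_sub]

theorem inner_toLp_eq_integral {f g : E d → ℂ} (hf : MemLp f 2) (hg : MemLp g 2) :
    inner ℂ (hf.toLp f : L2C d) (hg.toLp g) = ∫ x, (starRingEnd ℂ (f x)) * g x := by
  rw [L2.inner_def]
  refine integral_congr_ae ?_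
  filter_upwards [hf.coeFn_toLp, hg.coeFn_toLp] with x h1 h2
  rw [h1, h2, RCLike.inner_apply, mul_comm]

theorem parseval {f g : E d → ℂ} (hf1 : Integrable f) (hf2 : MemLp f 2) (hg1 : Integrable g)
    (hg2 : MemLp g 2) :
    ∫ ξ, (starRingEnd ℂ (𝓕 f ξ)) * 𝓕 g ξ = ∫ x, (starRingEnd ℂ (f x)) * g x := by
  rw [← inner_toLp_eq_integral hf2 hg2, ← Lp.inner_fourier_eq, L2.inner_def]
  refine integral_congr_ae ?_
  filter_upwards [fourier_toLp_ae_eq hf1 hf2, fourier_toLp_ae_eq hg1 hg2] with x h1 h2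
  rw [h1, h2, RCLike.inner_apply, mul_comm]

end Plancherel

/-! ### Existence and uniqueness of Riesz gradients. -/

section Gradient

variable {d : ℕ}

/-- The symbol is purely imaginary: this is the source of the minus sign in the duality between D^s
and the s-divergence. -/
theorem conj_symb (s : ℝ) (i : Fin d) (ξ : E d) : starRingEnd ℂ (symb s i ξ) = -symb s i ξ := by
  rw [symb, map_mul, conj_I, conj_ofReal, neg_mul]

theorem continuous_test {Φ : E d → E d} (hΦ : ContDiff ℝ ∞ Φ) (i : Fin d) :
    Continuous fun x => Φ x i := by
  have := hΦ.continuous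
  fun_prop

theorem hasCompactSupport_component {Φ : E d → E d} (hc : HasCompactSupport Φ) (i : Fin d) :
    HasCompactSupport fun x => Φ x i :=
  hc.comp_left (g := fun v : E d => v i) rfl

/-- The weak formulation of `Ĝ = symb · û`. -/
theorem sum_inner_eq_neg_integral (hd : 0 < d) {s : ℝ} (hs0 : 0 < s) (hs1 : s ≤ 1) {u : L2 d}
    (hu : Integrable u) (g : Fin d → L2C d)
    (hg : ∀ i, (𝓕 (g i) : L2C d) =ᵐ[volume] fun ξ => symb s i ξ * ft u ξ)
    {Φ : E d → E d} (hΦ : ContDiff ℝ ∞ Φ) (hc : HasCompactSupport Φ) :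
    ∑ i, ∫ x, (starRingEnd ℂ (g i x)) * (Φ x i : ℂ) = ((-∫ x, u x * rieszDiv s Φ x : ℝ) : ℂ) := by
  have hc1 : ∀ i, Integrable fun x => Φ x i := fun i =>
    (continuous_test hΦ i).integrable_of_hasCompactSupport (hasCompactSupport_component hc i)
  have hc2 : ∀ i, MemLp (fun x => Φ x i) 2 := fun i =>
    (continuous_test hΦ i).memLp_of_hasCompactSupport (hasCompactSupport_component hc i)
  have h1 : ∀ i, ∫ x, (starRingEnd ℂ (g i x)) * (Φ x i : ℂ)
      = ∫ ξ, (starRingEnd ℂ (symb s i ξ * ft u ξ)) * ft (fun x => Φ x i) ξ := by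
    intro i
    have e1 : ∫ x, (starRingEnd ℂ (g i x)) * (Φ x i : ℂ)
        = inner ℂ (g i) ((memLp_ofReal (hc2 i)).toLp _) := by
      rw [L2.inner_def]
      refine integral_congr_ae ?_
      filter_upwards [(memLp_ofReal (hc2 i)).coeFn_toLp] with x hx
      rw [hx, RCLike.inner_apply, mul_comm]
    rw [e1, ← Lp.inner_fourier_eq, L2.inner_def]
    refine integral_congr_ae ?_
    filter_upwards [hg i, fourier_toLp_ae_eq (integrable_ofReal (hc1 i)) (memLp_ofReal (hc2 i))]
      with ξ h1 h2
    rw [h1, h2, RCLike.inner_apply, mul_comm]; rfl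
  have hint : ∀ i, Integrable fun ξ =>
      (starRingEnd ℂ (symb s i ξ * ft u ξ)) * ft (fun x => Φ x i) ξ := by
    intro i
    have hm : MemLp (fun ξ => symb s i ξ * ft u ξ) 2 := (memLp_congr_ae (hg i)).mp (Lp.memLp _)
    exact hm.star.integrable_mul (memLp_ft (hc1 i) (hc2 i))
  simp_rw [h1]
  rw [← integral_finsetSum _ fun i _ => hint i]
  have hr1 := integrable_rieszDiv hd hs0 hs1 hΦ hc
  have hr2 := memLp_rieszDiv hd hs0 hs1 hΦ hc
  have h2 : ∀ ξ, ∑ i, (starRingEnd ℂ (symb s i ξ * ft u ξ)) * ft (fun x => Φ x i) ξ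
      = -((starRingEnd ℂ (ft u ξ)) * ft (rieszDiv s Φ) ξ) := by
    intro ξ
    rw [ft_rieszDiv hd hs0 hs1 hΦ hc, Finset.mul_sum, ← Finset.sum_neg_distrib]
    refine Finset.sum_congr rfl fun i _ => ?_
    rw [map_mul, conj_symb]; ring
  simp_rw [h2]
  rw [integral_neg]
  have h3 := parseval (integrable_ofReal hu) (memLp_ofReal (Lp.memLp u)) (integrable_ofReal hr1)
    (memLp_ofReal hr2)
  have h4 : ∫ ξ, (starRingEnd ℂ (ft u ξ)) * ft (rieszDiv s Φ) ξ
      = ((∫ x, u x * rieszDiv s Φ x : ℝ) : ℂ) := by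
    refine h3.trans ?_
    rw [← integral_complex_ofReal]
    refine integral_congr_ae (Eventually.of_forall fun x => ?_)
    simp
  rw [h4, ofReal_neg]

/-- A function in `L¹ ∩ L²` with `symb · û ∈ L²` has a Riesz gradient, given by the inverse Fourier
transform of `symb · û`. -/
theorem exists_isRieszGradient (hd : 0 < d) {s : ℝ} (hs0 : 0 < s) (hs1 : s ≤ 1) {u : L2 d}
    (hu : Integrable u) (hE : ∀ i, MemLp (fun ξ => symb s i ξ * ft u ξ) 2) :
    ∃ G : L2Vec d, IsRieszGradient s u G ∧
      ∀ i, (𝓕 (compC i G) : L2C d) =ᵐ[volume] fun ξ => symb s i ξ * ft u ξ := by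
  classical
  let g : Fin d → L2C d := fun i => 𝓕⁻ ((hE i).toLp _)
  have hFg : ∀ i, (𝓕 (g i) : L2C d) = (hE i).toLp _ := fun i => by
    simp [g]
  have hg : ∀ i, (𝓕 (g i) : L2C d) =ᵐ[volume] fun ξ => symb s i ξ * ft u ξ := fun i => by
    rw [hFg i]; exact (hE i).coeFn_toLp
  have key := fun (Φ : E d → E d) hΦ hc => sum_inner_eq_neg_integral hd hs0 hs1 hu g hg (Φ := Φ) hΦ hc
  -- The inverse transform is a priori complex. Paired with a real field φ e_i it gives a real
  -- number, by the weak identity `key`, so its imaginary part integrates to 0 against every φ.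
  have him : ∀ i, ∀ᵐ x, (g i x).im = 0 := by
    intro i
    have hmem : MemLp (fun x => (g i x).im) 2 := (Lp.memLp (g i)).im
    refine ae_eq_zero_of_integral_contDiff_smul_eq_zero (hmem.locallyIntegrable one_le_two) ?_
    intro φ hφ hφc
    let Φ : E d → E d := fun x => φ x • EuclideanSpace.single i (1 : ℝ)
    have hΦ : ContDiff ℝ ∞ Φ := hφ.smul contDiff_const
    have hΦc : HasCompactSupport Φ := hφc.smul_right
    have h1 := key Φ hΦ hΦc
    have h2 : ∀ j, j ≠ i → ∫ x, (starRingEnd ℂ (g j x)) * ((Φ x j : ℝ) : ℂ) = 0 := by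
      intro j hj
      simp [Φ, hj]
    rw [Finset.sum_eq_single i (fun j _ hj => h2 j hj) (by simp)] at h1
    have h3 := congrArg Complex.im h1
    rw [ofReal_im] at h3
    have hφ2 : MemLp φ 2 := hφ.continuous.memLp_of_hasCompactSupport hφc
    have hint : Integrable fun x => (starRingEnd ℂ (g i x)) * ((Φ x i : ℝ) : ℂ) := by
      have : ∀ x, ((Φ x i : ℝ) : ℂ) = (φ x : ℂ) := fun x => by simp [Φ]
      simp_rw [this]
      exact (Lp.memLp (g i)).star.integrable_mul (memLp_ofReal hφ2)
    have h4 : ∫ x, ((starRingEnd ℂ (g i x)) * ((Φ x i : ℝ) : ℂ)).im = 0 :=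
      (integral_im hint).trans h3
    have h5 : ∀ x, φ x • (g i x).im = -((starRingEnd ℂ (g i x)) * ((Φ x i : ℝ) : ℂ)).im := by
      intro x; simp [Φ, mul_comm]
    simp_rw [h5]
    rw [integral_neg, h4, neg_zero]
  have hG2 : MemLp (fun x => WithLp.toLp 2 fun i => (g i x).re : E d → E d) 2 :=
    MemLp.of_eval_piLp fun i => (Lp.memLp (g i)).re
  let G : L2Vec d := hG2.toLp _
  have hGg : ∀ i, compC i G = g i := by
    intro i
    refine Lp.ext ?_
    filter_upwards [coeFn_compC i G, hG2.coeFn_toLp, him i] with x h1 h2 h3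
    rw [h1, h2]
    exact Complex.ext (by simp) (by simp [h3])
  refine ⟨G, fun Φ hΦ hc => ?_, fun i => by rw [hGg i]; exact hg i⟩
  have h1 := key Φ hΦ hc
  have h2 : ∀ i, ∫ x, (starRingEnd ℂ (g i x)) * (Φ x i : ℂ) = ((∫ x, G x i * Φ x i : ℝ) : ℂ) := by
    intro i
    rw [← integral_complex_ofReal]
    refine integral_congr_ae ?_
    filter_upwards [coeFn_compC i G] with x hx
    rw [hGg i] at hx
    rw [hx, conj_ofReal, ofReal_mul]
  simp_rw [h2] at h1
  rw [← ofReal_sum, ofReal_inj] at h1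
  rw [← h1, ← integral_finsetSum]
  · refine integral_congr_ae (Eventually.of_forall fun x => ?_)
    simp only [PiLp.inner_apply, RCLike.inner_apply, conj_trivial]
    exact Finset.sum_congr rfl fun i _ => mul_comm _ _
  · intro i _
    have hGi : MemLp (fun x => G x i) 2 := (Lp.memLp G).eval_piLp i
    have hΦi : MemLp (fun x => Φ x i) 2 := (continuous_test hΦ i).memLp_of_hasCompactSupport
      (hasCompactSupport_component hc i)
    exact hGi.integrable_mul hΦi

theorem IsRieszGradient.unique {s : ℝ} {u : L2 d} {G G' : L2Vec d} (h : IsRieszGradient s u G)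
    (h' : IsRieszGradient s u G') : G = G' := by
  refine Lp.ext (ae_eq_of_integral_contDiff_smul_eq ((Lp.memLp G).locallyIntegrable one_le_two)
    ((Lp.memLp G').locallyIntegrable one_le_two) fun φ hφ hφc => ?_)
  have hφ2 : MemLp φ 2 := hφ.continuous.memLp_of_hasCompactSupport hφc
  have hi : ∀ F : L2Vec d, Integrable fun x => φ x • F x := fun F =>
    memLp_one_iff_integrable.mp ((Lp.memLp F).smul hφ2)
  refine ext_inner_left ℝ fun v => ?_
  rw [← integral_inner (hi G), ← integral_inner (hi G')]
  have e : ∀ F : L2Vec d, ∫ x, inner ℝ v (φ x • F x) = ∫ x, inner ℝ (F x) (φ x • v) := by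
    intro F
    refine integral_congr_ae (Eventually.of_forall fun x => ?_)
    simp only [inner_smul_right, real_inner_comm]
  have hΦ : ContDiff ℝ ∞ fun x => φ x • v := hφ.smul contDiff_const
  have hΦc : HasCompactSupport fun x => φ x • v := hφc.smul_right
  rw [e, e, h _ hΦ hΦc, h' _ hΦ hΦc]

end Gradient

end

end FracEigen

namespace FracEigen

noncomputable section

open Filter Topology Complex
open scoped FourierTransform ENNReal Real

/-! ### The energy as the squared norm of the gradient. -/

section Energy

variable {d : ℕ}

/-- `∫ (2π|ξ|)^{2s} |û(ξ)|² dξ`, the square of the norm of `D^s u`. -/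
def energy (s : ℝ) (u : E d → ℝ) : ℝ≥0∞ :=
  ∫⁻ ξ, ENNReal.ofReal ((2 * π * ‖ξ‖) ^ (2 * s)) * ‖ft u ξ‖ₑ ^ 2

/-- `G` is the gradient `D^s u` on the Fourier side. -/
def IsFourierGradient (s : ℝ) (u : L2 d) (G : L2Vec d) : Prop :=
  ∀ i, (𝓕 (compC i G) : L2C d) =ᵐ[volume] fun ξ => symb s i ξ * ft u ξ

theorem measurable_symb (s : ℝ) (i : Fin d) : Measurable (symb s i) := by
  unfold symb; fun_prop

theorem norm_symb_sq_sum {s : ℝ} (hs : 0 < s) (ξ : E d) :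
    ∑ i, ‖symb s i ξ‖ ^ 2 = (2 * π * ‖ξ‖) ^ (2 * s) := by
  have h1 : ∀ i, ‖symb s i ξ‖ ^ 2 = ((2 * π) ^ s * ‖ξ‖ ^ (s - 1)) ^ 2 * ‖ξ i‖ ^ 2 := by
    intro i
    rw [symb, norm_mul, norm_I, one_mul, norm_real, norm_mul, mul_pow,
      Real.norm_of_nonneg (by positivity)]
  simp_rw [h1]
  rw [← Finset.mul_sum, ← EuclideanSpace.norm_sq_eq]
  rcases eq_or_ne ξ 0 with rfl | hξ
  · simp only [norm_zero, mul_zero]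
    rw [Real.zero_rpow (mul_pos two_pos hs).ne']; simp
  have hξ' : 0 < ‖ξ‖ := norm_pos_iff.mpr hξ
  rw [← mul_pow, mul_assoc, Real.rpow_sub_one hξ'.ne', div_mul_cancel₀ _ hξ'.ne',
    ← Real.mul_rpow (by positivity) hξ'.le, ← Real.rpow_natCast, ← Real.rpow_mul (by positivity)]
  congr 1; push_cast; ring

theorem enorm_sq_eq_ofReal {F : Type*} [NormedAddCommGroup F] (a : F) :
    ‖a‖ₑ ^ 2 = ENNReal.ofReal (‖a‖ ^ 2) := by
  rw [ENNReal.ofReal_pow (norm_nonneg a), ofReal_norm]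

theorem enorm_symb_sq_sum {s : ℝ} (hs : 0 < s) (ξ : E d) :
    ∑ i, ‖symb s i ξ‖ₑ ^ 2 = ENNReal.ofReal ((2 * π * ‖ξ‖) ^ (2 * s)) := by
  simp_rw [enorm_sq_eq_ofReal]
  rw [← norm_symb_sq_sum hs, ENNReal.ofReal_sum_of_nonneg fun i _ => sq_nonneg _]

theorem energy_eq_sum {s : ℝ} (hs : 0 < s) {u : E d → ℝ} (hu : Integrable u) :
    energy s u = ∑ i, ∫⁻ ξ, ‖symb s i ξ * ft u ξ‖ₑ ^ 2 := by
  rw [← lintegral_finsetSum' _ fun i _ => ?_]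
  · refine lintegral_congr fun ξ => ?_
    simp_rw [enorm_mul, mul_pow]
    rw [← Finset.sum_mul, enorm_symb_sq_sum hs]
  · exact (((measurable_symb s i).mul (continuous_ft hu).measurable).enorm.pow_const 2).aemeasurable

theorem memLp_symb_mul_ft {s : ℝ} (hs : 0 < s) {u : E d → ℝ} (hu : Integrable u)
    (hE : energy s u < ⊤) (i : Fin d) : MemLp (fun ξ => symb s i ξ * ft u ξ) 2 := by
  refine memLp_two_of_lintegral
    ((measurable_symb s i).mul (continuous_ft hu).measurable).aestronglyMeasurable ?_
  rw [energy_eq_sum hs hu] at hE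
  exact ENNReal.sum_lt_top.mp hE i (Finset.mem_univ i)

theorem IsFourierGradient.enorm_sq {s : ℝ} (hs : 0 < s) {u : L2 d} (hu : Integrable u) {G : L2Vec d}
    (h : IsFourierGradient s u G) : ‖G‖ₑ ^ 2 = energy s u := by
  rw [enorm_sq_L2Vec_eq_sum, energy_eq_sum hs hu]
  refine Finset.sum_congr rfl fun i _ => ?_
  rw [← ofReal_norm, ← Lp.norm_fourier_eq, ofReal_norm, enorm_sq_eq_lintegral]
  refine lintegral_congr_ae ?_
  filter_upwards [h i] with ξ hξ
  rw [hξ]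

/-- A function in `L¹ ∩ L²` of finite energy has a Riesz gradient. -/
theorem exists_gradient_of_energy (hd : 0 < d) {s : ℝ} (hs0 : 0 < s) (hs1 : s ≤ 1) {u : L2 d}
    (hu : Integrable u) (hE : energy s u < ⊤) :
    ∃ G : L2Vec d, IsRieszGradient s u G ∧ IsFourierGradient s u G :=
  exists_isRieszGradient hd hs0 hs1 hu (memLp_symb_mul_ft hs0 hu hE)

/-- Finite energy provides some gradient with the right transform, and gradients are unique. -/
theorem IsRieszGradient.isFourierGradient (hd : 0 < d) {s : ℝ} (hs0 : 0 < s) (hs1 : s ≤ 1) {u : L2 d}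
    (hu : Integrable u) (hE : energy s u < ⊤) {G : L2Vec d} (h : IsRieszGradient s u G) :
    IsFourierGradient s u G := by
  obtain ⟨G', h1, h2⟩ := exists_gradient_of_energy hd hs0 hs1 hu hE
  rwa [h.unique h1]

theorem energy_congr_ae {s : ℝ} {u v : E d → ℝ} (h : u =ᵐ[volume] v) : energy s u = energy s v := by
  rw [energy, energy, ft_congr_ae h]

theorem enorm_sub_sq_of_isFourierGradient {s r : ℝ} {u : L2 d} {G G' : L2Vec d}
    (h : IsFourierGradient s u G) (h' : IsFourierGradient r u G') :
    ‖G - G'‖ₑ ^ 2 = ∑ i, ∫⁻ ξ, ‖(symb s i ξ - symb r i ξ) * ft u ξ‖ₑ ^ 2 := by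
  rw [enorm_sq_L2Vec_eq_sum]
  refine Finset.sum_congr rfl fun i _ => ?_
  rw [← ofReal_norm, ← Lp.norm_fourier_eq, ofReal_norm, enorm_sq_eq_lintegral]
  refine lintegral_congr_ae ?_
  have e : (𝓕 (compC i (G - G')) : L2C d) = 𝓕 (compC i G) - 𝓕 (compC i G') := by
    rw [map_sub]; exact map_sub (Lp.fourierTransformₗᵢ (E d) ℂ) _ _
  rw [e]
  filter_upwards [h i, h' i, Lp.coeFn_sub (𝓕 (compC i G) : L2C d) (𝓕 (compC i G'))] with ξ h1 h2 h3
  rw [h3, Pi.sub_apply, h1, h2, sub_mul]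

end Energy

/-! ### Continuity in the order s on test functions and test fields. -/

section TestFunctions

variable {d : ℕ}

theorem rpow_two_mul_le {x s : ℝ} (hx : 0 ≤ x) (hs0 : 0 ≤ s) (hs1 : s ≤ 1) :
    x ^ (2 * s) ≤ 1 + x ^ 2 := by
  rcases le_total x 1 with h | h
  · have := Real.rpow_le_one hx h (by positivity : 0 ≤ 2 * s)
    nlinarith [sq_nonneg x]
  · have : x ^ (2 * s) ≤ x ^ (2 : ℝ) := Real.rpow_le_rpow_of_exponent_le h (by linarith)
    rw [Real.rpow_two] at this
    linarith

/-- The transform of a test function is Schwartz. The weight dominates (2π|ξ|)^(2s) for all s ∈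
(0,1] at once, so a single majorant serves every order. -/
theorem integrable_weight_mul_ft_sq {φ : E d → ℝ} (hφ : ContDiff ℝ ∞ φ) (hc : HasCompactSupport φ) :
    Integrable fun ξ => (1 + (2 * π * ‖ξ‖) ^ 2) * ‖ft φ ξ‖ ^ 2 := by
  have hgC : ContDiff ℝ ∞ fun x => (φ x : ℂ) := Complex.ofRealCLM.contDiff.comp hφ
  have hgcC : HasCompactSupport fun x => (φ x : ℂ) := hc.comp_left Complex.ofReal_zero
  let ψ : SchwartzMap (E d) ℂ := 𝓕 (hgcC.toSchwartzMap hgC)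
  have hψ : ⇑ψ = ft φ := SchwartzMap.fourier_coe _
  have h0 := ψ.integrable_pow_mul volume 0
  have h2 := ψ.integrable_pow_mul volume 2
  obtain ⟨M, -, hM⟩ := ψ.decay 0 0
  rw [hψ] at h0 h2
  have hM' : ∀ ξ, ‖ft φ ξ‖ ≤ M := fun ξ => by
    have := hM ξ
    rw [hψ] at this
    simpa using this
  have hcont : Continuous (ft φ) := hψ ▸ ψ.continuous
  refine (((h0.add (h2.const_mul ((2 * π) ^ 2)))).const_mul M).mono' (by fun_prop)
    (Eventually.of_forall fun ξ => ?_)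
  rw [Real.norm_of_nonneg (by positivity)]
  simp only [Pi.add_apply, pow_zero, one_mul]
  have : (1 + (2 * π * ‖ξ‖) ^ 2) * ‖ft φ ξ‖ ^ 2
      = ‖ft φ ξ‖ * ((1 + (2 * π * ‖ξ‖) ^ 2) * ‖ft φ ξ‖) := by ring
  rw [this]
  calc _ ≤ M * ((1 + (2 * π * ‖ξ‖) ^ 2) * ‖ft φ ξ‖) := by gcongr; exact hM' ξ
    _ = _ := by ring

theorem energy_test_lt_top {φ : E d → ℝ} (hφ : ContDiff ℝ ∞ φ) (hc : HasCompactSupport φ) {s : ℝ}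
    (hs0 : 0 < s) (hs1 : s ≤ 1) : energy s φ < ⊤ := by
  refine lt_of_le_of_lt (lintegral_mono fun ξ => ?_)
    (integrable_weight_mul_ft_sq hφ hc).lintegral_lt_top
  rw [enorm_sq_eq_ofReal, ← ENNReal.ofReal_mul (by positivity)]
  refine ENNReal.ofReal_le_ofReal ?_
  gcongr
  exact rpow_two_mul_le (by positivity) hs0.le hs1

theorem tendsto_symb {s : ℕ → ℝ} {s₀ : ℝ} (hs : Tendsto s atTop (𝓝 s₀)) (i : Fin d) (ξ : E d) :
    Tendsto (fun n => symb (s n) i ξ) atTop (𝓝 (symb s₀ i ξ)) := by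
  -- At ξ = 0 the factor |ξ|^(s-1) need not be continuous in s, but the factor ξ_i kills it.
  rcases eq_or_ne ξ 0 with rfl | hξ
  · simp [symb]
  have hξ' : 0 < ‖ξ‖ := norm_pos_iff.mpr hξ
  have hcont : Continuous fun s : ℝ => symb s i ξ := by
    unfold symb
    have h1 : Continuous fun s : ℝ => (2 * π) ^ s :=
      continuous_const.rpow continuous_id fun _ => Or.inl (by positivity)
    have h2 : Continuous fun s : ℝ => ‖ξ‖ ^ (s - 1) :=
      continuous_const.rpow (by fun_prop) fun _ => Or.inl hξ'.ne'
    fun_prop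
  exact (hcont.tendsto s₀).comp hs

/-- Dominated convergence: the symbol is continuous in s at each frequency. The 4 in the majorant
comes from |a - b|² ≤ 2|a|² + 2|b|². -/
theorem tendsto_lintegral_symb_sub {s : ℕ → ℝ} {s₀ : ℝ} (hs : Tendsto s atTop (𝓝 s₀))
    (hs0 : ∀ n, 0 < s n) (hs1 : ∀ n, s n ≤ 1) (h₀ : 0 < s₀) (h₁ : s₀ ≤ 1) {φ : E d → ℝ}
    (hφ : ContDiff ℝ ∞ φ) (hc : HasCompactSupport φ) (i : Fin d) :
    Tendsto (fun n => ∫⁻ ξ, ‖(symb (s n) i ξ - symb s₀ i ξ) * ft φ ξ‖ₑ ^ 2) atTop (𝓝 0) := by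
  have hφ1 : Integrable φ := hφ.continuous.integrable_of_hasCompactSupport hc
  have h0 : ∫⁻ _ : E d, (0 : ℝ≥0∞) = 0 := by simp
  rw [← h0]
  refine tendsto_lintegral_of_dominated_convergence
    (fun ξ => ENNReal.ofReal (4 * ((1 + (2 * π * ‖ξ‖) ^ 2) * ‖ft φ ξ‖ ^ 2))) (fun n => ?_) (fun n => ?_)
    ((integrable_weight_mul_ft_sq hφ hc).const_mul 4).lintegral_lt_top.ne
    (Eventually.of_forall fun ξ => ?_)
  · exact ((((measurable_symb _ i).sub (measurable_symb _ i)).mul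
      (continuous_ft hφ1).measurable).enorm.pow_const 2)
  · refine Eventually.of_forall fun ξ => ?_
    simp only
    rw [enorm_sq_eq_ofReal]
    refine ENNReal.ofReal_le_ofReal ?_
    rw [norm_mul, mul_pow, ← mul_assoc]
    gcongr
    have hb : ∀ r : ℝ, 0 < r → r ≤ 1 → ‖symb r i ξ‖ ^ 2 ≤ 1 + (2 * π * ‖ξ‖) ^ 2 := by
      intro r hr0 hr1
      refine le_trans ?_ (rpow_two_mul_le (by positivity : 0 ≤ 2 * π * ‖ξ‖) hr0.le hr1)
      rw [← norm_symb_sq_sum hr0]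
      exact Finset.single_le_sum (f := fun i => ‖symb r i ξ‖ ^ 2) (fun i _ => sq_nonneg _)
        (Finset.mem_univ i)
    have h1 := hb _ (hs0 n) (hs1 n)
    have h2 := hb _ h₀ h₁
    have h3 := norm_sub_le (symb (s n) i ξ) (symb s₀ i ξ)
    have h4 := norm_nonneg (symb (s n) i ξ - symb s₀ i ξ)
    nlinarith [sq_nonneg (‖symb (s n) i ξ‖ - ‖symb s₀ i ξ‖)]
  · have h1 : Tendsto (fun n => (symb (s n) i ξ - symb s₀ i ξ) * ft φ ξ) atTop (𝓝 0) := by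
      have := ((tendsto_symb hs i ξ).sub_const (symb s₀ i ξ)).mul_const (ft φ ξ)
      simpa using this
    have h2 := (ENNReal.Tendsto.pow (n := 2) h1.enorm)
    simpa using h2

/-- `D^{sₙ} φ → D^s φ` in `L²` for a test function `φ`. -/
theorem tendsto_gradient_test {s : ℕ → ℝ} {s₀ : ℝ} (hs : Tendsto s atTop (𝓝 s₀))
    (hs0 : ∀ n, 0 < s n) (hs1 : ∀ n, s n ≤ 1) (h₀ : 0 < s₀) (h₁ : s₀ ≤ 1) {φ : E d → ℝ}
    (hφ : ContDiff ℝ ∞ φ) (hc : HasCompactSupport φ) {u : L2 d} (hu : u =ᵐ[volume] φ)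
    {G : ℕ → L2Vec d} {G₀ : L2Vec d} (hG : ∀ n, IsFourierGradient (s n) u (G n))
    (hG₀ : IsFourierGradient s₀ u G₀) : Tendsto G atTop (𝓝 G₀) := by
  have h1 : Tendsto (fun n => ‖G n - G₀‖ₑ ^ 2) atTop (𝓝 0) := by
    simp_rw [fun n => enorm_sub_sq_of_isFourierGradient (hG n) hG₀, ft_congr_ae hu]
    have := tendsto_finsetSum (Finset.univ : Finset (Fin d)) fun i _ =>
      tendsto_lintegral_symb_sub hs hs0 hs1 h₀ h₁ hφ hc i
    simpa using this
  rw [tendsto_iff_norm_sub_tendsto_zero]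
  have h2 := (ENNReal.tendsto_toReal ENNReal.zero_ne_top).comp h1
  have h3 : Tendsto (fun n => ‖G n - G₀‖ ^ 2) atTop (𝓝 0) := by
    refine (h2.congr fun n => ?_)
    simp [toReal_enorm]
  have h4 := h3.sqrt
  simpa using h4

/-- `D^{sₙ} · Φ → D^s · Φ` in `L²` for a test field `Φ`. -/
theorem tendsto_rieszDiv (hd : 0 < d) {s : ℕ → ℝ} {s₀ : ℝ} (hs : Tendsto s atTop (𝓝 s₀))
    (hs0 : ∀ n, 0 < s n) (hs1 : ∀ n, s n ≤ 1) (h₀ : 0 < s₀) (h₁ : s₀ ≤ 1) {Φ : E d → E d}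
    (hΦ : ContDiff ℝ ∞ Φ) (hc : HasCompactSupport Φ) :
    Tendsto (fun n => (memLp_rieszDiv hd (hs0 n) (hs1 n) hΦ hc).toLp (rieszDiv (s n) Φ)) atTop
      (𝓝 ((memLp_rieszDiv hd h₀ h₁ hΦ hc).toLp (rieszDiv s₀ Φ))) := by
  have hΦi : ∀ i, ContDiff ℝ ∞ fun x => Φ x i := fun i =>
    (EuclideanSpace.proj (𝕜 := ℝ) i).contDiff.comp hΦ
  have hi : ∀ i, Integrable fun x => Φ x i := fun i =>
    (continuous_test hΦ i).integrable_of_hasCompactSupport (hasCompactSupport_component hc i)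
  have hD1 := fun n => integrable_rieszDiv hd (hs0 n) (hs1 n) hΦ hc
  have hD1' := integrable_rieszDiv hd h₀ h₁ hΦ hc
  have hD2 := fun n => memLp_rieszDiv hd (hs0 n) (hs1 n) hΦ hc
  have hD2' := memLp_rieszDiv hd h₀ h₁ hΦ hc
  rw [Lp.tendsto_Lp_iff_tendsto_eLpNorm'']
  have h1 : ∀ n, eLpNorm (rieszDiv (s n) Φ - rieszDiv s₀ Φ) 2 volume
      ≤ ∑ i, eLpNorm (fun ξ => (symb (s n) i ξ - symb s₀ i ξ) * ft (fun x => Φ x i) ξ) 2 volume := by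
    intro n
    have e1 := lintegral_ft_sq ((hD1 n).sub hD1') ((hD2 n).sub hD2')
    rw [lintegral_enorm_sq, lintegral_enorm_sq] at e1
    have e2 : eLpNorm (ft (rieszDiv (s n) Φ - rieszDiv s₀ Φ)) 2 volume
        = eLpNorm (rieszDiv (s n) Φ - rieszDiv s₀ Φ) 2 volume :=
      (ENNReal.pow_right_strictMono two_ne_zero).injective e1
    have e3 : ft (rieszDiv (s n) Φ - rieszDiv s₀ Φ)
        = ∑ i, fun ξ => (symb (s n) i ξ - symb s₀ i ξ) * ft (fun x => Φ x i) ξ := by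
      funext ξ
      refine (ft_sub (hD1 n) hD1' ξ).trans ?_
      rw [ft_rieszDiv hd (hs0 n) (hs1 n) hΦ hc, ft_rieszDiv hd h₀ h₁ hΦ hc, Finset.sum_apply,
        ← Finset.sum_sub_distrib]
      exact Finset.sum_congr rfl fun i _ => (sub_mul _ _ _).symm
    rw [← e2, e3]
    refine eLpNorm_sum_le (fun i _ => ?_) one_le_two
    exact (((measurable_symb _ i).sub (measurable_symb _ i)).mul
      (continuous_ft (hi i)).measurable).aestronglyMeasurable
  refine tendsto_of_tendsto_of_tendsto_of_le_of_le tendsto_const_nhds ?_ (fun n => zero_le) h1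
  have h2 : ∀ i, Tendsto (fun n => eLpNorm (fun ξ =>
      (symb (s n) i ξ - symb s₀ i ξ) * ft (fun x => Φ x i) ξ) 2 volume) atTop (𝓝 0) := by
    intro i
    have := tendsto_lintegral_symb_sub hs hs0 hs1 h₀ h₁ (hΦi i) (hasCompactSupport_component hc i) i
    simp_rw [lintegral_enorm_sq] at this
    have h3 := this.ennrpow_const (1 / 2)
    refine Tendsto.congr (fun n => ?_) (by simpa using h3)
    rw [← ENNReal.rpow_natCast, ← ENNReal.rpow_mul]
    simp
  simpa using tendsto_finsetSum (Finset.univ : Finset (Fin d)) fun i _ => h2 i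

end TestFunctions

end

end FracEigen

namespace FracEigen

noncomputable section

open Filter Topology Complex
open scoped FourierTransform ENNReal Real

/-! ### Multiplication by test functions preserves finite energy. -/

section Cutoff

variable {d : ℕ}

/-- Cauchy–Schwarz for the measure with density g, applied to f and 1. -/
theorem lintegral_mul_sq_le {f g : E d → ℝ≥0∞} (hf : Measurable f) (hg : Measurable g) :
    (∫⁻ x, f x * g x) ^ 2 ≤ (∫⁻ x, g x) * ∫⁻ x, f x ^ 2 * g x := by
  have h := ENNReal.lintegral_mul_le_Lp_mul_Lq (volume : Measure (E d)) Real.HolderConjugate.two_two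
    (f := fun x => f x * g x ^ (1 / 2 : ℝ)) (g := fun x => g x ^ (1 / 2 : ℝ))
    (hf.mul (hg.pow_const _)).aemeasurable (hg.pow_const _).aemeasurable
  have e0 : ∀ a : ℝ≥0∞, a ^ (1 / 2 : ℝ) * a ^ (1 / 2 : ℝ) = a := fun a => by
    rw [← ENNReal.rpow_add_of_nonneg _ _ (by norm_num) (by norm_num)]; norm_num
  have e1 : ∀ x, ((fun x => f x * g x ^ (1 / 2 : ℝ)) * fun x => g x ^ (1 / 2 : ℝ)) x = f x * g x := by
    intro x
    rw [Pi.mul_apply, mul_assoc, e0]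
  have e2 : ∀ x, (f x * g x ^ (1 / 2 : ℝ)) ^ (2 : ℝ) = f x ^ 2 * g x := by
    intro x
    rw [ENNReal.rpow_two, mul_pow, pow_two (g x ^ (1 / 2 : ℝ)), e0]
  have e3 : ∀ x, (g x ^ (1 / 2 : ℝ)) ^ (2 : ℝ) = g x := by
    intro x
    rw [ENNReal.rpow_two, pow_two, e0]
  simp_rw [e1, e2, e3] at h
  calc (∫⁻ x, f x * g x) ^ 2
      ≤ ((∫⁻ x, f x ^ 2 * g x) ^ (1 / 2 : ℝ) * (∫⁻ x, g x) ^ (1 / 2 : ℝ)) ^ 2 := by gcongr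
    _ = _ := by rw [mul_pow, pow_two, pow_two, e0, e0, mul_comm]

/-- Since ξ = (ξ + η) - η and x ↦ x^s is subadditive for s ≤ 1, it remains to use (a + b)² ≤ 2a² +
2b². This lets the weight pass through a convolution, in place of a Leibniz rule. -/
theorem weight_le {s : ℝ} (hs0 : 0 < s) (hs1 : s ≤ 1) (ξ η : E d) :
    ENNReal.ofReal ((2 * π * ‖ξ‖) ^ (2 * s)) ≤ 2 * ENNReal.ofReal ((2 * π * ‖ξ + η‖) ^ (2 * s))
      + 2 * ENNReal.ofReal ((2 * π * ‖η‖) ^ (2 * s)) := by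
  have h2 : ∀ a : ℝ, (2 : ℝ≥0∞) * ENNReal.ofReal a = ENNReal.ofReal (2 * a) := fun a => by
    rw [ENNReal.ofReal_mul two_pos.le, ENNReal.ofReal_ofNat]
  rw [h2, h2, ← ENNReal.ofReal_add (by positivity) (by positivity)]
  refine ENNReal.ofReal_le_ofReal ?_
  have e : ∀ x : ℝ, 0 ≤ x → x ^ (2 * s) = (x ^ s) ^ 2 := fun x hx => by
    rw [← Real.rpow_natCast, ← Real.rpow_mul hx]; congr 1; push_cast; ring
  rw [e _ (by positivity), e _ (by positivity), e _ (by positivity)]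
  have h3 : (2 * π * ‖ξ‖) ^ s ≤ (2 * π * ‖ξ + η‖) ^ s + (2 * π * ‖η‖) ^ s := by
    refine le_trans ?_ (Real.rpow_add_le_add_rpow (by positivity) (by positivity) hs0.le hs1)
    refine Real.rpow_le_rpow (by positivity) ?_ hs0.le
    rw [← mul_add]
    gcongr
    have := norm_sub_le (ξ + η) η
    rwa [add_sub_cancel_right] at this
  have h4 : 0 ≤ (2 * π * ‖ξ‖) ^ s := by positivity
  nlinarith [sq_nonneg ((2 * π * ‖ξ + η‖) ^ s - (2 * π * ‖η‖) ^ s)]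

theorem integrable_mul_test {u ζ : E d → ℝ} (hu : Integrable u) (hζ : ContDiff ℝ ∞ ζ)
    (hc : HasCompactSupport ζ) : Integrable fun x => ζ x * u x := by
  obtain ⟨M, hM⟩ := hζ.continuous.bounded_above_of_compact_support hc
  exact hu.bdd_mul hζ.continuous.aestronglyMeasurable (Eventually.of_forall hM)

theorem memLp_mul_test {u ζ : E d → ℝ} (hu : MemLp u 2) (hζ : ContDiff ℝ ∞ ζ)
    (hc : HasCompactSupport ζ) : MemLp (fun x => ζ x * u x) 2 := by
  obtain ⟨M, hM⟩ := hζ.continuous.bounded_above_of_compact_support hc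
  have hζ' : MemLp ζ ⊤ := memLp_top_of_bound hζ.continuous.aestronglyMeasurable M
    (Eventually.of_forall hM)
  exact hu.mul hζ'

/-- The identity ∫ f̂ g = ∫ f ĝ for f = `chi ξ` · u, whose transform is û translated by ξ. -/
theorem ft_mul_test {u ζ : E d → ℝ} (hu : Integrable u) (g : SchwartzMap (E d) ℂ)
    (hg : 𝓕 (g : E d → ℂ) = fun x => (ζ x : ℂ)) (ξ : E d) :
    ft (fun x => ζ x * u x) ξ = ∫ η, ft u (ξ + η) * g η := by
  have hf : Integrable fun x => chi ξ x * (u x : ℂ) := integrable_chi_mul (integrable_ofReal hu) ξ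
  have e4 := VectorFourier.integral_fourierIntegral_smul_eq_flip (μ := volume) (ν := volume)
    (L := innerₗ (E d)) Real.continuous_fourierChar continuous_inner hf (g.integrable (μ := volume))
  rw [flip_innerₗ] at e4
  have e5 : ∫ η, (𝓕 fun x => chi ξ x * (u x : ℂ)) η • g η = ∫ x, (chi ξ x * (u x : ℂ)) • 𝓕 (g : E d → ℂ) x :=
    e4
  rw [hg] at e5
  rw [ft_apply]
  have e6 : ∀ x, chi ξ x * ((ζ x * u x : ℝ) : ℂ) = (chi ξ x * (u x : ℂ)) • ((ζ x : ℝ) : ℂ) := by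
    intro x; rw [smul_eq_mul]; push_cast; ring
  simp_rw [e6]
  rw [← e5]
  refine integral_congr_ae (Eventually.of_forall fun η => ?_)
  simp only [smul_eq_mul]
  congr 1
  rw [fourier_eq_integral_chi, ft_apply]
  refine integral_congr_ae (Eventually.of_forall fun x => ?_)
  simp only [← mul_assoc]
  congr 1
  simp only [chi, ← Complex.exp_add, inner_add_right]
  congr 1; push_cast; ring

/-- Multiplication by a test function preserves finiteness of the energy. -/
theorem energy_mul_test_lt_top {s : ℝ} (hs0 : 0 < s) (hs1 : s ≤ 1) {u ζ : E d → ℝ}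
    (hu : Integrable u) (hu2 : MemLp u 2) (hE : energy s u < ⊤) (hζ : ContDiff ℝ ∞ ζ)
    (hc : HasCompactSupport ζ) : energy s (fun x => ζ x * u x) < ⊤ := by
  have hgC : ContDiff ℝ ∞ fun x => (ζ x : ℂ) := Complex.ofRealCLM.contDiff.comp hζ
  have hgcC : HasCompactSupport fun x => (ζ x : ℂ) := hc.comp_left Complex.ofReal_zero
  let g : SchwartzMap (E d) ℂ := 𝓕⁻ (hgcC.toSchwartzMap hgC)
  have hg : 𝓕 (g : E d → ℂ) = fun x => (ζ x : ℂ) := by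
    rw [← SchwartzMap.fourier_coe]
    simp only [g, FourierTransform.fourier_fourierInv_eq]
    rfl
  let W : E d → ℝ≥0∞ := fun ξ => ENNReal.ofReal ((2 * π * ‖ξ‖) ^ (2 * s))
  have hW : Measurable W := by fun_prop
  let f : E d → ℝ≥0∞ := fun ξ => ‖ft u ξ‖ₑ ^ 2
  have hf : Measurable f := (continuous_ft hu).measurable.enorm.pow_const 2
  let γ : E d → ℝ≥0∞ := fun η => ‖g η‖ₑ
  have hγ : Measurable γ := g.continuous.measurable.enorm
  have hpt : ∀ ξ, ‖ft (fun x => ζ x * u x) ξ‖ₑ ^ 2 ≤ (∫⁻ η, γ η) * ∫⁻ η, f (ξ + η) * γ η := by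
    intro ξ
    rw [ft_mul_test hu g hg]
    calc _ ≤ (∫⁻ η, ‖ft u (ξ + η)‖ₑ * γ η) ^ 2 := by
          gcongr
          refine (enorm_integral_le_lintegral_enorm _).trans (le_of_eq ?_)
          simp only [enorm_mul, γ]
      _ ≤ _ := by
          refine lintegral_mul_sq_le ?_ hγ
          exact (((continuous_ft hu).comp (continuous_const.add continuous_id)).measurable).enorm
  have hγ1 : ∫⁻ η, γ η < ⊤ := (g.integrable (μ := volume)).2
  have hγW : ∫⁻ η, W η * γ η < ⊤ := by
    have h0 := g.integrable_pow_mul volume 0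
    have h2 := g.integrable_pow_mul volume 2
    refine lt_of_le_of_lt (lintegral_mono fun η => ?_)
      (h0.add (h2.const_mul ((2 * π) ^ 2))).lintegral_lt_top
    simp only [W, γ, Pi.add_apply, pow_zero, one_mul]
    rw [← ofReal_norm, ← ENNReal.ofReal_mul (by positivity)]
    refine ENNReal.ofReal_le_ofReal ?_
    have := rpow_two_mul_le (by positivity : 0 ≤ 2 * π * ‖η‖) hs0.le hs1
    have h3 := norm_nonneg (g η)
    nlinarith
  have hf1 : ∫⁻ ξ, f ξ < ⊤ := by
    have := (memLp_ft hu hu2).2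
    simp only [f]
    rw [lintegral_enorm_sq]
    exact ENNReal.pow_lt_top this
  have hfW : ∫⁻ ξ, W ξ * f ξ < ⊤ := hE
  have hmeas1 : Measurable (Function.uncurry fun ξ η : E d => W ξ * (f (ξ + η) * γ η)) := by
    have h1 : Measurable fun p : E d × E d => f (p.1 + p.2) := hf.comp (by fun_prop)
    exact (hW.comp measurable_fst).mul (h1.mul (hγ.comp measurable_snd))
  -- Tonelli, `weight_le` and translation invariance: the weight falls either on û, giving the
  -- energy of u, or on the Schwartz factor g.
  have hmain : ∫⁻ ξ, W ξ * ∫⁻ η, f (ξ + η) * γ η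
      ≤ 2 * (∫⁻ ξ, W ξ * f ξ) * (∫⁻ η, γ η) + 2 * (∫⁻ ξ, f ξ) * ∫⁻ η, W η * γ η := by
    have e1 : ∀ ξ, W ξ * ∫⁻ η, f (ξ + η) * γ η = ∫⁻ η, W ξ * (f (ξ + η) * γ η) := by
      intro ξ
      rw [lintegral_const_mul]
      exact (hf.comp (by fun_prop)).mul hγ
    simp_rw [e1]
    rw [lintegral_lintegral_swap hmeas1.aemeasurable]
    have e2 : ∀ η, ∫⁻ ξ, W ξ * (f (ξ + η) * γ η)
        ≤ 2 * (∫⁻ ξ, W ξ * f ξ) * γ η + 2 * (∫⁻ ξ, f ξ) * (W η * γ η) := by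
      intro η
      have hfη : Measurable fun ξ => f (ξ + η) := hf.comp (by fun_prop)
      have hWfη : Measurable fun ξ => W (ξ + η) * f (ξ + η) := (hW.mul hf).comp (by fun_prop)
      calc ∫⁻ ξ, W ξ * (f (ξ + η) * γ η)
          ≤ ∫⁻ ξ, (2 * γ η * (W (ξ + η) * f (ξ + η)) + 2 * (W η * γ η) * f (ξ + η)) := by
            refine lintegral_mono fun ξ => ?_
            calc _ ≤ (2 * W (ξ + η) + 2 * W η) * (f (ξ + η) * γ η) := by
                  gcongr; exact weight_le hs0 hs1 ξ η
              _ = _ := by ring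
        _ = 2 * γ η * (∫⁻ ξ, W ξ * f ξ) + 2 * (W η * γ η) * ∫⁻ ξ, f ξ := by
            rw [lintegral_add_left (hWfη.const_mul _), lintegral_const_mul _ hWfη,
              lintegral_const_mul _ hfη, lintegral_add_right_eq_self (fun ξ => W ξ * f ξ) η,
              lintegral_add_right_eq_self f η]
        _ = _ := by ring
    refine (lintegral_mono e2).trans (le_of_eq ?_)
    have hWγ : Measurable fun η => W η * γ η := hW.mul hγ
    rw [lintegral_add_left (hγ.const_mul _), lintegral_const_mul _ hγ,
      lintegral_const_mul _ hWγ]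
  calc energy s (fun x => ζ x * u x)
      ≤ ∫⁻ ξ, (∫⁻ η, γ η) * (W ξ * ∫⁻ η, f (ξ + η) * γ η) := by
        refine lintegral_mono fun ξ => ?_
        calc _ ≤ W ξ * ((∫⁻ η, γ η) * ∫⁻ η, f (ξ + η) * γ η) := by gcongr; exact hpt ξ
          _ = _ := by ring
    _ = (∫⁻ η, γ η) * ∫⁻ ξ, W ξ * ∫⁻ η, f (ξ + η) * γ η := by
        rw [lintegral_const_mul' _ _ hγ1.ne]
    _ < ⊤ := by
        refine ENNReal.mul_lt_top hγ1 (lt_of_le_of_lt hmain ?_)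
        exact ENNReal.add_lt_top.mpr
          ⟨ENNReal.mul_lt_top (ENNReal.mul_lt_top (by simp) hfW) hγ1,
            ENNReal.mul_lt_top (ENNReal.mul_lt_top (by simp) hf1) hγW⟩

end Cutoff

/-! ### Simultaneous translation and mollification. -/

section Mollify

variable {d : ℕ}

open scoped Convolution Pointwise

theorem ft_convolution {k u : E d → ℝ} (hk : Integrable k) (hu : Integrable u) (ξ : E d) :
    ft (k ⋆[ContinuousLinearMap.mul ℝ ℝ, volume] u) ξ = ft k ξ * ft u ξ := by
  have h := Real.fourier_mul_convolution_eq (integrable_ofReal hk) (integrable_ofReal hu) ξ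
  have e : (fun x => (((k ⋆[ContinuousLinearMap.mul ℝ ℝ, volume] u) x : ℝ) : ℂ))
      = (fun x => (k x : ℂ)) ⋆[ContinuousLinearMap.mul ℂ ℂ, volume] fun x => (u x : ℂ) := by
    funext x
    rw [convolution_def, convolution_def, ← integral_complex_ofReal]
    simp
  rw [ft, ft, ft, ← h, e]

theorem norm_ft_kernel_le {k : E d → ℝ} (hk0 : ∀ x, 0 ≤ k x) (hk1 : ∫ x, k x = 1) (ξ : E d) :
    ‖ft k ξ‖ ≤ 1 := by
  rw [ft_apply]
  refine (norm_integral_le_integral_norm _).trans (le_of_eq ?_)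
  rw [← hk1]
  refine integral_congr_ae (Eventually.of_forall fun x => ?_)
  simp [norm_chi, abs_of_nonneg (hk0 x)]

theorem norm_ft_kernel_sub_one_le {k : E d → ℝ} (hk : Integrable k) (hk0 : ∀ x, 0 ≤ k x)
    (hk1 : ∫ x, k x = 1) {R : ℝ} (hR : ∀ x, k x ≠ 0 → ‖x‖ ≤ R) (ξ : E d) :
    ‖ft k ξ - 1‖ ≤ 2 * π * ‖ξ‖ * R := by
  have h1 : ft k ξ - 1 = ∫ x, (chi ξ x - 1) * (k x : ℂ) := by
    have : (1 : ℂ) = ∫ x, (k x : ℂ) := by rw [integral_complex_ofReal, hk1, ofReal_one]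
    simp_rw [sub_mul, one_mul]
    rw [integral_sub (integrable_chi_mul (integrable_ofReal hk) ξ) (integrable_ofReal hk), ← this,
      ft_apply]
  have h2 : ∫ x, 2 * π * ‖ξ‖ * R * k x = 2 * π * ‖ξ‖ * R := by rw [integral_const_mul, hk1, mul_one]
  rw [h1, ← h2]
  refine norm_integral_le_of_norm_le (hk.const_mul _) (Eventually.of_forall fun x => ?_)
  rw [norm_mul, norm_real, Real.norm_of_nonneg (hk0 x)]
  by_cases hx : k x = 0
  · simp [hx]
  · refine mul_le_mul_of_nonneg_right ?_ (hk0 x)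
    rw [norm_sub_rev]
    refine (norm_one_sub_chi_le ξ x).trans ?_
    gcongr
    exact hR x hx

/-- The error has transform (k̂_n - 1)v̂, where |k̂_n - 1| ≤ 2 and k̂_n → 1 pointwise as the kernels
concentrate at 0. With W arbitrary, one sequence serves both the L² norm and the energy. -/
theorem tendsto_weighted_convolution_sub {k : ℕ → E d → ℝ} (hk : ∀ n, Integrable (k n))
    (hk0 : ∀ n x, 0 ≤ k n x) (hk1 : ∀ n, ∫ x, k n x = 1) {R : ℕ → ℝ}
    (hR : ∀ n x, k n x ≠ 0 → ‖x‖ ≤ R n) (hR0 : Tendsto R atTop (𝓝 0)) {v : E d → ℝ}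
    (hv : Integrable v) {W : E d → ℝ≥0∞} (hW : Measurable W) (hWv : ∫⁻ ξ, W ξ * ‖ft v ξ‖ₑ ^ 2 < ⊤) :
    Tendsto (fun n => ∫⁻ ξ, W ξ *
      ‖ft (fun x => (k n ⋆[ContinuousLinearMap.mul ℝ ℝ, volume] v) x - v x) ξ‖ₑ ^ 2) atTop (𝓝 0) := by
  have hft : ∀ n ξ, ft (fun x => (k n ⋆[ContinuousLinearMap.mul ℝ ℝ, volume] v) x - v x) ξ
      = (ft (k n) ξ - 1) * ft v ξ := by
    intro n ξ
    rw [ft_sub ((hk n).integrable_convolution _ hv) hv, ft_convolution (hk n) hv]; ring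
  simp_rw [hft]
  have hWf : ∀ᵐ ξ, W ξ * ‖ft v ξ‖ₑ ^ 2 < ⊤ :=
    ae_lt_top (hW.mul ((continuous_ft hv).measurable.enorm.pow_const 2)) hWv.ne
  have h0 : ∫⁻ _ : E d, (0 : ℝ≥0∞) = 0 := by simp
  rw [← h0]
  refine tendsto_lintegral_of_dominated_convergence (fun ξ => 4 * (W ξ * ‖ft v ξ‖ₑ ^ 2))
    (fun n => ?_) (fun n => Eventually.of_forall fun ξ => ?_) ?_ ?_
  · exact hW.mul ((((continuous_ft (hk n)).sub continuous_const).mul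
      (continuous_ft hv)).measurable.enorm.pow_const 2)
  · have h1 : ‖ft (k n) ξ - 1‖ₑ ≤ 2 := by
      rw [← ofReal_norm]
      refine ENNReal.ofReal_le_of_le_toReal ?_
      refine (norm_sub_le _ _).trans ?_
      have := norm_ft_kernel_le (hk0 n) (hk1 n) ξ
      simp only [norm_one, ENNReal.toReal_ofNat]
      linarith
    simp only
    rw [enorm_mul, mul_pow]
    calc _ ≤ W ξ * (2 ^ 2 * ‖ft v ξ‖ₑ ^ 2) := by gcongr
      _ = _ := by ring
  · rw [lintegral_const_mul' _ _ (by simp)]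
    exact (ENNReal.mul_lt_top (by simp) hWv).ne
  · filter_upwards [hWf] with ξ hξ
    have h1 : Tendsto (fun n => ft (k n) ξ - 1) atTop (𝓝 0) := by
      refine squeeze_zero_norm (fun n => norm_ft_kernel_sub_one_le (hk n) (hk0 n) (hk1 n) (hR n) ξ) ?_
      simpa using hR0.const_mul (2 * π * ‖ξ‖)
    have h2 : Tendsto (fun n => ‖ft (k n) ξ - 1‖ₑ ^ 2 * (W ξ * ‖ft v ξ‖ₑ ^ 2)) atTop (𝓝 0) := by
      have h3 : Tendsto (fun n => ‖ft (k n) ξ - 1‖ₑ ^ 2) atTop (𝓝 0) := by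
        simpa using (ENNReal.Tendsto.pow (n := 2) h1.enorm)
      have := ENNReal.Tendsto.mul_const h3 (Or.inr hξ.ne)
      simpa using this
    refine h2.congr fun n => ?_
    rw [enorm_mul, mul_pow]; ring

/-- A function supported in a compact set which is moved into `Ω` by small translations in a fixed
direction is approximated by test functions on `Ω`. -/
theorem exists_test_approx_of_translation {Ω : Set (E d)} (hΩ : IsOpen Ω) {v : E d → ℝ}
    (hv : Integrable v) {K : Set (E d)} (hK : IsCompact K)
    (hvK : Function.support v ⊆ K) {e : E d} {t₀ : ℝ} (ht₀ : 0 < t₀)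
    (hKe : ∀ t, 0 < t → t < t₀ → ∀ y ∈ K, y + t • e ∈ Ω) :
    ∃ w : ℕ → E d → ℝ, (∀ n, IsTestFunction Ω (w n)) ∧
      ∀ W : E d → ℝ≥0∞, Measurable W → ∫⁻ ξ, W ξ * ‖ft v ξ‖ₑ ^ 2 < ⊤ →
        Tendsto (fun n => ∫⁻ ξ, W ξ * ‖ft (fun x => w n x - v x) ξ‖ₑ ^ 2) atTop (𝓝 0) := by
  -- The shift n + 2 keeps every `t n` strictly below `t₀`.
  let t : ℕ → ℝ := fun n => t₀ / (n + 2)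
  have ht : ∀ n, 0 < t n := fun n => by positivity
  have ht1 : ∀ n, t n < t₀ := fun n => by
    refine div_lt_self ht₀ ?_
    have : (0 : ℝ) ≤ n := n.cast_nonneg
    linarith
  have htlim : Tendsto t atTop (𝓝 0) := by
    have := (tendsto_const_div_atTop_nhds_zero_nat t₀).comp (tendsto_add_atTop_nat 2)
    refine this.congr fun n => ?_
    simp [t]
  have hδ : ∀ n, ∃ δ, 0 < δ ∧ Metric.cthickening δ ((fun y => y + t n • e) '' K) ⊆ Ω := fun n =>
    (hK.image (by fun_prop)).exists_cthickening_subset_open hΩ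
      (by rintro _ ⟨y, hy, rfl⟩; exact hKe _ (ht n) (ht1 n) y hy)
  choose δ hδ0 hδΩ using hδ
  -- `δ n` keeps the support of the convolution inside Ω; `t n` forces the radii to tend to 0.
  let ρ : ℕ → ℝ := fun n => min (δ n) (t n)
  have hρ : ∀ n, 0 < ρ n := fun n => lt_min (hδ0 n) (ht n)
  -- The bump is centred at `t n • e`, not at 0, so one convolution both moves v into Ω and smooths
  -- it.
  let b : ∀ n, ContDiffBump (t n • e) := fun n =>
    ⟨ρ n / 2, ρ n, by have := hρ n; positivity, by have := hρ n; linarith⟩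
  let k : ℕ → E d → ℝ := fun n => (b n).normed volume
  have hsupp : ∀ n, Function.support (k n) = Metric.ball (t n • e) (ρ n) := fun n =>
    (b n).support_normed_eq
  have hkc : ∀ n, HasCompactSupport (k n) := fun n => (b n).hasCompactSupport_normed
  have hks : ∀ n, ContDiff ℝ ∞ (k n) := fun n => (b n).contDiff_normed
  refine ⟨fun n => k n ⋆[ContinuousLinearMap.mul ℝ ℝ, volume] v, fun n => ?_, fun W hW hWv => ?_⟩
  · have hsub : tsupport (k n ⋆[ContinuousLinearMap.mul ℝ ℝ, volume] v)
        ⊆ Metric.closedBall (t n • e) (ρ n) + K := by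
      refine closure_minimal ?_ ((isCompact_closedBall _ _).add hK).isClosed
      refine (support_convolution_subset _).trans (Set.add_subset_add ?_ hvK)
      rw [hsupp]; exact Metric.ball_subset_closedBall
    refine ⟨(hkc n).contDiff_convolution_left _ (hks n) hv.locallyIntegrable, ?_, ?_⟩
    · exact HasCompactSupport.of_support_subset_isCompact ((isCompact_closedBall _ _).add hK)
        ((subset_tsupport _).trans hsub)
    · refine hsub.trans (Subset.trans ?_ (hδΩ n))
      rintro _ ⟨a, ha, y, hy, rfl⟩
      refine Metric.mem_cthickening_of_dist_le _ (y + t n • e) _ _ ⟨y, hy, rfl⟩ ?_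
      rw [Metric.mem_closedBall, dist_eq_norm] at ha
      rw [dist_eq_norm]
      have : a + y - (y + t n • e) = a - t n • e := by abel
      exact (this ▸ ha).trans (min_le_left _ _)
  · refine tendsto_weighted_convolution_sub (fun n => (b n).integrable_normed)
      (fun n x => (b n).nonneg_normed x) (fun n => (b n).integral_normed)
      (R := fun n => t n * ‖e‖ + t n) (fun n x hx => ?_) ?_ hv hW hWv
    · have hx' : x ∈ Metric.ball (t n • e) (ρ n) := hsupp n ▸ (Function.mem_support.mpr hx)
      rw [Metric.mem_ball, dist_eq_norm] at hx'
      have h1 := norm_add_le (t n • e) (x - t n • e)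
      rw [add_sub_cancel, norm_smul, Real.norm_of_nonneg (ht n).le] at h1
      have h2 : ρ n ≤ t n := min_le_right _ _
      linarith
    · simpa using (htlim.mul_const ‖e‖).add htlim

end Mollify

end

end FracEigen

namespace FracEigen

noncomputable section

open Filter Topology Complex
open scoped FourierTransform ENNReal Real Manifold

/-! ### Functions vanishing outside Ω, and lower semicontinuity of the energy. -/

section Support

variable {d : ℕ}

/-- `u` vanishes almost everywhere outside `Ω`. -/
def SuppIn (Ω : Set (E d)) (u : E d → ℝ) : Prop := ∀ᵐ x, x ∉ Ω → u x = 0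

theorem SuppIn.ae_eq_indicator {Ω : Set (E d)} {u : E d → ℝ} (h : SuppIn Ω u) :
    u =ᵐ[volume] Ω.indicator u := by
  filter_upwards [h] with x hx
  by_cases hxΩ : x ∈ Ω
  · rw [indicator_of_mem hxΩ]
  · rw [indicator_of_notMem hxΩ, hx hxΩ]

theorem SuppIn.integrable {Ω : Set (E d)} (hΩ : IsOpen Ω) (hb : Bornology.IsBounded Ω) {u : L2 d}
    (h : SuppIn Ω u) : Integrable u := by
  have hfin : volume Ω < ⊤ := hb.measure_lt_top
  have : IsFiniteMeasure (volume.restrict Ω) := ⟨by simpa using hfin⟩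
  have h1 : Integrable u (volume.restrict Ω) := ((Lp.memLp u).restrict Ω).integrable one_le_two
  exact ((integrable_indicator_iff hΩ.measurableSet).mpr h1).congr h.ae_eq_indicator.symm

theorem IsTestFunction.suppIn {Ω : Set (E d)} {φ : E d → ℝ} (h : IsTestFunction Ω φ) {u : E d → ℝ}
    (hu : u =ᵐ[volume] φ) : SuppIn Ω u := by
  filter_upwards [hu] with x hx hxΩ
  rw [hx]
  exact image_eq_zero_of_notMem_tsupport fun hmem => hxΩ (h.2.2 hmem)

/-- Exhibits the support condition as the kernel of a bounded operator, hence as stable under strong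
and weak limits. -/
theorem suppIn_iff {Ω : Set (E d)} (hΩ : IsOpen Ω) {u : L2 d} :
    SuppIn Ω u ↔ LpToLpRestrictCLM (E d) ℝ ℝ volume 2 Ωᶜ u = 0 := by
  have h0 : SuppIn Ω u ↔ ∀ᵐ x ∂volume.restrict Ωᶜ, u x = 0 :=
    (ae_restrict_iff' hΩ.measurableSet.compl).symm
  rw [Lp.eq_zero_iff_ae_eq_zero, h0]
  have h1 := LpToLpRestrictCLM_coeFn ℝ Ωᶜ u
  constructor
  · intro h
    filter_upwards [h, h1] with x h2 h3
    rw [h3, h2]; rfl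
  · intro h
    filter_upwards [h, h1] with x h2 h3
    rw [← h3, h2]; rfl

theorem isClosed_suppIn (Ω : Set (E d)) (hΩ : IsOpen Ω) : IsClosed {u : L2 d | SuppIn Ω u} := by
  simp_rw [suppIn_iff hΩ]
  exact isClosed_eq (LpToLpRestrictCLM (E d) ℝ ℝ volume 2 Ωᶜ).continuous continuous_const

/-- For functions supported in a bounded set the values of the Fourier transform are continuous
functionals on `L²`, bounded uniformly in the frequency. -/
theorem exists_ft_functional {Ω : Set (E d)} (hΩ : IsOpen Ω) (hb : Bornology.IsBounded Ω) (ξ : E d) :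
    ∃ L : L2 d →L[ℝ] ℂ, (∀ u : L2 d, SuppIn Ω u → ft u ξ = L u) ∧
      ∀ u, ‖L u‖ ≤ √(volume.real Ω) * ‖u‖ := by
  have hfin : volume Ω < ⊤ := hb.measure_lt_top
  -- The character cut off to Ω, which is in L² because Ω is bounded; it is conjugated because the
  -- inner product conjugates its first argument.
  let k : E d → ℂ := Ω.indicator fun x => starRingEnd ℂ (chi ξ x)
  have hkn : ∀ x, ‖k x‖ₑ ^ 2 = Ω.indicator 1 x := by
    intro x
    by_cases hx : x ∈ Ω
    · simp only [k, indicator_of_mem hx, Pi.one_apply]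
      rw [enorm_sq_eq_ofReal, RCLike.norm_conj, norm_chi]; simp
    · simp [k, indicator_of_notMem hx]
  have hkl : ∫⁻ x, ‖k x‖ₑ ^ 2 = volume Ω := by
    simp_rw [hkn]
    exact lintegral_indicator_one hΩ.measurableSet
  have hk : MemLp k 2 := by
    refine memLp_two_of_lintegral ?_ (by rw [hkl]; exact hfin)
    refine AEStronglyMeasurable.indicator ?_ hΩ.measurableSet
    exact (Complex.continuous_conj.comp (continuous_chi ξ)).aestronglyMeasurable
  have hknorm : ‖hk.toLp k‖ = √(volume.real Ω) := by
    rw [eq_comm, Real.sqrt_eq_iff_mul_self_eq measureReal_nonneg (norm_nonneg _), ← pow_two,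
      ← toReal_enorm, ← ENNReal.toReal_pow, enorm_toLp_sq, hkl]; rfl
  refine ⟨((innerSL ℂ (hk.toLp k : L2C d)).restrictScalars ℝ).comp cpx, fun u hu => ?_, fun u => ?_⟩
  · change ft u ξ = inner ℂ (hk.toLp k : L2C d) (cpx u)
    rw [L2.inner_def, ft_apply]
    refine integral_congr_ae ?_
    filter_upwards [hk.coeFn_toLp, coeFn_cpx u, hu] with x h1 h2 h3
    rw [h1, h2, RCLike.inner_apply]
    by_cases hx : x ∈ Ω
    · simp [k, indicator_of_mem hx, mul_comm]
    · simp [h3 hx]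
  · change ‖inner ℂ (hk.toLp k : L2C d) (cpx u)‖ ≤ _
    refine (norm_inner_le_norm _ _).trans (le_of_eq ?_)
    rw [hknorm, ← toReal_enorm (cpx u), enorm_cpx, toReal_enorm]

/-- Lower semicontinuity of the energy. -/
theorem energy_le_of_tendsto {u : ℕ → E d → ℝ} {v : E d → ℝ} (hu : ∀ n, Integrable (u n))
    (hft : ∀ ξ, Tendsto (fun n => ft (u n) ξ) atTop (𝓝 (ft v ξ))) {s : ℕ → ℝ} {s₀ : ℝ}
    (hs : Tendsto s atTop (𝓝 s₀)) (h₀ : 0 < s₀) {C : ℝ≥0∞} (hC : ∀ n, energy (s n) (u n) ≤ C) :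
    energy s₀ v ≤ C := by
  have hlim : ∀ ξ : E d, Tendsto (fun n => ENNReal.ofReal ((2 * π * ‖ξ‖) ^ (2 * s n))
      * ‖ft (u n) ξ‖ₑ ^ 2) atTop (𝓝 (ENNReal.ofReal ((2 * π * ‖ξ‖) ^ (2 * s₀)) * ‖ft v ξ‖ₑ ^ 2)) := by
    intro ξ
    -- Positivity of the limiting exponent covers the base 0. The conclusion below is Fatou's lemma.
    have h1 : Tendsto (fun n => (2 * π * ‖ξ‖) ^ (2 * s n)) atTop (𝓝 ((2 * π * ‖ξ‖) ^ (2 * s₀))) :=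
      tendsto_const_nhds.rpow (hs.const_mul 2) (Or.inr (by positivity))
    refine ENNReal.Tendsto.mul (ENNReal.tendsto_ofReal h1) (Or.inr ?_)
      (ENNReal.Tendsto.pow (hft ξ).enorm) (Or.inr ENNReal.ofReal_ne_top)
    exact (ENNReal.pow_lt_top enorm_lt_top).ne
  calc energy s₀ v = ∫⁻ ξ : E d, liminf (fun n => ENNReal.ofReal ((2 * π * ‖ξ‖) ^ (2 * s n))
      * ‖ft (u n) ξ‖ₑ ^ 2) atTop := lintegral_congr fun ξ => (hlim ξ).liminf_eq.symm
    _ ≤ liminf (fun n => ∫⁻ ξ : E d, ENNReal.ofReal ((2 * π * ‖ξ‖) ^ (2 * s n))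
      * ‖ft (u n) ξ‖ₑ ^ 2) atTop := by
        refine lintegral_liminf_le fun n => ?_
        exact Measurable.mul (by fun_prop) ((continuous_ft (hu n)).measurable.enorm.pow_const 2)
    _ ≤ C := liminf_le_of_frequently_le' (Eventually.of_forall hC).frequently

end Support

/-! ### Density of test functions on Lipschitz domains. -/

section Density

variable {d : ℕ}

/-- A Lipschitz domain has the segment property. -/
theorem HasLipschitzBoundary.exists_translation {Ω : Set (E d)} (hΩ : IsOpen Ω)
    (hL : HasLipschitzBoundary Ω) {x₀ : E d} (hx₀ : x₀ ∈ closure Ω) :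
    ∃ ρ > 0, ∃ e : E d, ∃ t₀ > 0, ∀ t : ℝ, 0 < t → t < t₀ →
      ∀ y ∈ closure Ω ∩ Metric.ball x₀ ρ, y + t • e ∈ Ω := by
  by_cases hx : x₀ ∈ Ω
  · obtain ⟨ρ, hρ, hsub⟩ := Metric.isOpen_iff.mp hΩ x₀ hx
    exact ⟨ρ, hρ, 0, 1, one_pos, fun t _ _ y hy => by simpa using hsub hy.2⟩
  · obtain ⟨e, he, K, g, hg, ρ, hρ, h⟩ := hL x₀ ⟨hx₀, by rwa [hΩ.interior_eq]⟩
    -- Halving leaves room: a point within ρ/2 of x₀ moved by t < ρ/2 along the unit vector e stays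
    -- where Ω is an epigraph.
    refine ⟨ρ / 2, by positivity, e, ρ / 2, by positivity, fun t ht0 ht1 y hy => ?_⟩
    have hyball : y ∈ Metric.ball x₀ ρ := Metric.ball_subset_ball (by linarith) hy.2
    -- Points of the closure lie weakly above the graph. Moving up along e keeps the projection
    -- fixed and makes the inequality strict.
    have hle : g (y - inner ℝ e y • e) ≤ inner ℝ e y := by
      have hcl : IsClosed {z : E d | g (z - inner ℝ e z • e) ≤ inner ℝ e z} := by
        have := hg.continuous
        exact isClosed_le (by fun_prop) (by fun_prop)
      have hsub : Metric.ball x₀ ρ ∩ Ω ⊆ {z : E d | g (z - inner ℝ e z • e) ≤ inner ℝ e z} :=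
        fun z hz => ((h z hz.1).mp hz.2).le
      exact closure_minimal hsub hcl (Metric.isOpen_ball.inter_closure ⟨hyball, hy.1⟩)
    have hmem : y + t • e ∈ Metric.ball x₀ ρ := by
      rw [Metric.mem_ball, dist_eq_norm]
      have h2 : ‖y - x₀‖ < ρ / 2 := by rw [← dist_eq_norm]; exact hy.2
      have h3 : y + t • e - x₀ = (y - x₀) + t • e := by abel
      rw [h3]
      refine (norm_add_le _ _).trans_lt ?_
      rw [norm_smul, he, mul_one, Real.norm_of_nonneg ht0.le]
      linarith
    rw [h _ hmem]
    have hin : inner ℝ e (y + t • e) = inner ℝ e y + t := by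
      rw [inner_add_right, inner_smul_right, real_inner_self_eq_norm_sq, he]; ring
    have hproj : y + t • e - inner ℝ e (y + t • e) • e = y - inner ℝ e y • e := by
      rw [hin, add_smul]; abel
    rw [hproj, hin]
    linarith

theorem enorm_sum_sq_le {ι : Type*} [Fintype ι] (a : ι → ℂ) :
    ‖∑ i, a i‖ₑ ^ 2 ≤ (Fintype.card ι : ℝ≥0∞) * ∑ i, ‖a i‖ₑ ^ 2 := by
  simp_rw [enorm_sq_eq_ofReal]
  rw [← ENNReal.ofReal_sum_of_nonneg fun i _ => sq_nonneg _, ← ENNReal.ofReal_natCast,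
    ← ENNReal.ofReal_mul (by positivity)]
  refine ENNReal.ofReal_le_ofReal ?_
  calc ‖∑ i, a i‖ ^ 2 ≤ (∑ i, ‖a i‖) ^ 2 := by gcongr; exact norm_sum_le _ _
    _ ≤ _ := sq_sum_le_card_mul_sum_sq

theorem ft_sum {ι : Type*} (t : Finset ι) {f : ι → E d → ℝ} (hf : ∀ i ∈ t, Integrable (f i)) (ξ : E d) :
    ft (fun x => ∑ i ∈ t, f i x) ξ = ∑ i ∈ t, ft (f i) ξ := by
  simp_rw [ft_apply]
  rw [← integral_finsetSum _ fun i hi => integrable_chi_mul (integrable_ofReal (hf i hi)) ξ]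
  refine integral_congr_ae (Eventually.of_forall fun x => ?_)
  simp only [ofReal_sum, Finset.mul_sum]

theorem IsTestFunction.integrable {Ω : Set (E d)} {φ : E d → ℝ} (h : IsTestFunction Ω φ) :
    Integrable φ := h.1.continuous.integrable_of_hasCompactSupport h.2.1

theorem IsTestFunction.memLp {Ω : Set (E d)} {φ : E d → ℝ} (h : IsTestFunction Ω φ) :
    MemLp φ 2 := h.1.continuous.memLp_of_hasCompactSupport h.2.1

theorem IsTestFunction.sum {Ω : Set (E d)} {ι : Type*} [Fintype ι] {φ : ι → E d → ℝ}
    (h : ∀ i, IsTestFunction Ω (φ i)) : IsTestFunction Ω fun x => ∑ i, φ i x := by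
  have hK : IsCompact (⋃ i, tsupport (φ i)) := isCompact_iUnion fun i => (h i).2.1
  have hsub : Function.support (fun x => ∑ i, φ i x) ⊆ ⋃ i, tsupport (φ i) := by
    intro x hx
    by_contra hcon
    refine hx (Finset.sum_eq_zero fun i _ => image_eq_zero_of_notMem_tsupport fun hi => hcon ?_)
    exact mem_iUnion.mpr ⟨i, hi⟩
  refine ⟨ContDiff.sum fun i _ => (h i).1, HasCompactSupport.of_support_subset_isCompact hK hsub, ?_⟩
  exact (closure_minimal hsub hK.isClosed).trans (iUnion_subset fun i => (h i).2.2)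

/-- On a bounded Lipschitz domain, a function of finite energy that vanishes outside the domain is
approximated by test functions in the `H^s` norm. -/
theorem exists_test_approx {Ω : Set (E d)} (hΩ : IsOpen Ω) (hb : Bornology.IsBounded Ω)
    (hL : HasLipschitzBoundary Ω) {s : ℝ} (hs0 : 0 < s) (hs1 : s ≤ 1) {u : L2 d} (hu : SuppIn Ω u)
    (hE : energy s u < ⊤) :
    ∃ w : ℕ → E d → ℝ, (∀ n, IsTestFunction Ω (w n)) ∧
      Tendsto (fun n => energy s (fun x => w n x - u x)) atTop (𝓝 0) ∧
      Tendsto (fun n => ∫⁻ x, ‖w n x - u x‖ₑ ^ 2) atTop (𝓝 0) := by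
  classical
  have hcomp : IsCompact (closure Ω) := hb.isCompact_closure
  have hloc := fun x : closure Ω => hL.exists_translation hΩ x.2
  choose ρ hρ e t₀ ht₀ htr using hloc
  obtain ⟨t, htcov⟩ := hcomp.elim_finite_subcover (fun x : closure Ω => Metric.ball (x : E d) (ρ x))
    (fun _ => Metric.isOpen_ball) fun x hx =>
      mem_iUnion.mpr ⟨⟨x, hx⟩, Metric.mem_ball_self (hρ ⟨x, hx⟩)⟩
  obtain ⟨f, hf⟩ := SmoothPartitionOfUnity.exists_isSubordinate 𝓘(ℝ, E d)
    (isClosed_closure (s := Ω)) (fun j : t => Metric.ball ((j : closure Ω) : E d) (ρ j))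
    (fun _ => Metric.isOpen_ball) (fun x hx => by
      obtain ⟨j, hj, hx'⟩ := mem_iUnion₂.mp (htcov hx)
      exact mem_iUnion.mpr ⟨⟨j, hj⟩, hx'⟩)
  have hfs : ∀ j, ContDiff ℝ ∞ (f j) := fun j => (f j).contMDiff.contDiff
  have hfc : ∀ j, HasCompactSupport (f j) := fun j =>
    (isCompact_closedBall (((j : closure Ω) : E d)) (ρ j)).of_isClosed_subset (isClosed_tsupport _)
      ((hf j).trans Metric.ball_subset_closedBall)
  -- A representative vanishing everywhere off Ω, as supports are compared pointwise; it also makes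
  -- the partition identity hold where the cutoffs need not sum to 1.
  let v : E d → ℝ := Ω.indicator u
  have hvu : (u : E d → ℝ) =ᵐ[volume] v := hu.ae_eq_indicator
  have hv1 : Integrable v := (hu.integrable hΩ hb).congr hvu
  have hv2 : MemLp v 2 := (memLp_congr_ae hvu).mp (Lp.memLp u)
  have hvE : energy s v < ⊤ := energy_congr_ae hvu ▸ hE
  have hsum : ∀ x, v x = ∑ j, f j x * v x := by
    intro x
    by_cases hx : x ∈ Ω
    · rw [← Finset.sum_mul, ← finsum_eq_sum_of_fintype, f.sum_eq_one (subset_closure hx), one_mul]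
    · simp [v, indicator_of_notMem hx]
  have hfv1 : ∀ j, Integrable fun x => f j x * v x := fun j => integrable_mul_test hv1 (hfs j) (hfc j)
  have hfv2 : ∀ j, MemLp (fun x => f j x * v x) 2 := fun j => memLp_mul_test hv2 (hfs j) (hfc j)
  have hfvE : ∀ j, energy s (fun x => f j x * v x) < ⊤ := fun j =>
    energy_mul_test_lt_top hs0 hs1 hv1 hv2 hvE (hfs j) (hfc j)
  have happ : ∀ j, ∃ w : ℕ → E d → ℝ, (∀ n, IsTestFunction Ω (w n)) ∧
      ∀ W : E d → ℝ≥0∞, Measurable W → ∫⁻ ξ, W ξ * ‖ft (fun x => f j x * v x) ξ‖ₑ ^ 2 < ⊤ →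
        Tendsto (fun n => ∫⁻ ξ, W ξ * ‖ft (fun x => w n x - f j x * v x) ξ‖ₑ ^ 2) atTop (𝓝 0) := by
    intro j
    refine exists_test_approx_of_translation hΩ (hfv1 j) (K := tsupport (f j) ∩ closure Ω)
      (hcomp.inter_left (isClosed_tsupport _)) (fun x hx => ?_) (ht₀ j)
      fun t h0 h1 y hy => htr j t h0 h1 y ⟨hy.2, hf j hy.1⟩
    refine ⟨subset_tsupport _ fun h0 => hx (by simp [h0]), ?_⟩
    by_contra hcon
    exact hx (by simp [v, indicator_of_notMem fun h => hcon (subset_closure h)])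
  choose w hw hwlim using happ
  have hwt : ∀ n, IsTestFunction Ω fun x => ∑ j, w j n x := fun n => IsTestFunction.sum fun j => hw j n
  have hft : ∀ n ξ, ft (fun x => (∑ j, w j n x) - u x) ξ
      = ∑ j, ft (fun x => w j n x - f j x * v x) ξ := by
    intro n ξ
    rw [← ft_sum (f := fun j x => w j n x - f j x * v x) _
      fun j _ => (hw j n).integrable.sub (hfv1 j)]
    refine congrFun (ft_congr_ae ?_) ξ
    filter_upwards [hvu] with x hx
    rw [hx, Finset.sum_sub_distrib, ← hsum x]
  -- Used twice: with the energy weight and with W = 1.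
  have hgen : ∀ W : E d → ℝ≥0∞, Measurable W →
      (∀ j, ∫⁻ ξ, W ξ * ‖ft (fun x => f j x * v x) ξ‖ₑ ^ 2 < ⊤) →
      Tendsto (fun n => ∫⁻ ξ, W ξ * ‖ft (fun x => (∑ j, w j n x) - u x) ξ‖ₑ ^ 2) atTop (𝓝 0) := by
    intro W hW hWf
    have hlim : Tendsto (fun n => (Fintype.card t : ℝ≥0∞) *
        ∑ j, ∫⁻ ξ, W ξ * ‖ft (fun x => w j n x - f j x * v x) ξ‖ₑ ^ 2) atTop (𝓝 0) := by
      have h1 := tendsto_finsetSum (Finset.univ : Finset t) fun j _ => hwlim j W hW (hWf j)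
      have h2 := ENNReal.Tendsto.const_mul h1 (Or.inr (ENNReal.natCast_ne_top (Fintype.card t)))
      simpa using h2
    refine tendsto_of_tendsto_of_tendsto_of_le_of_le tendsto_const_nhds hlim (fun n => zero_le)
      fun n => ?_
    simp only
    rw [← lintegral_finsetSum' _ fun j _ => ?_, ← lintegral_const_mul' _ _ (ENNReal.natCast_ne_top _)]
    · refine lintegral_mono fun ξ => ?_
      simp only
      rw [hft, ← Finset.mul_sum]
      calc _ ≤ W ξ * ((Fintype.card t : ℝ≥0∞) *
          ∑ j, ‖ft (fun x => w j n x - f j x * v x) ξ‖ₑ ^ 2) := by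
            gcongr; exact enorm_sum_sq_le _
        _ = _ := by ring
    · exact (hW.mul ((continuous_ft ((hw j n).integrable.sub (hfv1 j))).measurable.enorm.pow_const
        2)).aemeasurable
  refine ⟨fun n x => ∑ j, w j n x, hwt, ?_, ?_⟩
  · exact hgen (fun ξ => ENNReal.ofReal ((2 * π * ‖ξ‖) ^ (2 * s))) (by fun_prop) hfvE
  · have h1 := hgen (fun _ => 1) measurable_const fun j => by
      simp only [one_mul]
      rw [lintegral_ft_sq (hfv1 j) (hfv2 j), lintegral_enorm_sq]
      exact ENNReal.pow_lt_top (hfv2 j).2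
    refine h1.congr fun n => ?_
    simp only [one_mul]
    exact lintegral_ft_sq ((hwt n).integrable.sub (hu.integrable hΩ hb))
      ((hwt n).memLp.sub (Lp.memLp u))

end Density

end

end FracEigen

namespace FracEigen

noncomputable section

open Filter Topology Complex
open scoped FourierTransform ENNReal Real

/-! ### Weak convergence in Hilbert spaces. -/

section WeakLimits

/-- Bounded sequences in a separable Hilbert space have weakly convergent subsequences. -/
theorem exists_weak_limit {H : Type*} [NormedAddCommGroup H] [InnerProductSpace ℝ H]
    [CompleteSpace H] [TopologicalSpace.SeparableSpace H] {x : ℕ → H} {C : ℝ}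
    (hx : ∀ n, ‖x n‖ ≤ C) :
    ∃ y : H, ∃ φ : ℕ → ℕ, StrictMono φ ∧
      ∀ z, Tendsto (fun n => inner ℝ (x (φ n)) z) atTop (𝓝 (inner ℝ y z)) := by
  have hball := WeakDual.isSeqCompact_closedBall (𝕜 := ℝ) (E := H) 0 C
  obtain ⟨f, -, φ, hφ, hlim⟩ := hball (x := fun n =>
    StrongDual.toWeakDual (InnerProductSpace.toDual ℝ H (x n))) (fun n => by
      simpa using hx n)
  refine ⟨(InnerProductSpace.toDual ℝ H).symm (WeakDual.toStrongDual f), φ, hφ, fun z => ?_⟩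
  have h1 := ((WeakDual.eval_continuous z).tendsto f).comp hlim
  rw [InnerProductSpace.toDual_symm_apply]
  exact h1

theorem tendsto_functional_of_weak {H : Type*} [NormedAddCommGroup H] [InnerProductSpace ℝ H]
    [CompleteSpace H] {x : ℕ → H} {y : H}
    (h : ∀ z, Tendsto (fun n => inner ℝ (x n) z) atTop (𝓝 (inner ℝ y z))) (L : H →L[ℝ] ℂ) :
    Tendsto (fun n => L (x n)) atTop (𝓝 (L y)) := by
  have hreal : ∀ ℓ : H →L[ℝ] ℝ, Tendsto (fun n => ℓ (x n)) atTop (𝓝 (ℓ y)) := by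
    intro ℓ
    have h1 : ∀ v, ℓ v = inner ℝ v ((InnerProductSpace.toDual ℝ H).symm ℓ) := fun v => by
      rw [real_inner_comm, InnerProductSpace.toDual_symm_apply]
    simp_rw [h1]
    exact h _
  have h2 := (continuous_ofReal.tendsto _).comp (hreal (reCLM.comp L))
  have h3 := (continuous_ofReal.tendsto _).comp (hreal (imCLM.comp L))
  have h4 := h2.add (h3.mul_const I)
  simpa [Function.comp_def, re_add_im] using h4

theorem tendsto_inner_of_weak_of_strong {H : Type*} [NormedAddCommGroup H] [InnerProductSpace ℝ H]
    {x z : ℕ → H} {y w : H} {C : ℝ} (hC : ∀ n, ‖x n‖ ≤ C)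
    (h : ∀ v, Tendsto (fun n => inner ℝ (x n) v) atTop (𝓝 (inner ℝ y v)))
    (hz : Tendsto z atTop (𝓝 w)) :
    Tendsto (fun n => inner ℝ (x n) (z n)) atTop (𝓝 (inner ℝ y w)) := by
  have h1 : Tendsto (fun n => inner ℝ (x n) (z n - w)) atTop (𝓝 0) := by
    refine squeeze_zero_norm (a := fun n => C * ‖z n - w‖) (fun n => ?_) ?_
    · exact (norm_inner_le_norm _ _).trans (by gcongr; exact hC n)
    · simpa using (tendsto_iff_norm_sub_tendsto_zero.mp hz).const_mul C
  have h2 := h1.add (h w)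
  simpa [← inner_add_right] using h2

end WeakLimits

/-! ### Description of H^s_0(Ω) by support and finite energy. -/

section EnergySpace

variable {d : ℕ}

/-- Written with L² inner products, the definition is visibly closed in (u, G) and ready for weak
limits. -/
theorem isRieszGradient_iff (hd : 0 < d) {s : ℝ} (hs0 : 0 < s) (hs1 : s ≤ 1) {u : L2 d}
    {G : L2Vec d} : IsRieszGradient s u G ↔
      ∀ (Φ : E d → E d) (hΦ : ContDiff ℝ ∞ Φ) (hc : HasCompactSupport Φ),
        inner ℝ G ((hΦ.continuous.memLp_of_hasCompactSupport (p := 2) hc).toLp Φ)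
          = -inner ℝ u ((memLp_rieszDiv hd hs0 hs1 hΦ hc).toLp (rieszDiv s Φ)) := by
  refine forall_congr' fun Φ => forall_congr' fun hΦ => forall_congr' fun hc => ?_
  have h1 : inner ℝ G ((hΦ.continuous.memLp_of_hasCompactSupport (p := 2) hc).toLp Φ)
      = ∫ x, inner ℝ (G x) (Φ x) := by
    rw [L2.inner_def]
    refine integral_congr_ae ?_
    filter_upwards [(hΦ.continuous.memLp_of_hasCompactSupport (μ := volume) (p := 2) hc).coeFn_toLp]
      with x hx
    rw [hx]
  have h2 : inner ℝ u ((memLp_rieszDiv hd hs0 hs1 hΦ hc).toLp (rieszDiv s Φ))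
      = ∫ x, u x * rieszDiv s Φ x := by
    rw [L2.inner_def]
    refine integral_congr_ae ?_
    filter_upwards [(memLp_rieszDiv hd hs0 hs1 hΦ hc).coeFn_toLp] with x hx
    rw [hx]
    simp [mul_comm]
  rw [h1, h2]

theorem IsFourierGradient.add {s : ℝ} {u v : L2 d} {G F : L2Vec d} (hu : Integrable u)
    (hv : Integrable v) (h : IsFourierGradient s u G) (h' : IsFourierGradient s v F) :
    IsFourierGradient s (u + v) (G + F) := by
  intro i
  have e : (𝓕 (compC i (G + F)) : L2C d) = 𝓕 (compC i G) + 𝓕 (compC i F) := by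
    rw [map_add]; exact map_add (Lp.fourierTransformₗᵢ (E d) ℂ) _ _
  rw [e, ft_congr_ae (Lp.coeFn_add u v)]
  filter_upwards [h i, h' i, Lp.coeFn_add (𝓕 (compC i G) : L2C d) (𝓕 (compC i F))] with ξ h1 h2 h3
  rw [h3, Pi.add_apply, h1, h2, ← mul_add]
  exact congrArg _ (ft_add hu hv ξ).symm

theorem IsFourierGradient.smul {s : ℝ} {u : L2 d} {G : L2Vec d} (c : ℝ)
    (h : IsFourierGradient s u G) : IsFourierGradient s (c • u) (c • G) := by
  intro i
  have e : (𝓕 (compC i (c • G)) : L2C d) = (c : ℂ) • 𝓕 (compC i G) := by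
    have : compC i (c • G) = (c : ℂ) • compC i G := by
      rw [map_smul]
      refine Lp.ext ?_
      filter_upwards [Lp.coeFn_smul c (compC i G), Lp.coeFn_smul (c : ℂ) (compC i G)] with x h1 h2
      rw [h1, h2]; simp
    rw [this]; exact map_smul (Lp.fourierTransformₗᵢ (E d) ℂ) _ _
  have e2 : ∀ ξ, ft (c • u : L2 d) ξ = c * ft u ξ := by
    intro ξ
    rw [ft_congr_ae (Lp.coeFn_smul c u), ft_apply, ft_apply, ← integral_const_mul]
    refine integral_congr_ae (Eventually.of_forall fun x => ?_)
    simp only [Pi.smul_apply, smul_eq_mul, ofReal_mul]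
    ring
  rw [e]
  filter_upwards [h i, Lp.coeFn_smul (c : ℂ) (𝓕 (compC i G) : L2C d)] with ξ h1 h2
  rw [h2, Pi.smul_apply, h1, e2, smul_eq_mul]
  ring

theorem IsFourierGradient.unique {s : ℝ} {u : L2 d} {G G' : L2Vec d}
    (h : IsFourierGradient s u G) (h' : IsFourierGradient s u G') : G = G' := by
  have := enorm_sub_sq_of_isFourierGradient h h'
  simp only [sub_self, zero_mul, enorm_zero] at this
  simpa [sub_eq_zero] using this

theorem IsFourierGradient.isRieszGradient (hd : 0 < d) {s : ℝ} (hs0 : 0 < s) (hs1 : s ≤ 1)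
    {u : L2 d} (hu : Integrable u) {G : L2Vec d} (h : IsFourierGradient s u G) :
    IsRieszGradient s u G := by
  have hE : energy s u < ⊤ := by rw [← h.enorm_sq hs0 hu]; exact ENNReal.pow_lt_top enorm_lt_top
  obtain ⟨G', h1, h2⟩ := exists_gradient_of_energy hd hs0 hs1 hu hE
  rwa [h.unique h2]

/-- For functions supported in Ω, evaluating the transform at ξ is a bounded functional, so weak
convergence suffices. -/
theorem SuppIn.ft_tendsto {Ω : Set (E d)} (hΩ : IsOpen Ω) (hb : Bornology.IsBounded Ω)
    {u : ℕ → L2 d} {v : L2 d} (hu : ∀ n, SuppIn Ω (u n)) (hv : SuppIn Ω v)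
    (h : ∀ z, Tendsto (fun n => inner ℝ (u n) z) atTop (𝓝 (inner ℝ v z))) (ξ : E d) :
    Tendsto (fun n => ft (u n) ξ) atTop (𝓝 (ft v ξ)) := by
  obtain ⟨L, hL, -⟩ := exists_ft_functional hΩ hb ξ
  rw [hL v hv]
  simp_rw [fun n => hL (u n) (hu n)]
  exact tendsto_functional_of_weak h L

theorem tendsto_of_enorm_sq {F : Type*} [NormedAddCommGroup F] {x : ℕ → F} {y : F}
    (h : Tendsto (fun n => ‖x n - y‖ₑ ^ 2) atTop (𝓝 0)) : Tendsto x atTop (𝓝 y) := by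
  rw [tendsto_iff_norm_sub_tendsto_zero]
  have h2 := (ENNReal.tendsto_toReal ENNReal.zero_ne_top).comp h
  have h3 : Tendsto (fun n => ‖x n - y‖ ^ 2) atTop (𝓝 0) := by
    refine h2.congr fun n => ?_
    simp [toReal_enorm]
  simpa using h3.sqrt

/-- The gradient of a test function. -/
theorem IsTestFunction.exists_gradient (hd : 0 < d) {Ω : Set (E d)} {φ : E d → ℝ}
    (h : IsTestFunction Ω φ) {s : ℝ} (hs0 : 0 < s) (hs1 : s ≤ 1) {u : L2 d} (hu : u =ᵐ[volume] φ) :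
    ∃ G : L2Vec d, IsFourierGradient s u G := by
  have hE : energy s u < ⊤ := by
    rw [energy_congr_ae hu]; exact energy_test_lt_top h.1 h.2.1 hs0 hs1
  obtain ⟨G, -, hG⟩ := exists_gradient_of_energy hd hs0 hs1 (h.integrable.congr hu.symm) hE
  exact ⟨G, hG⟩

/-- On a bounded Lipschitz domain, `H^s_0(Ω)` consists of the functions in `H^s` that vanish
outside `Ω`. -/
theorem mem_Hs0_iff (hd : 0 < d) {Ω : Set (E d)} (hΩ : IsOpen Ω) (hb : Bornology.IsBounded Ω)
    (hL : HasLipschitzBoundary Ω) {s : ℝ} (hs0 : 0 < s) (hs1 : s ≤ 1) {p : L2 d × L2Vec d} :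
    p ∈ Hs0 Ω s ↔ SuppIn Ω p.1 ∧ IsFourierGradient s p.1 p.2 := by
  constructor
  · rintro ⟨hp, hcl⟩
    obtain ⟨q, hq, hlim⟩ := mem_closure_iff_seq_limit.mp hcl
    have hlim1 : Tendsto (fun n => (q n).1) atTop (𝓝 p.1) := (continuous_fst.tendsto _).comp hlim
    have hlim2 : Tendsto (fun n => (q n).2) atTop (𝓝 p.2) := (continuous_snd.tendsto _).comp hlim
    have hqs : ∀ n, SuppIn Ω (q n).1 := fun n => by
      obtain ⟨-, φ, hφ, hφ'⟩ := hq n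
      exact hφ.suppIn hφ'
    have hps : SuppIn Ω p.1 :=
      (isClosed_suppIn Ω hΩ).mem_of_tendsto hlim1 (Eventually.of_forall hqs)
    refine ⟨hps, hp.isFourierGradient hd hs0 hs1 (hps.integrable hΩ hb) ?_⟩
    -- The convergent gradients are bounded, which bounds the energies, and lower semicontinuity at
    -- the constant order s passes this to the limit.
    obtain ⟨C, hC⟩ := (hlim2.norm).bddAbove_range
    refine (energy_le_of_tendsto (fun n => (hqs n).integrable hΩ hb)
      (SuppIn.ft_tendsto hΩ hb hqs hps fun z => hlim1.inner tendsto_const_nhds)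
      (s := fun _ => s) tendsto_const_nhds hs0 (C := ENNReal.ofReal C ^ 2) fun n => ?_).trans_lt
        (ENNReal.pow_lt_top ENNReal.ofReal_lt_top)
    obtain ⟨hr, φ, hφ, hφ'⟩ := hq n
    obtain ⟨G, hG⟩ := hφ.exists_gradient hd hs0 hs1 hφ'
    have hGq : (q n).2 = G := IsRieszGradient.unique hr
      (hG.isRieszGradient hd hs0 hs1 ((hqs n).integrable hΩ hb))
    rw [← hG.enorm_sq hs0 ((hqs n).integrable hΩ hb), ← hGq, ← ofReal_norm]
    gcongr
    exact hC ⟨n, rfl⟩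
  · rintro ⟨hps, hG⟩
    have hpi := hps.integrable hΩ hb
    have hE : energy s p.1 < ⊤ := by
      rw [← hG.enorm_sq hs0 hpi]; exact ENNReal.pow_lt_top enorm_lt_top
    refine ⟨hG.isRieszGradient hd hs0 hs1 hpi, ?_⟩
    obtain ⟨w, hw, hw1, hw2⟩ := exists_test_approx hΩ hb hL hs0 hs1 hps hE
    have hW : ∀ n, (hw n).memLp.toLp (w n) =ᵐ[volume] w n := fun n => (hw n).memLp.coeFn_toLp
    choose G' hG' using fun n => (hw n).exists_gradient hd hs0 hs1 (hW n)
    have hWi : ∀ n, Integrable ((hw n).memLp.toLp (w n) : L2 d) := fun n =>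
      (hw n).integrable.congr (hW n).symm
    refine mem_closure_of_tendsto (f := fun n => ((hw n).memLp.toLp (w n), G' n)) (b := atTop) ?_
      (Eventually.of_forall fun n =>
        ⟨(hG' n).isRieszGradient hd hs0 hs1 (hWi n), w n, hw n, hW n⟩)
    have hsub : ∀ n, ((hw n).memLp.toLp (w n) - p.1 : L2 d) =ᵐ[volume] fun x => w n x - p.1 x := by
      intro n
      filter_upwards [Lp.coeFn_sub ((hw n).memLp.toLp (w n)) p.1, hW n] with x h1 h2
      rw [h1, Pi.sub_apply, h2]
    refine Tendsto.prodMk_nhds (tendsto_of_enorm_sq (hw2.congr fun n => ?_))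
      (tendsto_of_enorm_sq (hw1.congr fun n => ?_))
    · rw [enorm_sq_eq_lintegral]
      refine lintegral_congr_ae ?_
      filter_upwards [hsub n] with x h1
      rw [h1]
    · have hF : IsFourierGradient s ((hw n).memLp.toLp (w n) - p.1) (G' n - p.2) := by
        have := (hG' n).add (v := (-1 : ℝ) • p.1) (hWi n)
          ((hpi.smul (-1 : ℝ)).congr (Lp.coeFn_smul (-1 : ℝ) p.1).symm) (hG.smul (-1))
        simpa [sub_eq_add_neg] using this
      have hFi : Integrable ((hw n).memLp.toLp (w n) - p.1 : L2 d) :=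
        ((hw n).integrable.sub hpi).congr (hsub n).symm
      rw [hF.enorm_sq hs0 hFi, energy_congr_ae (hsub n)]

end EnergySpace

end

end FracEigen

namespace FracEigen

noncomputable section

open Filter Topology Complex
open scoped FourierTransform ENNReal Real

/-! ### Poincaré and Rellich, uniformly in the order. -/

section Compactness

variable {d : ℕ}

/-- Chebyshev: for |ξ| ≥ R the energy weight is at least (2πR)^(2s). -/
theorem lintegral_tail_le {s R : ℝ} (hs : 0 < s) (hR : 0 < R) (u : E d → ℝ) :
    ∫⁻ ξ in (Metric.ball (0 : E d) R)ᶜ, ‖ft u ξ‖ₑ ^ 2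
      ≤ (ENNReal.ofReal ((2 * π * R) ^ (2 * s)))⁻¹ * energy s u := by
  have hc0 : ENNReal.ofReal ((2 * π * R) ^ (2 * s)) ≠ 0 := by
    rw [Ne, ENNReal.ofReal_eq_zero, not_le]; positivity
  have hc1 : ENNReal.ofReal ((2 * π * R) ^ (2 * s)) ≠ ⊤ := ENNReal.ofReal_ne_top
  rw [energy, ← lintegral_const_mul' _ _ (ENNReal.inv_ne_top.mpr hc0)]
  refine le_trans ?_ (setLIntegral_le_lintegral (Metric.ball (0 : E d) R)ᶜ _)
  refine setLIntegral_mono' Metric.isOpen_ball.measurableSet.compl fun ξ hξ => ?_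
  have hξ' : R ≤ ‖ξ‖ := by simpa using hξ
  rw [← mul_assoc]
  refine le_mul_of_one_le_left zero_le ?_
  rw [← ENNReal.inv_mul_cancel hc0 hc1]
  gcongr

/-- `|û(ξ)|² ≤ |Ω| ‖u‖²` for `u` supported in `Ω`. -/
theorem SuppIn.enorm_ft_sq_le {Ω : Set (E d)} (hΩ : IsOpen Ω) (hb : Bornology.IsBounded Ω) {u : L2 d}
    (hu : SuppIn Ω u) (ξ : E d) : ‖ft u ξ‖ₑ ^ 2 ≤ ENNReal.ofReal (volume.real Ω * ‖u‖ ^ 2) := by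
  obtain ⟨L, hL, hL'⟩ := exists_ft_functional hΩ hb ξ
  rw [hL u hu, enorm_sq_eq_ofReal]
  refine ENNReal.ofReal_le_ofReal ?_
  calc ‖L u‖ ^ 2 ≤ (√(volume.real Ω) * ‖u‖) ^ 2 := by gcongr; exact hL' u
    _ = _ := by rw [mul_pow, Real.sq_sqrt measureReal_nonneg]

theorem SuppIn.lintegral_ft_sq {Ω : Set (E d)} (hΩ : IsOpen Ω) (hb : Bornology.IsBounded Ω)
    {u : L2 d} (hu : SuppIn Ω u) : ∫⁻ ξ, ‖ft u ξ‖ₑ ^ 2 = ‖u‖ₑ ^ 2 := by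
  rw [FracEigen.lintegral_ft_sq (hu.integrable hΩ hb) (Lp.memLp u), enorm_sq_eq_lintegral]

theorem exists_ball_volume_mul_le (hd : 0 < d) (m : ℝ) (hm : 0 ≤ m) :
    ∃ ρ > 0, volume.real (Metric.ball (0 : E d) ρ) * m ≤ 1 / 2 := by
  set v := volume.real (Metric.ball (0 : E d) 1) with hv
  have hv0 : 0 ≤ v := measureReal_nonneg
  refine ⟨1 / (2 * (v * m + 1)), by positivity, ?_⟩
  set ρ := 1 / (2 * (v * m + 1)) with hρ
  have hρ0 : 0 < ρ := by positivity
  have hρ1 : ρ ≤ 1 := by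
    rw [hρ, div_le_one (by positivity)]; nlinarith [mul_nonneg hv0 hm]
  have h1 : volume.real (Metric.ball (0 : E d) ρ) = ρ ^ d * v := by
    rw [Measure.real, Measure.addHaar_ball_of_pos _ _ hρ0, ENNReal.toReal_mul,
      ENNReal.toReal_ofReal (by positivity), finrank_euclideanSpace_fin]; rfl
  have h2 : ρ ^ d ≤ ρ := pow_le_of_le_one hρ0.le hρ1 hd.ne'
  calc volume.real (Metric.ball (0 : E d) ρ) * m ≤ ρ * v * m := by rw [h1]; gcongr
    _ = (v * m) / (v * m + 1) * (1 / 2) := by rw [hρ]; field_simp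
    _ ≤ 1 * (1 / 2) := by
      gcongr
      rw [div_le_one (by positivity)]; linarith
    _ = 1 / 2 := one_mul _

/-- The Poincaré inequality, uniform in the order `s`. -/
theorem exists_poincare (hd : 0 < d) {Ω : Set (E d)} (hΩ : IsOpen Ω) (hb : Bornology.IsBounded Ω) :
    ∃ C : ℝ, 0 < C ∧ ∀ s : ℝ, 0 < s → s ≤ 1 → ∀ (u : L2 d) (G : L2Vec d), SuppIn Ω u →
      IsFourierGradient s u G → ‖u‖ ≤ C * ‖G‖ := by
  -- Frequencies below ρ carry at most |B_ρ||Ω|‖u‖² ≤ ‖u‖²/2, which is absorbed on the left; the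
  -- rest is bounded by the energy.
  obtain ⟨ρ, hρ, hball⟩ := exists_ball_volume_mul_le hd (volume.real Ω) measureReal_nonneg
  -- A lower bound for (2πρ)^(2s) valid for all s ∈ (0,1], whence the uniform constant.
  set c : ℝ := min 1 ((2 * π * ρ) ^ 2) with hc
  have hc0 : 0 < c := lt_min one_pos (by positivity)
  refine ⟨√(2 / c), by positivity, fun s hs0 hs1 u G hu hG => ?_⟩
  have hcs : c ≤ (2 * π * ρ) ^ (2 * s) := by
    rcases le_total 1 (2 * π * ρ) with h | h
    · exact (min_le_left _ _).trans (Real.one_le_rpow h (by positivity))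
    · refine (min_le_right _ _).trans ?_
      rw [← Real.rpow_natCast]
      exact Real.rpow_le_rpow_of_exponent_ge (by positivity) h (by push_cast; linarith)
  have h1 : ‖u‖ₑ ^ 2 ≤ ENNReal.ofReal (volume.real Ω * ‖u‖ ^ 2) * volume (Metric.ball (0 : E d) ρ)
      + (ENNReal.ofReal c)⁻¹ * ‖G‖ₑ ^ 2 := by
    rw [← hu.lintegral_ft_sq hΩ hb, ← lintegral_add_compl _
      (Metric.isOpen_ball (x := (0 : E d)) (ε := ρ)).measurableSet]
    gcongr
    · rw [← setLIntegral_const]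
      exact lintegral_mono fun ξ => hu.enorm_ft_sq_le hΩ hb ξ
    · refine (lintegral_tail_le hs0 hρ u).trans ?_
      rw [hG.enorm_sq hs0 (hu.integrable hΩ hb)]
      gcongr
  have hvol : volume (Metric.ball (0 : E d) ρ) = ENNReal.ofReal (volume.real (Metric.ball (0 : E d) ρ)) :=
    (ofReal_measureReal measure_ball_lt_top.ne).symm
  rw [hvol, enorm_sq_eq_ofReal, enorm_sq_eq_ofReal, ← ENNReal.ofReal_inv_of_pos hc0,
    ← ENNReal.ofReal_mul (by positivity), ← ENNReal.ofReal_mul (by positivity),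
    ← ENNReal.ofReal_add (by positivity) (by positivity),
    ENNReal.ofReal_le_ofReal_iff (by positivity)] at h1
  have h2 : ‖u‖ ^ 2 ≤ 2 / c * ‖G‖ ^ 2 := by
    have h3 : volume.real Ω * ‖u‖ ^ 2 * volume.real (Metric.ball (0 : E d) ρ) ≤ 1 / 2 * ‖u‖ ^ 2 := by
      calc _ = volume.real (Metric.ball (0 : E d) ρ) * volume.real Ω * ‖u‖ ^ 2 := by ring
        _ ≤ _ := by gcongr
    have h4 : 2 / c * ‖G‖ ^ 2 = 2 * (c⁻¹ * ‖G‖ ^ 2) := by ring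
    linarith
  refine le_of_sq_le_sq ?_ (by positivity)
  rwa [mul_pow, Real.sq_sqrt (by positivity)]

theorem enorm_sub_sq_le (a b : ℂ) : ‖a - b‖ₑ ^ 2 ≤ 2 * ‖a‖ₑ ^ 2 + 2 * ‖b‖ₑ ^ 2 := by
  simp_rw [enorm_sq_eq_ofReal]
  rw [← ENNReal.ofReal_ofNat 2, ← ENNReal.ofReal_mul two_pos.le, ← ENNReal.ofReal_mul two_pos.le,
    ← ENNReal.ofReal_add (by positivity) (by positivity)]
  refine ENNReal.ofReal_le_ofReal ?_
  have h1 := norm_sub_le a b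
  nlinarith [norm_nonneg (a - b), sq_nonneg (‖a‖ - ‖b‖)]

/-- Rellich compactness, uniform in the order. -/
theorem tendsto_of_weak_of_energy_le {Ω : Set (E d)} (hΩ : IsOpen Ω) (hb : Bornology.IsBounded Ω)
    {u : ℕ → L2 d} {v : L2 d} (hu : ∀ n, SuppIn Ω (u n)) (hv : SuppIn Ω v)
    (h : ∀ z, Tendsto (fun n => inner ℝ (u n) z) atTop (𝓝 (inner ℝ v z))) {M : ℝ}
    (hM : ∀ n, ‖u n‖ ≤ M) {σ : ℝ} (hσ : 0 < σ) {s : ℕ → ℝ} {s₀ : ℝ} (hs : ∀ n, σ ≤ s n)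
    (hs₀ : σ ≤ s₀) {C : ℝ≥0∞} (hC : C ≠ ⊤) (hCu : ∀ n, energy (s n) (u n) ≤ C)
    (hCv : energy s₀ v ≤ C) : Tendsto u atTop (𝓝 v) := by
  have hft := SuppIn.ft_tendsto hΩ hb hu hv h
  have hui := fun n => (hu n).integrable hΩ hb
  have hvi := hv.integrable hΩ hb
  have hns : ∀ n, SuppIn Ω (u n - v : L2 d) := fun n => by
    filter_upwards [hu n, hv, Lp.coeFn_sub (u n) v] with x h1 h2 h3 hx
    rw [h3, Pi.sub_apply, h1 hx, h2 hx, sub_zero]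
  have hsub : ∀ n ξ, ft (u n - v : L2 d) ξ = ft (u n) ξ - ft v ξ := fun n ξ => by
    rw [ft_congr_ae (Lp.coeFn_sub (u n) v)]
    exact ft_sub (hui n) hvi ξ
  refine tendsto_of_enorm_sq ?_
  -- High frequencies of u_n - v are uniformly small. For R ≥ 1 the base 2πR exceeds 1, so each
  -- order may be lowered to σ; 4C arises from |a - b|² ≤ 2|a|² + 2|b|².
  have htail : Tendsto (fun R : ℝ => (ENNReal.ofReal ((2 * π * R) ^ (2 * σ)))⁻¹ * (4 * C)) atTop (𝓝 0) := by
    have h1 : Tendsto (fun R : ℝ => (2 * π * R) ^ (2 * σ)) atTop atTop :=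
      (tendsto_rpow_atTop (by positivity)).comp (tendsto_id.const_mul_atTop (by positivity))
    have h2 : Tendsto (fun R : ℝ => (ENNReal.ofReal ((2 * π * R) ^ (2 * σ)))⁻¹) atTop (𝓝 0) := by
      rw [← ENNReal.inv_top]
      exact (ENNReal.tendsto_ofReal_atTop.comp h1).inv
    simpa using ENNReal.Tendsto.mul_const h2 (Or.inr (ENNReal.mul_ne_top (by simp) hC))
  rw [ENNReal.tendsto_atTop_zero]
  intro ε hε
  obtain ⟨R, hR, hRε⟩ := ((eventually_ge_atTop 1).and
    (htail.eventually (Iic_mem_nhds (ENNReal.half_pos hε.ne')))).exists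
  have hR0 : 0 < R := by linarith
  -- Low frequencies: the transforms converge pointwise and are uniformly bounded on a ball of
  -- finite measure.
  have hball : Tendsto (fun n => ∫⁻ ξ in Metric.ball (0 : E d) R, ‖ft (u n - v : L2 d) ξ‖ₑ ^ 2)
      atTop (𝓝 0) := by
    have hlim : Tendsto (fun n => ∫⁻ ξ in Metric.ball (0 : E d) R, ‖ft (u n - v : L2 d) ξ‖ₑ ^ 2)
        atTop (𝓝 (∫⁻ ξ in Metric.ball (0 : E d) R, 0)) := by
      refine tendsto_lintegral_of_dominated_convergence
        (fun _ => ENNReal.ofReal (volume.real Ω * (M + ‖v‖) ^ 2)) (fun n => ?_)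
        (fun n => Eventually.of_forall fun ξ => ?_) ?_ (Eventually.of_forall fun ξ => ?_)
      · exact ((continuous_ft ((hns n).integrable hΩ hb)).measurable.enorm.pow_const 2)
      · refine ((hns n).enorm_ft_sq_le hΩ hb ξ).trans (ENNReal.ofReal_le_ofReal ?_)
        gcongr
        exact (norm_sub_le _ _).trans (by gcongr; exact hM n)
      · rw [setLIntegral_const]
        exact ENNReal.mul_ne_top ENNReal.ofReal_ne_top measure_ball_lt_top.ne
      · have h1 : Tendsto (fun n => ft (u n - v : L2 d) ξ) atTop (𝓝 0) := by
          simp_rw [hsub]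
          simpa using (hft ξ).sub_const (ft v ξ)
        simpa using ENNReal.Tendsto.pow (n := 2) h1.enorm
    simpa using hlim
  obtain ⟨N, hN⟩ := (ENNReal.tendsto_atTop_zero.mp hball) (ε / 2) (ENNReal.half_pos hε.ne')
  refine ⟨N, fun n hn => ?_⟩
  have htl : ∀ (r : ℝ) (w : E d → ℝ), σ ≤ r → energy r w ≤ C →
      ∫⁻ ξ in (Metric.ball (0 : E d) R)ᶜ, ‖ft w ξ‖ₑ ^ 2
        ≤ (ENNReal.ofReal ((2 * π * R) ^ (2 * σ)))⁻¹ * C := by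
    intro r w hr hw
    refine (lintegral_tail_le (hσ.trans_le hr) hR0 w).trans ?_
    have : (1 : ℝ) ≤ 2 * π * R := by nlinarith [Real.pi_gt_three]
    gcongr
  rw [← (hns n).lintegral_ft_sq hΩ hb, ← lintegral_add_compl _
      (Metric.isOpen_ball (x := (0 : E d)) (ε := R)).measurableSet, ← ENNReal.add_halves ε]
  refine add_le_add (hN n hn) (le_trans ?_ hRε)
  have hpt : ∀ ξ, ‖ft (u n - v : L2 d) ξ‖ₑ ^ 2 ≤ 2 * ‖ft (u n) ξ‖ₑ ^ 2 + 2 * ‖ft v ξ‖ₑ ^ 2 := by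
    intro ξ
    rw [hsub]
    exact enorm_sub_sq_le _ _
  calc _ ≤ ∫⁻ ξ in (Metric.ball (0 : E d) R)ᶜ, (2 * ‖ft (u n) ξ‖ₑ ^ 2 + 2 * ‖ft v ξ‖ₑ ^ 2) :=
        lintegral_mono hpt
    _ = 2 * (∫⁻ ξ in (Metric.ball (0 : E d) R)ᶜ, ‖ft (u n) ξ‖ₑ ^ 2)
        + 2 * ∫⁻ ξ in (Metric.ball (0 : E d) R)ᶜ, ‖ft v ξ‖ₑ ^ 2 := by
      have hm := (continuous_ft (hui n)).measurable.enorm.pow_const 2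
      have hm' := (continuous_ft hvi).measurable.enorm.pow_const 2
      rw [lintegral_add_left (hm.const_mul 2), lintegral_const_mul _ hm, lintegral_const_mul _ hm']
    _ ≤ 2 * ((ENNReal.ofReal ((2 * π * R) ^ (2 * σ)))⁻¹ * C)
        + 2 * ((ENNReal.ofReal ((2 * π * R) ^ (2 * σ)))⁻¹ * C) := by
      gcongr
      · exact htl _ _ (hs n) (hCu n)
      · exact htl _ _ hs₀ hCv
    _ = _ := by ring

end Compactness

end

end FracEigen

namespace FracEigen

noncomputable section

open Filter Topology
open scoped ENNReal Real

/-! ### The coefficient matrix as an operator on L² fields. -/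

section Coefficients

variable {d : ℕ}

/-- Polarisation with w = Mz: by symmetry 4|w|²/a₂ is the difference of the form at z + w/a₂ and at
z - w/a₂, hence at most a₂(|z| + |w|/a₂)². Taking roots, 2|w| ≤ a₂|z| + |w|. -/
theorem norm_toEuclideanLin_le {M : Matrix (Fin d) (Fin d) ℝ} (hM : M.IsSymm) {a₁ a₂ : ℝ}
    (ha₁ : 0 < a₁) (h : ∀ z : E d, a₁ * ‖z‖ ^ 2 ≤ inner ℝ (Matrix.toEuclideanLin M z) z ∧
      inner ℝ (Matrix.toEuclideanLin M z) z ≤ a₂ * ‖z‖ ^ 2) (z : E d) :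
    ‖Matrix.toEuclideanLin M z‖ ≤ a₂ * ‖z‖ := by
  rcases eq_or_ne z 0 with rfl | hz
  · simp
  have hz' : 0 < ‖z‖ := norm_pos_iff.mpr hz
  have ha₂ : 0 < a₂ := by
    have := (h z).1.trans (h z).2
    exact ha₁.trans_le (le_of_mul_le_mul_right this (by positivity))
  have hsym : (Matrix.toEuclideanLin M).IsSymmetric :=
    Matrix.isSymmetric_toEuclideanLin_iff.mpr (by rwa [Matrix.IsHermitian, Matrix.conjTranspose_eq_transpose_of_trivial])
  set w := Matrix.toEuclideanLin M z with hw
  have hp := (h (z + a₂⁻¹ • w)).2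
  have hm := (h (z - a₂⁻¹ • w)).1
  have hpm : inner ℝ (Matrix.toEuclideanLin M (z + a₂⁻¹ • w)) (z + a₂⁻¹ • w)
      - inner ℝ (Matrix.toEuclideanLin M (z - a₂⁻¹ • w)) (z - a₂⁻¹ • w) = 4 * (a₂⁻¹ * ‖w‖ ^ 2) := by
    have e : inner ℝ (Matrix.toEuclideanLin M w) z = ‖w‖ ^ 2 := by
      rw [hsym w z, ← hw, real_inner_self_eq_norm_sq]
    simp only [map_add, map_sub, map_smul, inner_add_left, inner_add_right, inner_sub_left,
      inner_sub_right, inner_smul_left, inner_smul_right, e, ← hw, real_inner_self_eq_norm_sq,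
      conj_trivial]
    ring
  have hn : ‖z + a₂⁻¹ • w‖ ≤ ‖z‖ + a₂⁻¹ * ‖w‖ := by
    refine (norm_add_le _ _).trans_eq ?_
    rw [norm_smul, Real.norm_of_nonneg (by positivity)]
  have h0 : 0 ≤ a₁ * ‖z - a₂⁻¹ • w‖ ^ 2 := by positivity
  have h1 : 4 * (a₂⁻¹ * ‖w‖ ^ 2) ≤ a₂ * (‖z‖ + a₂⁻¹ * ‖w‖) ^ 2 := by
    have : a₂ * ‖z + a₂⁻¹ • w‖ ^ 2 ≤ a₂ * (‖z‖ + a₂⁻¹ * ‖w‖) ^ 2 := by gcongr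
    linarith
  have h2 : (2 * ‖w‖) ^ 2 ≤ (a₂ * ‖z‖ + ‖w‖) ^ 2 := by
    have e1 : a₂ * (4 * (a₂⁻¹ * ‖w‖ ^ 2)) = (2 * ‖w‖) ^ 2 := by field_simp; ring
    have e2 : a₂ * (a₂ * (‖z‖ + a₂⁻¹ * ‖w‖) ^ 2) = (a₂ * ‖z‖ + ‖w‖) ^ 2 := by field_simp
    rw [← e1, ← e2]
    gcongr
  have h3 := abs_le_of_sq_le_sq h2 (by positivity)
  linarith [le_abs_self (2 * ‖w‖)]

/-- Multiplication by the coefficient matrix, as a bounded, symmetric and coercive operator. -/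
theorem exists_coefficient_operator {A : E d → Matrix (Fin d) (Fin d) ℝ}
    (hA_meas : ∀ i j, Measurable fun x => A x i j) (hA_symm : ∀ᵐ x, (A x).IsSymm) {a₁ a₂ : ℝ}
    (ha₁ : 0 < a₁) (hA_ell : ∀ᵐ x, ∀ z : E d,
      a₁ * ‖z‖ ^ 2 ≤ inner ℝ (Matrix.toEuclideanLin (A x) z) z ∧
        inner ℝ (Matrix.toEuclideanLin (A x) z) z ≤ a₂ * ‖z‖ ^ 2) :
    ∃ 𝒜 : L2Vec d →L[ℝ] L2Vec d,
      (∀ G F : L2Vec d, ∫ x, inner ℝ (Matrix.toEuclideanLin (A x) (G x)) (F x) = inner ℝ (𝒜 G) F) ∧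
      (∀ G F : L2Vec d, inner ℝ (𝒜 G) F = inner ℝ G (𝒜 F)) ∧
      ∀ G : L2Vec d, a₁ * ‖G‖ ^ 2 ≤ inner ℝ (𝒜 G) G := by
  have hbd : ∀ G : L2Vec d, ∀ᵐ x, ‖Matrix.toEuclideanLin (A x) (G x)‖ ≤ a₂ * ‖G x‖ := by
    intro G
    filter_upwards [hA_symm, hA_ell] with x h1 h2
    exact norm_toEuclideanLin_le h1 ha₁ h2 _
  have hmeas : ∀ G : L2Vec d,
      AEStronglyMeasurable (fun x => Matrix.toEuclideanLin (A x) (G x)) volume := by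
    intro G
    refine AEMeasurable.aestronglyMeasurable ?_
    refine (MeasurableEquiv.toLp 2 (Fin d → ℝ)).measurable.comp_aemeasurable
      (f := fun x => (A x).mulVec (WithLp.ofLp (G x))) ?_
    refine aemeasurable_pi_lambda _ fun i => ?_
    simp only [Matrix.mulVec, dotProduct]
    refine Finset.aemeasurable_fun_sum _ fun j _ => ?_
    refine (hA_meas i j).aemeasurable.mul ?_
    exact ((EuclideanSpace.proj (𝕜 := ℝ) j).continuous.measurable.comp_aemeasurable
      (Lp.aestronglyMeasurable G).aemeasurable)
  have hmem : ∀ G : L2Vec d, MemLp (fun x => Matrix.toEuclideanLin (A x) (G x)) 2 volume :=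
    fun G => (Lp.memLp G).of_le_mul (hmeas G) (hbd G)
  let 𝒜ₗ : L2Vec d →ₗ[ℝ] L2Vec d :=
    { toFun := fun G => (hmem G).toLp _
      map_add' := fun G F => by
        refine Lp.ext ?_
        filter_upwards [(hmem (G + F)).coeFn_toLp, (hmem G).coeFn_toLp, (hmem F).coeFn_toLp,
          Lp.coeFn_add ((hmem G).toLp _) ((hmem F).toLp _), Lp.coeFn_add G F] with x h1 h2 h3 h4 h5
        rw [h1, h4, Pi.add_apply, h2, h3, h5, Pi.add_apply, map_add]
      map_smul' := fun c G => by
        refine Lp.ext ?_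
        filter_upwards [(hmem (c • G)).coeFn_toLp, (hmem G).coeFn_toLp,
          Lp.coeFn_smul c ((hmem G).toLp _), Lp.coeFn_smul c G] with x h1 h2 h3 h4
        rw [RingHom.id_apply, h1, h3, Pi.smul_apply, h2, h4, Pi.smul_apply, map_smul] }
  have h𝒜 : ∀ G, 𝒜ₗ G =ᵐ[volume] fun x => Matrix.toEuclideanLin (A x) (G x) :=
    fun G => (hmem G).coeFn_toLp
  have hinner : ∀ G F : L2Vec d,
      inner ℝ (𝒜ₗ G) F = ∫ x, inner ℝ (Matrix.toEuclideanLin (A x) (G x)) (F x) := by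
    intro G F
    rw [L2.inner_def]
    refine integral_congr_ae ?_
    filter_upwards [h𝒜 G] with x hx
    rw [hx]
  refine ⟨𝒜ₗ.mkContinuous a₂ fun G => ?_, fun G F => (hinner G F).symm, fun G F => ?_, fun G => ?_⟩
  · refine Lp.norm_le_mul_norm_of_ae_le_mul ?_
    filter_upwards [h𝒜 G, hbd G] with x h1 h2
    rwa [h1]
  · change inner ℝ (𝒜ₗ G) F = inner ℝ G (𝒜ₗ F)
    rw [real_inner_comm (𝒜ₗ F), hinner, hinner]
    refine integral_congr_ae ?_
    filter_upwards [hA_symm] with x hx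
    have hsym : (Matrix.toEuclideanLin (A x)).IsSymmetric :=
      Matrix.isSymmetric_toEuclideanLin_iff.mpr
        (by rwa [Matrix.IsHermitian, Matrix.conjTranspose_eq_transpose_of_trivial])
    rw [real_inner_comm (G x)]
    exact hsym _ _
  · change _ ≤ inner ℝ (𝒜ₗ G) G
    rw [← real_inner_self_eq_norm_sq, L2.inner_def, L2.inner_def, ← integral_const_mul]
    refine integral_mono_ae ((L2.integrable_inner G G).const_mul _) (L2.integrable_inner (𝒜ₗ G) G) ?_
    filter_upwards [h𝒜 G, hA_ell] with x h1 h2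
    rw [h1, real_inner_self_eq_norm_sq]
    exact (h2 _).1

end Coefficients

/-! ### Stability of weak solutions under varying order and data. -/

section Solutions

variable {d : ℕ}

/-- The restriction `L²(ℝᵈ) → L²(Ω)`. -/
abbrev restr (Ω : Set (E d)) : L2 d →L[ℝ] L2On Ω := LpToLpRestrictCLM (E d) ℝ ℝ volume 2 Ω

theorem norm_restr_le (Ω : Set (E d)) (u : L2 d) : ‖restr Ω u‖ ≤ ‖u‖ := norm_Lp_toLp_restrict_le Ω u

/-- `p = (u, D^s u)` solves the problem with right-hand side `h`, in terms of the operator `𝒜` of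
multiplication by the coefficients. -/
def Solves (Ω : Set (E d)) (𝒜 : L2Vec d →L[ℝ] L2Vec d) (s : ℝ) (h : L2On Ω) (p : L2 d × L2Vec d) :
    Prop :=
  p ∈ Hs0 Ω s ∧ ∀ q ∈ Hs0 Ω s, inner ℝ (𝒜 p.2) q.2 = inner ℝ h (restr Ω q.1)

theorem inner_restr (Ω : Set (E d)) (h : L2On Ω) (u : L2 d) :
    inner ℝ h (restr Ω u) = ∫ x in Ω, h x * u x := by
  rw [L2.inner_def]
  refine integral_congr_ae ?_
  filter_upwards [LpToLpRestrictCLM_coeFn ℝ Ω u] with x hx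
  rw [hx]
  simp [mul_comm]

theorem suppIn_of_weak {Ω : Set (E d)} (hΩ : IsOpen Ω) {u : ℕ → L2 d} {v : L2 d}
    (hu : ∀ n, SuppIn Ω (u n))
    (h : ∀ z, Tendsto (fun n => inner ℝ (u n) z) atTop (𝓝 (inner ℝ v z))) : SuppIn Ω v := by
  simp_rw [suppIn_iff hΩ] at hu ⊢
  set R := LpToLpRestrictCLM (E d) ℝ ℝ volume 2 Ωᶜ
  refine ext_inner_right ℝ fun w => ?_
  have h1 := h (R.adjoint w)
  simp_rw [ContinuousLinearMap.adjoint_inner_right, hu] at h1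
  exact tendsto_nhds_unique h1 (by simp)

/-- Solutions depend continuously on the order and on the right-hand side, even for weak
convergence of the latter. -/
theorem exists_subseq_solves (hd : 0 < d) {Ω : Set (E d)} (hΩ : IsOpen Ω)
    (hb : Bornology.IsBounded Ω) (hL : HasLipschitzBoundary Ω) {𝒜 : L2Vec d →L[ℝ] L2Vec d}
    (hsymm : ∀ G F, inner ℝ (𝒜 G) F = inner ℝ G (𝒜 F)) {a₁ : ℝ} (ha₁ : 0 < a₁)
    (hcoer : ∀ G, a₁ * ‖G‖ ^ 2 ≤ inner ℝ (𝒜 G) G) {σ : ℝ} (hσ : 0 < σ) {s : ℕ → ℝ} {s₀ : ℝ}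
    (hs : ∀ n, s n ∈ Icc σ 1) (hs₀ : s₀ ∈ Icc σ 1) (hlim : Tendsto s atTop (𝓝 s₀))
    {h : ℕ → L2On Ω} {h₀ : L2On Ω} {M : ℝ} (hM : ∀ n, ‖h n‖ ≤ M)
    (hh : ∀ z, Tendsto (fun n => inner ℝ (h n) z) atTop (𝓝 (inner ℝ h₀ z)))
    {p : ℕ → L2 d × L2Vec d} (hp : ∀ n, Solves Ω 𝒜 (s n) (h n) (p n)) :
    ∃ φ : ℕ → ℕ, StrictMono φ ∧ ∃ q, Solves Ω 𝒜 s₀ h₀ q ∧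
      Tendsto (fun n => (p (φ n)).1) atTop (𝓝 q.1) := by
  obtain ⟨C, hC, hpoinc⟩ := exists_poincare hd hΩ hb
  have hs0 : ∀ n, 0 < s n := fun n => hσ.trans_le (hs n).1
  have hs1 : ∀ n, s n ≤ 1 := fun n => (hs n).2
  have h₀0 : 0 < s₀ := hσ.trans_le hs₀.1
  have hM0 : 0 ≤ M := (norm_nonneg _).trans (hM 0)
  have hmem := fun n => (mem_Hs0_iff hd hΩ hb hL (hs0 n) (hs1 n)).mp (hp n).1
  have hpi := fun n => (hmem n).1.integrable hΩ hb
  -- Test the equation with its own solution; the uniform Poincaré constant makes the bound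
  -- independent of n.
  have hG : ∀ n, ‖(p n).2‖ ≤ M * C / a₁ := by
    intro n
    have h1 : a₁ * ‖(p n).2‖ ^ 2 ≤ M * (C * ‖(p n).2‖) := by
      refine (hcoer _).trans ?_
      rw [(hp n).2 _ (hp n).1]
      refine (real_inner_le_norm _ _).trans ?_
      gcongr
      · exact hM n
      · exact (norm_restr_le Ω _).trans (hpoinc _ (hs0 n) (hs1 n) _ _ (hmem n).1 (hmem n).2)
    rcases (norm_nonneg (p n).2).eq_or_lt with h0 | h0
    · rw [← h0]; positivity
    · rw [le_div_iff₀ ha₁]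
      refine le_of_mul_le_mul_right ?_ h0
      linarith
  have hu : ∀ n, ‖(p n).1‖ ≤ C * (M * C / a₁) := fun n =>
    (hpoinc _ (hs0 n) (hs1 n) _ _ (hmem n).1 (hmem n).2).trans (by gcongr; exact hG n)
  have : Fact ((2 : ℝ≥0∞) ≠ ⊤) := ⟨ENNReal.ofNat_ne_top⟩
  obtain ⟨G, φ₁, hφ₁, hGlim⟩ := exists_weak_limit hG
  obtain ⟨u, φ₂, hφ₂, hulim⟩ := exists_weak_limit fun n => hu (φ₁ n)
  set φ := φ₁ ∘ φ₂
  have hφ : StrictMono φ := hφ₁.comp hφ₂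
  replace hGlim : ∀ z, Tendsto (fun n => inner ℝ (p (φ n)).2 z) atTop (𝓝 (inner ℝ G z)) :=
    fun z => (hGlim z).comp hφ₂.tendsto_atTop
  replace hlim : Tendsto (fun n => s (φ n)) atTop (𝓝 s₀) := hlim.comp hφ.tendsto_atTop
  have husupp : SuppIn Ω u := suppIn_of_weak hΩ (fun n => (hmem (φ n)).1) hulim
  have hui := husupp.integrable hΩ hb
  have hE : ∀ n, energy (s n) (p n).1 ≤ ENNReal.ofReal (M * C / a₁) ^ 2 := by
    intro n
    rw [← (hmem n).2.enorm_sq (hs0 n) (hpi n), ← ofReal_norm]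
    gcongr
    exact hG n
  have hEu : energy s₀ u ≤ ENNReal.ofReal (M * C / a₁) ^ 2 :=
    energy_le_of_tendsto (fun n => hpi (φ n))
      (SuppIn.ft_tendsto hΩ hb (fun n => (hmem (φ n)).1) husupp hulim) hlim h₀0 fun n => hE (φ n)
  have hfin : ENNReal.ofReal (M * C / a₁) ^ 2 < ⊤ := ENNReal.pow_lt_top ENNReal.ofReal_lt_top
  -- In the pairing of u_n with D^(s_n)·Φ the first factor converges weakly and the second strongly,
  -- so the weak limit of the gradients is the gradient of order s₀.
  have hgrad : IsRieszGradient s₀ u G := by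
    rw [isRieszGradient_iff hd h₀0 hs₀.2]
    intro Φ hΦ hc
    have h1 := hGlim ((hΦ.continuous.memLp_of_hasCompactSupport (p := 2) hc).toLp Φ)
    have h2 := (tendsto_inner_of_weak_of_strong (fun n => hu (φ n)) hulim
      (tendsto_rieszDiv hd hlim (fun n => hs0 (φ n)) (fun n => hs1 (φ n)) h₀0 hs₀.2 hΦ hc)).neg
    refine tendsto_nhds_unique h1 (h2.congr fun n => ?_)
    exact ((isRieszGradient_iff hd (hs0 (φ n)) (hs1 (φ n))).mp (hp (φ n)).1.1 Φ hΦ hc).symm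
  have hFG := hgrad.isFourierGradient hd h₀0 hs₀.2 hui (hEu.trans_lt hfin)
  refine ⟨φ, hφ, (u, G), ⟨(mem_Hs0_iff hd hΩ hb hL h₀0 hs₀.2).mpr ⟨husupp, hFG⟩, fun q hq => ?_⟩,
    tendsto_of_weak_of_energy_le hΩ hb (fun n => (hmem (φ n)).1) husupp hulim (fun n => hu (φ n)) hσ
      (fun n => (hs (φ n)).1) hs₀.1 hfin.ne (fun n => hE (φ n)) hEu⟩
  -- It suffices to check the limit equation on test functions: they lie in H^s_0(Ω) for every
  -- order, whereas a general q in the space of order s₀ need not be admissible at order s_n.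
  have hclosed : IsClosed {q : L2 d × L2Vec d | inner ℝ (𝒜 G) q.2 = inner ℝ h₀ (restr Ω q.1)} :=
    isClosed_eq (by fun_prop) (by fun_prop)
  refine closure_minimal (fun r hr => ?_) hclosed hq.2
  obtain ⟨hr, ψ, hψ, hrψ⟩ := hr
  have hri : Integrable r.1 := hψ.integrable.congr hrψ.symm
  have hr₀ : IsFourierGradient s₀ r.1 r.2 := by
    obtain ⟨F, hF⟩ := hψ.exists_gradient hd h₀0 hs₀.2 hrψ
    rwa [IsRieszGradient.unique hr (hF.isRieszGradient hd h₀0 hs₀.2 hri)]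
  choose F hF using fun n => hψ.exists_gradient hd (hs0 (φ n)) (hs1 (φ n)) hrψ
  have hFlim : Tendsto F atTop (𝓝 r.2) := tendsto_gradient_test hlim (fun n => hs0 (φ n))
    (fun n => hs1 (φ n)) h₀0 hs₀.2 hψ.1 hψ.2.1 hrψ hF hr₀
  have h1 := tendsto_inner_of_weak_of_strong (fun n => hG (φ n)) hGlim
    ((𝒜.continuous.tendsto _).comp hFlim)
  have h2 := (hh (restr Ω r.1)).comp hφ.tendsto_atTop
  change inner ℝ (𝒜 G) r.2 = inner ℝ h₀ (restr Ω r.1)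
  -- Symmetry moves `𝒜` onto the strongly convergent gradients of the test function.
  rw [hsymm]
  refine tendsto_nhds_unique h1 (h2.congr fun n => ?_)
  have h3 := (hp (φ n)).2 (r.1, F n)
    ((mem_Hs0_iff hd hΩ hb hL (hs0 (φ n)) (hs1 (φ n))).mpr ⟨hψ.suppIn hrψ, hF n⟩)
  simp only [Function.comp_apply]
  rw [← hsymm, h3]

end Solutions

end

end FracEigen

namespace FracEigen

noncomputable section

open Filter Topology
open scoped ENNReal Real

/-! ### The solution operators: existence, compactness, positivity, norm continuity. -/

section SolutionOperator

variable {d : ℕ}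

/-- The standing assumptions on the domain and on the operator `𝒜` of multiplication by the
coefficients. -/
structure IsAdmissible (Ω : Set (E d)) (𝒜 : L2Vec d →L[ℝ] L2Vec d) (a₁ : ℝ) : Prop where
  dim_pos : 0 < d
  isOpen : IsOpen Ω
  isBounded : Bornology.IsBounded Ω
  lipschitz : HasLipschitzBoundary Ω
  symm : ∀ G F, inner ℝ (𝒜 G) F = inner ℝ G (𝒜 F)
  pos : 0 < a₁
  coercive : ∀ G, a₁ * ‖G‖ ^ 2 ≤ inner ℝ (𝒜 G) G

variable {Ω : Set (E d)} {𝒜 : L2Vec d →L[ℝ] L2Vec d} {a₁ : ℝ} {s : ℝ}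

theorem IsAdmissible.mem_Hs0_iff (H : IsAdmissible Ω 𝒜 a₁) (hs0 : 0 < s) (hs1 : s ≤ 1)
    {p : L2 d × L2Vec d} : p ∈ Hs0 Ω s ↔ SuppIn Ω p.1 ∧ IsFourierGradient s p.1 p.2 :=
  FracEigen.mem_Hs0_iff H.dim_pos H.isOpen H.isBounded H.lipschitz hs0 hs1

theorem IsAdmissible.add_mem (H : IsAdmissible Ω 𝒜 a₁) (hs0 : 0 < s) (hs1 : s ≤ 1)
    {p q : L2 d × L2Vec d} (hp : p ∈ Hs0 Ω s) (hq : q ∈ Hs0 Ω s) : p + q ∈ Hs0 Ω s := by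
  rw [H.mem_Hs0_iff hs0 hs1] at hp hq ⊢
  refine ⟨?_, hp.2.add (hp.1.integrable H.isOpen H.isBounded)
    (hq.1.integrable H.isOpen H.isBounded) hq.2⟩
  filter_upwards [hp.1, hq.1, Lp.coeFn_add p.1 q.1] with x h1 h2 h3 hx
  rw [Prod.fst_add, h3, Pi.add_apply, h1 hx, h2 hx, add_zero]

theorem IsAdmissible.smul_mem (H : IsAdmissible Ω 𝒜 a₁) (hs0 : 0 < s) (hs1 : s ≤ 1) (c : ℝ)
    {p : L2 d × L2Vec d} (hp : p ∈ Hs0 Ω s) : c • p ∈ Hs0 Ω s := by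
  rw [H.mem_Hs0_iff hs0 hs1] at hp ⊢
  refine ⟨?_, hp.2.smul c⟩
  filter_upwards [hp.1, Lp.coeFn_smul c p.1] with x h1 h3 hx
  rw [Prod.smul_fst, h3, Pi.smul_apply, h1 hx, smul_zero]

theorem IsTestFunction.exists_mem_Hs0 (H : IsAdmissible Ω 𝒜 a₁) (hs0 : 0 < s) (hs1 : s ≤ 1)
    {φ : E d → ℝ} (hφ : IsTestFunction Ω φ) : ∃ p ∈ Hs0 Ω s, p.1 =ᵐ[volume] φ := by
  obtain ⟨G, hG⟩ := hφ.exists_gradient H.dim_pos hs0 hs1 hφ.memLp.coeFn_toLp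
  exact ⟨(hφ.memLp.toLp φ, G),
    (H.mem_Hs0_iff hs0 hs1).mpr ⟨hφ.suppIn hφ.memLp.coeFn_toLp, hG⟩, hφ.memLp.coeFn_toLp⟩

theorem IsAdmissible.isClosed_Hs0 (H : IsAdmissible Ω 𝒜 a₁) (hs0 : 0 < s) (hs1 : s ≤ 1) :
    IsClosed (Hs0 Ω s) := by
  refine IsClosed.inter ?_ isClosed_closure
  simp_rw [Hs, isRieszGradient_iff H.dim_pos hs0 hs1, ofPred_forall]
  exact isClosed_iInter fun Φ => isClosed_iInter fun hΦ => isClosed_iInter fun hc =>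
    isClosed_eq (by fun_prop) (by fun_prop)

theorem Solves.eq_of_rhs_eq (H : IsAdmissible Ω 𝒜 a₁) (hs0 : 0 < s) (hs1 : s ≤ 1) {h : L2On Ω}
    {p q : L2 d × L2Vec d} (hp : Solves Ω 𝒜 s h p) (hq : Solves Ω 𝒜 s h q) : p.1 = q.1 := by
  have hr : p + (-1 : ℝ) • q ∈ Hs0 Ω s := H.add_mem hs0 hs1 hp.1 (H.smul_mem hs0 hs1 (-1) hq.1)
  set r := p + (-1 : ℝ) • q with hrdef
  have h2 : inner ℝ (𝒜 r.2) r.2 = 0 := by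
    have e : 𝒜 r.2 = 𝒜 p.2 - 𝒜 q.2 := by simp [hrdef, sub_eq_add_neg]
    rw [e, inner_sub_left, hp.2 r hr, hq.2 r hr, sub_self]
  have h3 : ‖r.2‖ = 0 := by
    have h4 := H.coercive r.2
    rw [h2] at h4
    have h5 : ‖r.2‖ ^ 2 ≤ 0 := nonpos_of_mul_nonpos_right h4 H.pos
    exact pow_eq_zero_iff two_ne_zero |>.mp (le_antisymm h5 (sq_nonneg _))
  obtain ⟨C, -, hC⟩ := exists_poincare H.dim_pos H.isOpen H.isBounded
  have hr' := (H.mem_Hs0_iff hs0 hs1).mp hr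
  have h6 := hC s hs0 hs1 _ _ hr'.1 hr'.2
  rw [h3, mul_zero] at h6
  have h7 : r.1 = 0 := norm_le_zero_iff.mp h6
  simpa [hrdef, sub_eq_add_neg, add_neg_eq_zero] using h7

/-- `T` maps `h` to the solution with right-hand side `h`. -/
def IsSolver (Ω : Set (E d)) (𝒜 : L2Vec d →L[ℝ] L2Vec d) (s : ℝ) (T : L2On Ω →L[ℝ] L2On Ω) : Prop :=
  ∀ h, ∃ p, Solves Ω 𝒜 s h p ∧ restr Ω p.1 = T h

/-- The functional ⟨h, J·⟩ is represented by J*h, so S is the inverse of the operator of the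
coercive form composed with J*. -/
theorem exists_lax_milgram {V W K : Type*} [NormedAddCommGroup V] [InnerProductSpace ℝ V]
    [CompleteSpace V] [NormedAddCommGroup W] [InnerProductSpace ℝ W] [NormedAddCommGroup K]
    [InnerProductSpace ℝ K] [CompleteSpace K] (B : W →L[ℝ] W) (P : V →L[ℝ] W) (J : V →L[ℝ] K)
    {c : ℝ} (hc : 0 < c) (hB : ∀ v, c * ‖v‖ ^ 2 ≤ inner ℝ (B (P v)) (P v)) :
    ∃ S : K →L[ℝ] V, ∀ h w, inner ℝ (B (P (S h))) (P w) = inner ℝ h (J w) := by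
  let b : V →L[ℝ] V →L[ℝ] ℝ := LinearMap.mkContinuous₂
    (LinearMap.mk₂ ℝ (fun v w => inner ℝ (B (P v)) (P w))
      (fun v v' w => by simp only [map_add, inner_add_left])
      (fun c v w => by simp only [map_smul, real_inner_smul_left, smul_eq_mul])
      (fun v w w' => by simp only [map_add, inner_add_right])
      (fun c v w => by simp only [map_smul, real_inner_smul_right, smul_eq_mul]))
    (‖B‖ * ‖P‖ * ‖P‖) fun v w => by
      change ‖inner ℝ (B (P v)) (P w)‖ ≤ _
      refine (norm_inner_le_norm _ _).trans ?_
      calc ‖B (P v)‖ * ‖P w‖ ≤ (‖B‖ * (‖P‖ * ‖v‖)) * (‖P‖ * ‖w‖) := by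
            gcongr
            · exact B.le_opNorm_of_le (P.le_opNorm v)
            · exact P.le_opNorm w
        _ = _ := by ring
  have hb : ∀ v w, b v w = inner ℝ (B (P v)) (P w) := fun v w => rfl
  have hcoer : IsCoercive b := ⟨c, hc, fun v => by rw [hb, mul_assoc, ← pow_two]; exact hB v⟩
  let S : V ≃L[ℝ] V := hcoer.continuousLinearEquivOfBilin
  refine ⟨(S.symm : V →L[ℝ] V).comp J.adjoint, fun h w => ?_⟩
  have h1 : inner ℝ (S (S.symm (J.adjoint h))) w = b (S.symm (J.adjoint h)) w :=
    hcoer.continuousLinearEquivOfBilin_apply _ w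
  rw [S.apply_symm_apply, ContinuousLinearMap.adjoint_inner_left, hb] at h1
  exact h1.symm

/-- Existence of solutions, by the Lax–Milgram theorem. -/
theorem IsAdmissible.exists_operator (H : IsAdmissible Ω 𝒜 a₁) (hs0 : 0 < s) (hs1 : s ≤ 1) :
    ∃ T : L2On Ω →L[ℝ] L2On Ω, IsSolver Ω 𝒜 s T := by
  -- The L² product norm, not the sup norm of the plain product, makes the space of pairs a Hilbert
  -- space.
  let V : Submodule ℝ (WithLp 2 (L2 d × L2Vec d)) :=
    { carrier := {x | WithLp.ofLp x ∈ Hs0 Ω s}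
      add_mem' := fun hx hy => H.add_mem hs0 hs1 hx hy
      zero_mem' := by
        obtain ⟨p, hp, -⟩ := IsTestFunction.exists_mem_Hs0 H hs0 hs1 (φ := 0)
          ⟨contDiff_const, HasCompactSupport.zero, by simp⟩
        have := H.smul_mem hs0 hs1 0 hp
        rw [zero_smul] at this
        exact this
      smul_mem' := fun c x hx => H.smul_mem hs0 hs1 c hx }
  have hVc : IsClosed (V : Set (WithLp 2 (L2 d × L2Vec d))) :=
    (H.isClosed_Hs0 hs0 hs1).preimage (WithLp.prod_continuous_ofLp 2 _ _)
  have : CompleteSpace V := hVc.completeSpace_coe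
  let P₁ : V →L[ℝ] L2 d := (WithLp.fstL 2 ℝ (L2 d) (L2Vec d)).comp V.subtypeL
  let P₂ : V →L[ℝ] L2Vec d := (WithLp.sndL 2 ℝ (L2 d) (L2Vec d)).comp V.subtypeL
  have hPmem : ∀ v : V, (P₁ v, P₂ v) ∈ Hs0 Ω s := fun v => v.2
  obtain ⟨C, hC0, hC⟩ := exists_poincare H.dim_pos H.isOpen H.isBounded
  -- By Poincaré ‖v‖² = ‖u‖² + ‖D^s u‖² ≤ (C² + 1)‖D^s u‖².
  have hcoer : ∀ v, a₁ / (C ^ 2 + 1) * ‖v‖ ^ 2 ≤ inner ℝ (𝒜 (P₂ v)) (P₂ v) := by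
    intro v
    refine le_trans ?_ (H.coercive (P₂ v))
    have hn : ‖v‖ ^ 2 = ‖P₁ v‖ ^ 2 + ‖P₂ v‖ ^ 2 :=
      WithLp.prod_norm_sq_eq_of_L2 (v : WithLp 2 (L2 d × L2Vec d))
    have hv := (H.mem_Hs0_iff hs0 hs1).mp (hPmem v)
    have h1 : ‖P₁ v‖ ^ 2 ≤ (C * ‖P₂ v‖) ^ 2 := by
      gcongr
      exact hC s hs0 hs1 _ _ hv.1 hv.2
    have h2 : ‖v‖ ^ 2 ≤ (C ^ 2 + 1) * ‖P₂ v‖ ^ 2 := by rw [hn]; linarith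
    calc a₁ / (C ^ 2 + 1) * ‖v‖ ^ 2 ≤ a₁ / (C ^ 2 + 1) * ((C ^ 2 + 1) * ‖P₂ v‖ ^ 2) :=
          mul_le_mul_of_nonneg_left h2 (div_nonneg H.pos.le (by positivity))
      _ = a₁ * ‖P₂ v‖ ^ 2 := by field_simp
  obtain ⟨S, hS⟩ := exists_lax_milgram 𝒜 P₂ ((restr Ω).comp P₁) (div_pos H.pos (by positivity)) hcoer
  refine ⟨((restr Ω).comp P₁).comp S, fun h => ⟨(P₁ (S h), P₂ (S h)), ⟨hPmem _, fun q hq => ?_⟩, rfl⟩⟩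
  exact hS h ⟨WithLp.toLp 2 q, hq⟩

/-- An element of H^s_0(Ω) vanishes off Ω, so it is the zero extension of its restriction. -/
theorem IsAdmissible.isWeakSolution_iff (H : IsAdmissible Ω 𝒜 a₁)
    {A : E d → Matrix (Fin d) (Fin d) ℝ}
    (hA : ∀ G F : L2Vec d, ∫ x, inner ℝ (Matrix.toEuclideanLin (A x) (G x)) (F x) = inner ℝ (𝒜 G) F)
    (hs0 : 0 < s) (hs1 : s ≤ 1) {h u : L2On Ω} :
    IsWeakSolution Ω A s h u ↔ ∃ p, Solves Ω 𝒜 s h p ∧ restr Ω p.1 = u := by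
  simp only [IsWeakSolution, Solves, hA, ← inner_restr]
  refine ⟨fun ⟨p, hp, hpu, heq⟩ => ⟨p, ⟨hp, heq⟩, ?_⟩, fun ⟨p, ⟨hp, heq⟩, hpu⟩ => ⟨p, hp, ?_, heq⟩⟩
  · refine Lp.ext ?_
    filter_upwards [LpToLpRestrictCLM_coeFn ℝ Ω p.1, ae_restrict_of_ae hpu,
      ae_restrict_mem H.isOpen.measurableSet] with x h1 h2 hx
    rw [h1, h2, indicator_of_mem hx]
  · have h1 := (ae_restrict_iff' H.isOpen.measurableSet).mp (LpToLpRestrictCLM_coeFn ℝ Ω p.1)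
    filter_upwards [h1, ((H.mem_Hs0_iff hs0 hs1).mp hp).1] with x h2 h3
    by_cases hx : x ∈ Ω
    · rw [indicator_of_mem hx, ← h2 hx, ← hpu]
    · rw [indicator_of_notMem hx, h3 hx]

theorem Solves.restr_eq (H : IsAdmissible Ω 𝒜 a₁) (hs0 : 0 < s) (hs1 : s ≤ 1)
    {T : L2On Ω →L[ℝ] L2On Ω} (hT : IsSolver Ω 𝒜 s T) {h : L2On Ω} {p : L2 d × L2Vec d}
    (hp : Solves Ω 𝒜 s h p) : restr Ω p.1 = T h := by
  obtain ⟨q, hq, hq'⟩ := hT h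
  rw [← hq', hp.eq_of_rhs_eq H hs0 hs1 hq]

/-- Testing each equation with the other solution gives ⟨Th, k⟩ = ⟨𝒜 D^s q, D^s p⟩ and ⟨h, Tk⟩ = ⟨𝒜
D^s p, D^s q⟩. -/
theorem IsSolver.isSymmetric (H : IsAdmissible Ω 𝒜 a₁) {T : L2On Ω →L[ℝ] L2On Ω}
    (hT : IsSolver Ω 𝒜 s T) : (T : L2On Ω →ₗ[ℝ] L2On Ω).IsSymmetric := by
  intro h k
  obtain ⟨p, hp, hp'⟩ := hT h
  obtain ⟨q, hq, hq'⟩ := hT k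
  change inner ℝ (T h) k = inner ℝ h (T k)
  rw [← hp', ← hq', real_inner_comm, ← hq.2 p hp.1, ← hp.2 q hq.1, H.symm, real_inner_comm]

theorem eq_zero_of_forall_test (hΩ : IsOpen Ω) (hb : Bornology.IsBounded Ω) {h : L2On Ω}
    (hh : ∀ φ : E d → ℝ, IsTestFunction Ω φ → ∫ x in Ω, h x * φ x = 0) : h = 0 := by
  have : IsFiniteMeasure (volume.restrict Ω) := ⟨by simpa using hb.measure_lt_top⟩
  have hint : IntegrableOn h Ω := (Lp.memLp h).integrable one_le_two
  rw [Lp.eq_zero_iff_ae_eq_zero]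
  refine (ae_restrict_iff' hΩ.measurableSet).mpr
    (hΩ.ae_eq_zero_of_integral_contDiff_smul_eq_zero hint.locallyIntegrableOn fun g h1 h2 h3 => ?_)
  rw [← hh g ⟨h1, h2, h3⟩, ← setIntegral_eq_integral_of_forall_compl_eq_zero (s := Ω)]
  · simp [mul_comm]
  · intro x hx
    rw [image_eq_zero_of_notMem_tsupport fun hmem => hx (h3 hmem), zero_smul]

/-- ⟨Th, h⟩ = ⟨𝒜 D^s p, D^s p⟩ ≥ a₁‖D^s p‖². If D^s p = 0, the equation makes h orthogonal to all
test functions, so h = 0. -/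
theorem IsSolver.inner_pos (H : IsAdmissible Ω 𝒜 a₁) (hs0 : 0 < s) (hs1 : s ≤ 1)
    {T : L2On Ω →L[ℝ] L2On Ω} (hT : IsSolver Ω 𝒜 s T) (h : L2On Ω) (hh : h ≠ 0) :
    0 < inner ℝ (T h) h := by
  obtain ⟨p, hp, hp'⟩ := hT h
  rw [← hp', real_inner_comm, ← hp.2 p hp.1]
  refine lt_of_lt_of_le ?_ (H.coercive _)
  have hpos := H.pos
  have : p.2 ≠ 0 := by
    intro h0
    refine hh (eq_zero_of_forall_test H.isOpen H.isBounded fun φ hφ => ?_)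
    obtain ⟨q, hq, hqφ⟩ := hφ.exists_mem_Hs0 H hs0 hs1
    have h1 := hp.2 q hq
    rw [h0, map_zero, inner_zero_left, inner_restr] at h1
    rw [h1]
    refine integral_congr_ae ?_
    filter_upwards [ae_restrict_of_ae hqφ] with x hx
    rw [hx]
  positivity

theorem IsAdmissible.exists_subseq_tendsto (H : IsAdmissible Ω 𝒜 a₁) {σ : ℝ} (hσ : 0 < σ)
    {s : ℕ → ℝ} {s₀ : ℝ} (hs : ∀ n, s n ∈ Icc σ 1) (hs₀ : s₀ ∈ Icc σ 1)
    (hlim : Tendsto s atTop (𝓝 s₀)) {T : ℕ → L2On Ω →L[ℝ] L2On Ω} {T₀ : L2On Ω →L[ℝ] L2On Ω}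
    (hT : ∀ n, IsSolver Ω 𝒜 (s n) (T n)) (hT₀ : IsSolver Ω 𝒜 s₀ T₀)
    {h : ℕ → L2On Ω} {h₀ : L2On Ω} {M : ℝ} (hM : ∀ n, ‖h n‖ ≤ M)
    (hh : ∀ z, Tendsto (fun n => inner ℝ (h n) z) atTop (𝓝 (inner ℝ h₀ z))) :
    ∃ φ : ℕ → ℕ, StrictMono φ ∧ Tendsto (fun n => T (φ n) (h (φ n))) atTop (𝓝 (T₀ h₀)) := by
  choose p hp hp' using fun n => hT n (h n)
  obtain ⟨φ, hφ, q, hq, hlim'⟩ := exists_subseq_solves H.dim_pos H.isOpen H.isBounded H.lipschitz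
    H.symm H.pos H.coercive hσ hs hs₀ hlim hM hh hp
  refine ⟨φ, hφ, ?_⟩
  rw [← hq.restr_eq H (hσ.trans_le hs₀.1) hs₀.2 hT₀]
  refine (((restr Ω).continuous.tendsto _).comp hlim').congr fun n => ?_
  exact hp' (φ n)

theorem norm_le_of_weak {F : Type*} [NormedAddCommGroup F] [InnerProductSpace ℝ F] {x : ℕ → F}
    {y : F} {C : ℝ} (hC : ∀ n, ‖x n‖ ≤ C)
    (h : ∀ v, Tendsto (fun n => inner ℝ (x n) v) atTop (𝓝 (inner ℝ y v))) : ‖y‖ ≤ C := by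
  rcases (norm_nonneg y).eq_or_lt with h0 | h0
  · rw [← h0]; exact (norm_nonneg _).trans (hC 0)
  · refine le_of_mul_le_mul_right ?_ h0
    rw [← pow_two, ← real_inner_self_eq_norm_sq]
    refine le_of_tendsto' (h y) fun n => (real_inner_le_norm _ _).trans ?_
    gcongr
    exact hC n

/-- Stability at constant order: weakly convergent data have strongly convergent images along a
subsequence. The weak limit stays in the unit ball, so the image of the closed ball is itself
compact. -/
theorem IsSolver.isCompactOperator (H : IsAdmissible Ω 𝒜 a₁) (hs0 : 0 < s) (hs1 : s ≤ 1)
    {T : L2On Ω →L[ℝ] L2On Ω} (hT : IsSolver Ω 𝒜 s T) : IsCompactOperator T := by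
  have : Fact ((2 : ℝ≥0∞) ≠ ⊤) := ⟨ENNReal.ofNat_ne_top⟩
  refine (isCompactOperator_iff_exists_mem_nhds_image_subset_compact _).mpr
    ⟨Metric.closedBall 0 1, Metric.closedBall_mem_nhds 0 one_pos, _, ?_, subset_rfl⟩
  refine IsSeqCompact.isCompact fun y hy => ?_
  choose h hball hy using hy
  have hn : ∀ n, ‖h n‖ ≤ 1 := fun n => by simpa using hball n
  obtain ⟨h₀, φ, hφ, hw⟩ := exists_weak_limit hn
  obtain ⟨ψ, hψ, hlim⟩ := H.exists_subseq_tendsto hs0 (s := fun _ => s) (fun _ => ⟨le_rfl, hs1⟩)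
    ⟨le_rfl, hs1⟩ tendsto_const_nhds (fun _ => hT) hT (fun n => hn (φ n)) hw
  refine ⟨T h₀, ⟨h₀, by simpa using norm_le_of_weak (fun n => hn (φ n)) hw, rfl⟩, φ ∘ ψ, hφ.comp hψ, ?_⟩
  exact hlim.congr fun n => hy (φ (ψ n))

/-- The solution operators depend continuously on the order, in the operator norm. -/
theorem IsAdmissible.tendsto_operator (H : IsAdmissible Ω 𝒜 a₁) {σ : ℝ} (hσ : 0 < σ)
    {s : ℕ → ℝ} {s₀ : ℝ} (hs : ∀ n, s n ∈ Icc σ 1) (hs₀ : s₀ ∈ Icc σ 1)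
    (hlim : Tendsto s atTop (𝓝 s₀)) {T : ℕ → L2On Ω →L[ℝ] L2On Ω} {T₀ : L2On Ω →L[ℝ] L2On Ω}
    (hT : ∀ n, IsSolver Ω 𝒜 (s n) (T n)) (hT₀ : IsSolver Ω 𝒜 s₀ T₀) :
    Tendsto T atTop (𝓝 T₀) := by
  have : Fact ((2 : ℝ≥0∞) ≠ ⊤) := ⟨ENNReal.ofNat_ne_top⟩
  refine tendsto_of_subseq_tendsto fun ns hns => ?_
  -- Near-maximisers of the operator norm; the factor 2 allows for the supremum not being attained.
  have hex : ∀ n, ∃ h : L2On Ω, ‖h‖ ≤ 1 ∧ ‖T (ns n) - T₀‖ ≤ 2 * ‖(T (ns n) - T₀) h‖ := by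
    intro n
    rcases (norm_nonneg (T (ns n) - T₀)).eq_or_lt with h0 | h0
    · exact ⟨0, by simp, by rw [← h0]; positivity⟩
    · obtain ⟨h, h1, h2⟩ := ContinuousLinearMap.exists_lt_apply_of_lt_opNorm (T (ns n) - T₀)
        (half_lt_self h0)
      exact ⟨h, h1.le, by linarith⟩
  choose h hn hle using hex
  obtain ⟨h₀, φ, hφ, hw⟩ := exists_weak_limit hn
  obtain ⟨ψ, hψ, hlim₁⟩ := H.exists_subseq_tendsto hσ (s := fun n => s (ns (φ n))) (fun n => hs _) hs₀
    (hlim.comp (hns.comp hφ.tendsto_atTop)) (fun n => hT (ns (φ n))) hT₀ (fun n => hn (φ n)) hw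
  -- A second use at the constant order s₀: both T_n h_n and T₀ h_n tend to T₀ h₀, so their
  -- difference tends to 0.
  obtain ⟨χ, hχ, hlim₂⟩ := H.exists_subseq_tendsto hσ (s := fun _ => s₀) (fun _ => hs₀) hs₀
    tendsto_const_nhds (fun _ => hT₀) hT₀ (fun n => hn (φ (ψ n)))
    fun z => (hw z).comp hψ.tendsto_atTop
  refine ⟨φ ∘ ψ ∘ χ, ?_⟩
  rw [tendsto_iff_norm_sub_tendsto_zero]
  have h1 := ((hlim₁.comp hχ.tendsto_atTop).sub hlim₂).norm.const_mul 2
  rw [sub_self, norm_zero, mul_zero] at h1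
  exact squeeze_zero (fun n => norm_nonneg _) (fun n => hle (φ (ψ (χ n)))) h1

/-- Polynomials in one coordinate embed into L²(Ω): one that vanishes almost everywhere on Ω
vanishes on a segment by continuity, hence has infinitely many roots. -/
theorem not_finiteDimensional_L2On (hd : 0 < d) (hΩ : IsOpen Ω) (hb : Bornology.IsBounded Ω)
    (hne : Ω.Nonempty) : ¬ FiniteDimensional ℝ (L2On Ω) := by
  intro hfin
  have : IsFiniteMeasure (volume.restrict Ω) := ⟨by simpa using hb.measure_lt_top⟩
  let i₀ : Fin d := ⟨0, hd⟩
  have hcont : ∀ P : Polynomial ℝ, Continuous fun x : E d => P.eval (x i₀) := fun P =>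
    P.continuous.comp (EuclideanSpace.proj (𝕜 := ℝ) i₀).continuous
  have hmem : ∀ P : Polynomial ℝ, MemLp (fun x : E d => P.eval (x i₀)) 2 (volume.restrict Ω) := by
    intro P
    obtain ⟨C, hC⟩ := hb.isCompact_closure.exists_bound_of_continuousOn (hcont P).continuousOn
    refine MemLp.of_bound (hcont P).aestronglyMeasurable C ?_
    filter_upwards [ae_restrict_mem hΩ.measurableSet] with x hx
    exact hC x (subset_closure hx)
  let L : Polynomial ℝ →ₗ[ℝ] L2On Ω :=
    { toFun := fun P => (hmem P).toLp _
      map_add' := fun P Q => by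
        rw [← MemLp.toLp_add]
        congr 1
        funext x; simp
      map_smul' := fun c P => by
        rw [RingHom.id_apply, ← MemLp.toLp_const_smul]
        congr 1
        funext x; simp }
  have hinj : Function.Injective L := by
    rw [← LinearMap.ker_eq_bot, LinearMap.ker_eq_bot']
    intro P hP
    have h1 : (fun x : E d => P.eval (x i₀)) =ᵐ[volume.restrict Ω] fun _ => 0 :=
      (hmem P).coeFn_toLp.symm.trans ((Lp.eq_zero_iff_ae_eq_zero).mp hP)
    have h2 := Measure.eqOn_open_of_ae_eq h1 hΩ (hcont P).continuousOn continuousOn_const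
    obtain ⟨x, hx⟩ := hne
    have hnhds : {t : ℝ | x + t • EuclideanSpace.single i₀ (1 : ℝ) ∈ Ω} ∈ 𝓝 (0 : ℝ) := by
      have hc : Continuous fun t : ℝ => x + t • EuclideanSpace.single i₀ (1 : ℝ) := by fun_prop
      exact hc.continuousAt.preimage_mem_nhds (hΩ.mem_nhds (by simpa using hx))
    refine P.eq_zero_of_infinite_isRoot
      (((infinite_of_mem_nhds 0 hnhds).image (f := fun t => x i₀ + t) (by simp [InjOn])).mono ?_)
    rintro _ ⟨t, ht, rfl⟩
    have h3 := h2 ht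
    simpa using h3
  exact Polynomial.not_finite (R := ℝ) (Module.Finite.of_injective L hinj)

end SolutionOperator

end

end FracEigen

/-! ### The main theorem. -/

theorem corollaryC2 {d : ℕ} (hd : 0 < d)
    (Ω : Set (FracEigen.E d)) (hΩ_open : IsOpen Ω) (hΩ_bdd : Bornology.IsBounded Ω)
    (hΩ_ne : Ω.Nonempty) (hΩ_lip : FracEigen.HasLipschitzBoundary Ω)
    (A : FracEigen.E d → Matrix (Fin d) (Fin d) ℝ)
    (hA_meas : ∀ i j, Measurable fun x => A x i j)
    (hA_symm : ∀ᵐ x, (A x).IsSymm)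
    (a₁ a₂ : ℝ) (ha₁ : 0 < a₁)
    (hA_ell : ∀ᵐ x, ∀ z : FracEigen.E d,
      a₁ * ‖z‖ ^ 2 ≤ inner ℝ (Matrix.toEuclideanLin (A x) z) z ∧
        inner ℝ (Matrix.toEuclideanLin (A x) z) z ≤ a₂ * ‖z‖ ^ 2)
    (σ : ℝ) (hσ₀ : 0 < σ) (hσ₁ : σ ≤ 1) :
    -- the solutions, the operators `T^s` and their eigenvalue sequences are well defined
    (∀ s ∈ Icc σ 1, (∀ h, ∃! u, FracEigen.IsWeakSolution Ω A s h u) ∧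
      ∃ T : FracEigen.L2On Ω →L[ℝ] FracEigen.L2On Ω,
        FracEigen.IsSolutionOperator Ω A s T ∧ ∃! lam, FracEigen.IsEigenvalueSequence T lam) ∧
    ∀ (T : ℝ → FracEigen.L2On Ω →L[ℝ] FracEigen.L2On Ω) (lam : ℝ → ℕ → ℝ),
      (∀ s ∈ Icc σ 1, FracEigen.IsSolutionOperator Ω A s (T s)) →
      (∀ s ∈ Icc σ 1, FracEigen.IsEigenvalueSequence (T s) (lam s)) →
      (∀ k, ∀ s ∈ Icc σ 1, ∀ r ∈ Icc σ 1, |lam s k - lam r k| ≤ ‖T s - T r‖) ∧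
      (∀ k, ∀ s ∈ Icc σ 1, 0 < lam s k) ∧
      ∀ k, ContinuousOn (fun s => lam s k) (Icc σ 1) := by
  obtain ⟨𝒜, hA, hsymm, hcoer⟩ :=
    FracEigen.exists_coefficient_operator hA_meas hA_symm ha₁ hA_ell
  have H : FracEigen.IsAdmissible Ω 𝒜 a₁ :=
    ⟨hd, hΩ_open, hΩ_bdd, hΩ_lip, hsymm, ha₁, hcoer⟩
  have hinf := FracEigen.not_finiteDimensional_L2On hd hΩ_open hΩ_bdd hΩ_ne
  have hs0 : ∀ s ∈ Icc σ 1, 0 < s := fun s hs => hσ₀.trans_le hs.1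
  refine ⟨fun s hs => ?_, fun T lam hT hlam => ?_⟩
  · obtain ⟨T, hT⟩ := H.exists_operator (hs0 s hs) hs.2
    have hiff := fun h u => H.isWeakSolution_iff hA (hs0 s hs) hs.2 (h := h) (u := u)
    refine ⟨fun h => ⟨T h, (hiff h _).mpr (hT h), fun u hu => ?_⟩, T,
      fun h => (hiff h _).mpr (hT h),
      FracEigen.existsUnique_isEigenvalueSequence hinf (hT.isCompactOperator H (hs0 s hs) hs.2)
        (hT.isSymmetric H) (hT.inner_pos H (hs0 s hs) hs.2)⟩
    obtain ⟨p, hp, hpu⟩ := (hiff h u).mp hu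
    rw [← hpu, hp.restr_eq H (hs0 s hs) hs.2 hT]
  -- Any family meeting the weak formulation consists of solvers, so the results apply to the given
  -- `T` and not only to the operators constructed above.
  · have hsol : ∀ s ∈ Icc σ 1, FracEigen.IsSolver Ω 𝒜 s (T s) := fun s hs h =>
      (H.isWeakSolution_iff hA (hs0 s hs) hs.2).mp (hT s hs h)
    have hcp := fun s hs => (hsol s hs).isCompactOperator H (hs0 s hs) hs.2
    have hsy := fun s hs => (hsol s hs).isSymmetric H
    have hps := fun s hs => (hsol s hs).inner_pos H (hs0 s hs) hs.2
    have hweyl : ∀ k, ∀ s ∈ Icc σ 1, ∀ r ∈ Icc σ 1, |lam s k - lam r k| ≤ ‖T s - T r‖ :=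
      fun k s hs r hr => FracEigen.abs_eigenvalue_sub_le (hcp s hs) (hsy s hs) (hps s hs)
        (hcp r hr) (hsy r hr) (hps r hr) (hlam s hs) (hlam r hr) k
    refine ⟨hweyl, fun k s hs => (hlam s hs).pos (hcp s hs) (hsy s hs) (hps s hs) k, fun k => ?_⟩
    rw [continuousOn_iff_continuous_domRestrict]
    refine SeqContinuous.continuous fun x y hxy => ?_
    have hop : Filter.Tendsto (fun n => T (x n)) Filter.atTop (nhds (T y)) :=
      H.tendsto_operator hσ₀ (fun n => (x n).2) y.2 ((continuous_subtype_val.tendsto y).comp hxy)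
        (fun n => hsol _ (x n).2) (hsol _ y.2)
    rw [tendsto_iff_norm_sub_tendsto_zero] at hop ⊢
    exact squeeze_zero (fun n => norm_nonneg _) (fun n => hweyl k _ (x n).2 _ y.2) hop
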